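/- Let $\lambda>0$, let $\mathbb M=[0,1]^{\mathbb N\times\mathbb N}$ with the infinite product $\mathbb Q$ of Lebesgue measures on $[0,1]$, and let $\hat\eta$, defined on a probability space $(\Omega,\mathcal F,\mathbb P)$, be a Poisson point process on $\mathbb S=\mathbb R^d\times[0,1]\times\mathbb M$, $d\ge 1$, with intensity measure $\lambda\,\ell_d\otimes\ell\otimes\mathbb Q$ (Lebesgue measures $\ell_d$ on $\mathbb R^d$ and $\ell$ on $[0,1]$). A point $(x,t,(u_{i,j}))\in\mathbb S$ has location $x$, birth time $t$ and marks $u_{i,j}$. Put $\hat\Omega=\Omega\times\mathbb M$, $\hat{\mathbb P}=\mathbb P\otimes\mathbb Q$, with expectation $\hat{\mathbb E}$; the second coordinate is denoted $M$. Fix an enumeration $\{B_n\}_{n\in\mathbb N}$ of the unit lattice cubes $\prod_i[k_i,k_i+1)$, $k\in\mathbb Z^d$. Let $(\mathbb R^d)^{[2]}$ be the set of unordered pairs of distinct points of $\mathbb R^d$. For $\eta\subset\mathbb S$ locally finite with distinct birth times, $T(\eta)\subset(\mathbb R^d)^{[2]}\times[0,1]$ is the complete graph with marked edges in which, for two points $(x,t,(u_{i,j}))$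 and $(y,s,(v_{i,j}))$ of $\eta$ with $t<s$, the first being the $m$-th oldest point of $\eta$ in $B_n$, the edge $\{x,y\}$ has mark $v_{m,n}$. For $W\subset\mathbb R^d$, $\eta|_W$ consists of the points of $\eta$ with location in $W$. Let $f$ be a measurable real functional of the finite subsets of $(\mathbb R^d)^{[2]}\times[0,1]$, and for $(x,t,M)\in\mathbb S$ and finite $\eta\subset\mathbb S$ let $$D_{(x,t,M)}(\eta)=f\big(T(\eta\cup\{(x,t,M)\})\big)-f\big(T(\eta\cup\{(x,t,M)\})\setminus\{x\}\big),$$ where $\setminus\{x\}$ removes the vertex $x$ and all edges at $x$. A cube is a set $\prod_{i=1}^d[x_i,x_i+l)$ with $l>0$; a sequence of cubes tends to $\mathbb R^d$ if it eventually contains every ball. Assume that $f$ is weakly stabilizing, that is, $f$ is invariant under translations of $\mathbb R^d$ and there is a random variable $\Delta_1$ on $\hat\Omega$ with $D_{(\mathbf 0,1,M)}(\hat\eta|_{W_n})\to\Delta_1$ in $\hat{\mathbb P}$-probability for every sequence of cubes $W_n$ tending to $\mathbb R^d$; and that $f$ satisfies the moment condition $$\sup_{\mathbf 0\in W:\ \text{cube}}\hat{\mathbb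 E}\big[|D_{(\mathbf 0,1,M)}(\hat\eta|_W)|^p\big]<\infty\quad\text{for some }p>2 .$$ Then $f(T(\hat\eta|_W))$ is square integrable for every cube $W$. For every $t\in[0,1]$ there is a ($\hat{\mathbb P}$-a.s. unique) random variable $\Delta_t$ on $\hat\Omega$, the limit add-one cost of a point born at time $t$, such that $D_{(\mathbf 0,t,M)}(\hat\eta|_{W_n})\to\Delta_t$ in $\hat{\mathbb P}$-probability for every sequence of cubes $W_n$ tending to $\mathbb R^d$; it lies in $L^2(\hat{\mathbb P})$. Let $\hat\eta_t$ be the restriction of $\hat\eta$ to $\mathbb R^d\times[0,t)\times\mathbb M$, and let $\mathbb E[\Delta_t\mid\hat\eta_t]$ be the conditional expectation of $\Delta_t$ given $\hat\eta_t$ with $M$ kept fixed, i.e. given the $\sigma$-field on $\hat\Omega$ generated by $\hat\eta_t$ and $M$. Then $t\mapsto\hat{\mathbb E}[\mathbb E[\Delta_t\mid\hat\eta_t]^2]$ is integrable on $[0,1]$ and, for every sequence of cubes $W_n$ tending to $\mathbb R^d$, $$\frac{\operatorname{Var}[f(T(\hat\eta|_{W_n}))]}{|W_n|}\longrightarrow\sigma^2:=\lambda\int_0^1\hat{\mathbb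 E}\big[\mathbb E[\Delta_t\mid\hat\eta_t]^2\big]\,dt ,$$ where $|W|$ is the volume of $W$. Moreover, if $\hat{\mathbb P}(\Delta_1\ne0)>0$, then $\sigma^2>0$. -/

import Mathlib

open MeasureTheory ProbabilityTheory Filter Topology
open scoped ENNReal NNReal unitInterval

namespace MarkedPoisson

noncomputable section

/-! ### Locally finite configurations and Poisson point processes -/

/-- `N(X)`: the locally finite subsets of a topological space `X`, i.e. the subsets having
finitely many points in every compact set. -/
structure Config (X : Type*) [TopologicalSpace X] where
  carrier : Set X
  locallyFinite : ∀ K : Set X, IsCompact K → (carrier ∩ K).Finite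

namespace Config

variable {X : Type*} [TopologicalSpace X]

/-- The number `η(A) ∈ {0, 1, 2, …, ∞}` of points of `η` in `A`. -/
def count (η : Config X) (A : Set X) : ℕ∞ := (η.carrier ∩ A).encard

/-- The restriction of a configuration to a set. -/
def restrict (η : Config X) (A : Set X) : Config X where
  carrier := η.carrier ∩ A
  locallyFinite K hK :=
    (η.locallyFinite K hK).subset fun _ h => ⟨h.1.1, h.2⟩

/-- The usual sigma-field on `N(X)`, generated by the counts `η ↦ η(A)`, `A` measurable. -/
instance [MeasurableSpace X] : MeasurableSpace (Config X) :=
  ⨆ (A : Set X) (_ : MeasurableSet A),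
    MeasurableSpace.comap (fun η : Config X => η.count A) inferInstance

end Config

/-- `η` is a (simple) Poisson point process on `X` with intensity measure `μ`, defined on the
probability space `(Ω, P)`. -/
structure IsPoissonProcess {Ω X : Type*} [MeasurableSpace Ω] [TopologicalSpace X]
    [MeasurableSpace X] (P : Measure Ω) (η : Ω → Config X) (μ : Measure X) : Prop where
  measurable : Measurable η
  law_count : ∀ A : Set X, MeasurableSet A → μ A < ∞ → ∀ k : ℕ,
    P {ω | (η ω).count A = k} = poissonMeasure (μ A).toNNReal {k}
  indep : ∀ (n : ℕ) (A : Fin n → Set X), (∀ i, MeasurableSet (A i)) →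
    Pairwise (fun i j => Disjoint (A i) (A j)) →
    iIndepFun (fun i ω => (η ω).count (A i)) P

/-! ### The marked space `𝕊 = ℝ^d × [0,1] × [0,1]^(ℕ × ℕ)` -/

/-- `𝕄 = [0,1]^(ℕ × ℕ)`. -/
abbrev Marks : Type := ℕ × ℕ → I

/-- `ℚ`, the infinite product of the Lebesgue measure on `[0,1]`. -/
def marksMeasure : Measure Marks := Measure.infinitePi fun _ : ℕ × ℕ => (volume : Measure I)

/-- `𝕊 = ℝ^d × [0,1] × 𝕄`: location, birth time, marks. -/
abbrev Pt (d : ℕ) : Type := (Fin d → ℝ) × I × Marks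

/-- The intensity measure `lam ℓ_d ⊗ ℓ ⊗ ℚ`. -/
def intensity (d : ℕ) (lam : ℝ) : Measure (Pt d) :=
  (ENNReal.ofReal lam • (volume : Measure (Fin d → ℝ))).prod
    ((volume : Measure I).prod marksMeasure)

/-! ### Cubes -/

/-- The cube `∏ i, [corner i, corner i + side)`. -/
structure Cube (d : ℕ) where
  corner : Fin d → ℝ
  side : ℝ
  side_pos : 0 < side

/-- The cube as a set. -/
def Cube.toSet {d : ℕ} (W : Cube d) : Set (Fin d → ℝ) :=
  Set.univ.pi fun i => Set.Ico (W.corner i) (W.corner i + W.side)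

/-- A sequence of cubes tends to `ℝ^d`: it eventually contains every ball. -/
def TendsToSpace {d : ℕ} (W : ℕ → Cube d) : Prop :=
  ∀ r : ℝ, ∀ᶠ n in atTop, Metric.closedBall (0 : Fin d → ℝ) r ⊆ (W n).toSet

theorem finite_inCube {d : ℕ} (η : Config (Pt d)) (W : Cube d) :
    (η.carrier ∩ {p | p.1 ∈ W.toSet}).Finite := by
  have hK : IsCompact ((Set.univ.pi fun i => Set.Icc (W.corner i) (W.corner i + W.side)) ×ˢ
      (Set.univ : Set (I × Marks))) :=
    (isCompact_univ_pi fun _ => isCompact_Icc).prod isCompact_univ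
  refine (η.locallyFinite _ hK).subset ?_
  rintro p ⟨hp, hW⟩
  exact ⟨hp, fun i hi => Set.Ico_subset_Icc_self (hW i hi), trivial⟩

/-- The finite configuration `η|_W`. -/
def Config.inCube {d : ℕ} (η : Config (Pt d)) (W : Cube d) : Finset (Pt d) :=
  (finite_inCube η W).toFinset

/-- `η_t`: the restriction of `η` to `ℝ^d × [0,t) × 𝕄`. -/
def Config.before {d : ℕ} (η : Config (Pt d)) (t : I) : Config (Pt d) :=
  η.restrict {p | p.2.1 < t}

/-! ### Marked edges -/

/-- The sigma-field on unordered pairs induced by the product sigma-field on ordered pairs. -/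
instance {α : Type*} [MeasurableSpace α] : MeasurableSpace (Sym2 α) :=
  MeasurableSpace.map (fun p : α × α => s(p.1, p.2)) inferInstance

/-- `(ℝ^d)^[2]`: the unordered pairs of distinct points of `ℝ^d`. -/
abbrev Edge (d : ℕ) : Type := {e : Sym2 (Fin d → ℝ) // ¬ e.IsDiag}

/-- `(ℝ^d)^[2] × [0,1]`. -/
abbrev MarkedEdge (d : ℕ) : Type := Edge d × I

/-- The sigma-field on the finite subsets of `(ℝ^d)^[2] × [0,1]`, generated by the counts. -/
abbrev markedEdgeSets (d : ℕ) : MeasurableSpace (Finset (MarkedEdge d)) :=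
  ⨆ (A : Set (MarkedEdge d)) (_ : MeasurableSet A),
    MeasurableSpace.comap (fun G : Finset (MarkedEdge d) => ((G : Set (MarkedEdge d)) ∩ A).encard)
      inferInstance

/-- Translation of both endpoints of a marked edge by `z`. -/
def MarkedEdge.translate {d : ℕ} (z : Fin d → ℝ) (e : MarkedEdge d) : MarkedEdge d :=
  (⟨e.1.1.map (z + ·), fun h => e.1.2 ((Sym2.isDiag_map (add_right_injective z)).1 h)⟩, e.2)

open Classical in
/-- Translation invariance of a functional of finite marked graphs. -/
def TranslationInvariant {d : ℕ} (f : Finset (MarkedEdge d) → ℝ) : Prop :=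
  ∀ (z : Fin d → ℝ) (G : Finset (MarkedEdge d)), f (G.image (MarkedEdge.translate z)) = f G

/-! ### The edge marking mapping `T` -/

/-- The integer vector `k` such that `x` lies in the unit cube `∏ i, [k i, k i + 1)`. -/
def cell {d : ℕ} (x : Fin d → ℝ) : Fin d → ℤ := fun i => ⌊x i⌋

/-- The number of points of `η` in the unit lattice cube of `p` which are older than `p`; so `p`
is the oldest point of its cube if its rank is `0`, the second oldest if its rank is `1`, etc. -/
def rank {d : ℕ} (η : Set (Pt d)) (p : Pt d) : ℕ :=
  {q | q ∈ η ∧ cell q.1 = cell p.1 ∧ q.2.1 < p.2.1}.ncard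

/-- The edge marking mapping `T` associated with the enumeration `B` of the unit lattice cubes
(the `n`-th cube being `∏ i, [B n i, B n i + 1)`): if `p, q ∈ η`, where `p` is older than `q` and
`p` is the `m`-th oldest point of `η` in the `n`-th cube, then the edge between their locations
gets the mark of `q` with index `(m, n)`. Ranks are counted from `0`. -/
def edgeMarking {d : ℕ} (B : ℕ ≃ (Fin d → ℤ)) (η : Set (Pt d)) : Set (MarkedEdge d) :=
  {e | ∃ p ∈ η, ∃ q ∈ η, p.2.1 < q.2.1 ∧ e.1.1 = s(p.1, q.1) ∧
    e.2 = q.2.2 (rank η p, B.symm (cell p.1))}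

theorem edgeMarking_finite {d : ℕ} (B : ℕ ≃ (Fin d → ℤ)) {η : Set (Pt d)} (h : η.Finite) :
    (edgeMarking B η).Finite := by
  have hinj : Function.Injective
      (fun e : MarkedEdge d => ((e.1.1, e.2) : Sym2 (Fin d → ℝ) × I)) := by
    rintro ⟨⟨a, ha⟩, u⟩ ⟨⟨b, hb⟩, v⟩ hab
    simp only [Prod.mk.injEq] at hab
    obtain ⟨rfl, rfl⟩ := hab
    rfl
  refine (((h.prod h).image fun w : Pt d × Pt d =>
    ((s(w.1.1, w.2.1), w.2.2.2 (rank η w.1, B.symm (cell w.1.1))) :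
      Sym2 (Fin d → ℝ) × I)).preimage hinj.injOn).subset ?_
  rintro e ⟨p, hp, q, hq, -, h1, h2⟩
  exact ⟨(p, q), ⟨hp, hq⟩, Prod.ext h1.symm h2.symm⟩

/-- `T(η)` for a finite configuration `η`. -/
def graph {d : ℕ} (B : ℕ ≃ (Fin d → ℤ)) (η : Finset (Pt d)) : Finset (MarkedEdge d) :=
  (edgeMarking_finite B η.finite_toSet).toFinset

open Classical in
/-- `G \ {x}`: the vertex `x` and all edges at `x` are removed. -/
def removeVertex {d : ℕ} (G : Finset (MarkedEdge d)) (x : Fin d → ℝ) : Finset (MarkedEdge d) :=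
  G.filter fun e => x ∉ e.1.1

open Classical in
/-- The add-one cost `D_p(η) = f(T(η ∪ {p})) - f(T(η ∪ {p}) \ {x})`, where `x` is the location
of `p`. -/
def addOneCost {d : ℕ} (B : ℕ ≃ (Fin d → ℤ)) (f : Finset (MarkedEdge d) → ℝ) (p : Pt d)
    (η : Finset (Pt d)) : ℝ :=
  f (graph B (insert p η)) - f (removeVertex (graph B (insert p η)) p.1)

/-! ### Weak stabilization, the moment condition and the limiting variance -/

section

variable {d : ℕ} {Ω : Type*} [MeasurableSpace Ω]

/-- `Δ` is a random variable on `(Ω × 𝕄, P ⊗ ℚ)` to which `D_(0,t,M)(η|_(W n))` converges in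
probability, for every sequence of cubes `W` tending to `ℝ^d`. -/
def IsLimitAddOneCost (P : Measure Ω) (B : ℕ ≃ (Fin d → ℤ)) (η : Ω → Config (Pt d))
    (f : Finset (MarkedEdge d) → ℝ) (t : I) (Δ : Ω × Marks → ℝ) : Prop :=
  Measurable Δ ∧ ∀ W : ℕ → Cube d, TendsToSpace W →
    TendstoInMeasure (P.prod marksMeasure)
      (fun n z => addOneCost B f (0, t, z.2) ((η z.1).inCube (W n))) atTop Δ

/-- Weak stabilization of `f`. -/
def WeaklyStabilizing (P : Measure Ω) (B : ℕ ≃ (Fin d → ℤ)) (η : Ω → Config (Pt d))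
    (f : Finset (MarkedEdge d) → ℝ) : Prop :=
  TranslationInvariant f ∧ ∃ Δ : Ω × Marks → ℝ, IsLimitAddOneCost P B η f 1 Δ

/-- The moment condition: the `p`-th absolute moments of the add-one cost, for a point at the
origin born at time `1`, are bounded over all cubes containing the origin, for some `p > 2`. -/
def MomentCondition (P : Measure Ω) (B : ℕ ≃ (Fin d → ℤ)) (η : Ω → Config (Pt d))
    (f : Finset (MarkedEdge d) → ℝ) : Prop :=
  ∃ p : ℝ, 2 < p ∧
    (⨆ (W : Cube d) (_ : (0 : Fin d → ℝ) ∈ W.toSet),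
      ∫⁻ z, ‖addOneCost B f (0, 1, z.2) ((η z.1).inCube W)‖ₑ ^ p ∂(P.prod marksMeasure)) < ∞

/-- The sigma-field on `Ω × 𝕄` generated by `η_t` and the mark sequence `M`. Conditioning on it is
conditioning on `η_t` with the mark sequence `M` of the added point kept fixed. -/
abbrev sigmaBefore (η : Ω → Config (Pt d)) (t : I) : MeasurableSpace (Ω × Marks) :=
  (MeasurableSpace.comap (fun ω => (η ω).before t) inferInstance).prod inferInstance

/-- The second moment of `E[Δ_t | η_t]` under `P ⊗ ℚ`. -/
def condSecondMoment (P : Measure Ω) (η : Ω → Config (Pt d)) (Δ : I → Ω × Marks → ℝ)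
    (t : I) : ℝ :=
  ∫ z, (condExp (sigmaBefore η t) (P.prod marksMeasure) (Δ t) z) ^ 2 ∂(P.prod marksMeasure)

/-- `σ² = lam ∫₀¹ Ê[E[Δ_t | η_t]²] dt`. -/
def limitVariance (P : Measure Ω) (lam : ℝ) (η : Ω → Config (Pt d))
    (Δ : I → Ω × Marks → ℝ) : ℝ :=
  lam * ∫ t : I, condSecondMoment P η Δ t

end

end

end MarkedPoisson

open MarkedPoisson

/-! The engine is a covariance identity for a finite Poisson process η with atomless birth times.
Let η' be an independent copy and let `mix` follow η before time t and η' after it. Then Cov(F, G)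
is the integral of E[D_z F(η) D_z G(mix (τ z) η η')] over the intensity μ(dz), where D_z is the
add-one difference. For F = G the two factors are conditionally independent and identically
distributed given the past, so the integrand is the second moment of a conditional expectation.
Since void events determine laws, the identity need only be tested on indicators of void events.
There it reduces to the integral over C = A ∩ B of exp(-μ(C ∩ {τ > τ z})) μ(dz), which equals 1 -
exp(-μ(C)) (`covariance_identity`).

The functional f ∘ T is not directly accessible to this, because inserting a point shifts ranks and
thereby reassigns edge marks. However, an edge reads a mark of its younger endpoint at a label that
identifies the older one, so distinct edges read distinct marks. For fixed locations and birth times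
the edge marks are therefore i.i.d. uniform, even jointly for two `Compatible` configurations
(`exists_index`, `lintegral_graph_skelPts`). Three consequences follow. Not adding a point has the
same effect in law as adding and removing it (`lintegral_graph_remove`), which replaces D_z (f ∘ T)
by the add-one cost of f. The law of the cost does not depend on the birth time
(`lintegral_graph_window`). It also does not see the position of the lattice of unit cubes
(`lintegral_vertexCost_shift`). Hence the variance in W is λ times the integral of `costCov` over W
× [0,1], and `costCov` at (x, t) is the second moment of E[D | η_t] for a point at the origin of the
cube W - x. Truncating f reduces the general case to bounded f.

The moment condition with p > 2 upgrades the convergence at time 1 to mean square. The joint law of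
the costs in a lattice-aligned cube and in a larger cube is the same for all birth times, so the
Cauchy property passes from time 1 to every t and produces Δ_t. Conditional expectation is an L²
contraction, so `costCov` converges to `condSecondMoment`. After rescaling W to the unit cube,
dominated convergence gives the limit of the variances.

For positivity, suppose σ² = 0. Then E[Δ_t | η_t] = 0 for almost every t. For t close to 1 a large
fixed cube probably has no point born after t, so the truncated cost in it is almost a function of
η_t and of the marks, hence almost orthogonal to Δ_t. But Δ_t is close to that cost, whose law is
the same as at time 1. This forces the expectation of Δ_1 times its truncation to vanish. -/

namespace MarkedPoisson

noncomputable section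

/-! ### The sigma-field on finite subsets generated by the void events -/

section Voids

variable {X Y : Type*}

/-- The event that a finite set has no point in `A`. -/
def voidSet (A : Set X) : Set (Finset X) := {η | ∀ x ∈ η, x ∉ A}

theorem mem_voidSet {A : Set X} {η : Finset X} : η ∈ voidSet A ↔ ∀ x ∈ η, x ∉ A := Iff.rfl

theorem voidSet_inter (A B : Set X) : voidSet A ∩ voidSet B = voidSet (A ∪ B) := by
  ext η
  simp only [voidSet, Set.mem_inter_iff, Set.mem_ofPred_eq, Set.mem_union, not_or]
  exact ⟨fun h x hx => ⟨h.1 x hx, h.2 x hx⟩, fun h => ⟨fun x hx => (h x hx).1,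
    fun x hx => (h x hx).2⟩⟩

theorem voidSet_empty : voidSet (∅ : Set X) = Set.univ := by ext; simp [voidSet]

open Classical in
/-- Adding a point to a finite set. -/
def addPt (z : X) (η : Finset X) : Finset X := insert z η

@[simp] theorem mem_addPt {x z : X} {η : Finset X} : x ∈ addPt z η ↔ x = z ∨ x ∈ η := by
  simp [addPt]

open Classical in
/-- The points of `η` before time `t` together with the points of `η'` after time `t`. -/
def mix (τ : X → I) (t : I) (η η' : Finset X) : Finset X :=
  η.filter (fun x => τ x < t) ∪ η'.filter (fun x => t < τ x)

@[simp] theorem mem_mix {τ : X → I} {t : I} {η η' : Finset X} {x : X} :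
    x ∈ mix τ t η η' ↔ (x ∈ η ∧ τ x < t) ∨ (x ∈ η' ∧ t < τ x) := by
  simp [mix]

variable [MeasurableSpace X] [MeasurableSpace Y]

/-- The sigma-field on the finite subsets of `X` generated by the void events. -/
instance finsetMeasurableSpace : MeasurableSpace (Finset X) :=
  MeasurableSpace.generateFrom {S | ∃ A : Set X, MeasurableSet A ∧ voidSet A = S}

theorem measurableSet_voidSet {A : Set X} (hA : MeasurableSet A) : MeasurableSet (voidSet A) :=
  MeasurableSpace.measurableSet_generateFrom ⟨A, hA, rfl⟩

theorem measurable_to_finset {g : Y → Finset X}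
    (h : ∀ A : Set X, MeasurableSet A → MeasurableSet {y | ∀ x ∈ g y, x ∉ A}) :
    Measurable g := by
  refine measurable_generateFrom ?_
  rintro _ ⟨A, hA, rfl⟩
  exact h A hA

theorem measurable_to_finset_of_hit {g : Y → Finset X}
    (h : ∀ A : Set X, MeasurableSet A → MeasurableSet {y | ∃ x ∈ g y, x ∈ A}) :
    Measurable g := by
  refine measurable_to_finset fun A hA => ?_
  have : {y | ∀ x ∈ g y, x ∉ A} = {y | ∃ x ∈ g y, x ∈ A}ᶜ := by ext; simp
  rw [this]
  exact (h A hA).compl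

theorem measurableSet_hit {A : Set X} (hA : MeasurableSet A) :
    MeasurableSet {η : Finset X | ∃ x ∈ η, x ∈ A} := by
  have : {η : Finset X | ∃ x ∈ η, x ∈ A} = (voidSet A)ᶜ := by ext; simp [voidSet]
  rw [this]
  exact (measurableSet_voidSet hA).compl

theorem isPiSystem_voidSet :
    IsPiSystem {S : Set (Finset X) | ∃ A : Set X, MeasurableSet A ∧ voidSet A = S} := by
  rintro _ ⟨A, hA, rfl⟩ _ ⟨B, hB, rfl⟩ -
  exact ⟨A ∪ B, hA.union hB, (voidSet_inter A B).symm⟩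

/-- Finite measures on finite subsets are determined by their void probabilities. -/
theorem finset_measure_ext {μ ν : Measure (Finset X)} [IsFiniteMeasure μ]
    (h : ∀ A : Set X, MeasurableSet A → μ (voidSet A) = ν (voidSet A)) : μ = ν := by
  refine ext_of_generate_finite _ rfl isPiSystem_voidSet ?_ ?_
  · rintro _ ⟨A, hA, rfl⟩
    exact h A hA
  · rw [← voidSet_empty]
    exact h ∅ MeasurableSet.empty

theorem finset_prod_measure_ext {μ ν : Measure (Finset X × Finset X)} [IsFiniteMeasure μ]
    (h : ∀ A B : Set X, MeasurableSet A → MeasurableSet B →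
      μ (voidSet A ×ˢ voidSet B) = ν (voidSet A ×ˢ voidSet B)) : μ = ν := by
  have hsp : IsCountablySpanning
      {S : Set (Finset X) | ∃ A : Set X, MeasurableSet A ∧ voidSet A = S} :=
    ⟨fun _ => Set.univ, fun _ => ⟨∅, MeasurableSet.empty, voidSet_empty⟩, Set.iUnion_const _⟩
  refine ext_of_generate_finite _ (generateFrom_prod_eq hsp hsp)
    (isPiSystem_voidSet.prod isPiSystem_voidSet) ?_ ?_
  · rintro _ ⟨_, ⟨A, hA, rfl⟩, _, ⟨B, hB, rfl⟩, rfl⟩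
    exact h A B hA hB
  · rw [← Set.univ_prod_univ, ← voidSet_empty]
    exact h ∅ ∅ MeasurableSet.empty MeasurableSet.empty

theorem measurable_addPt : Measurable fun p : X × Finset X => addPt p.1 p.2 := by
  refine measurable_to_finset fun A hA => ?_
  have : {p : X × Finset X | ∀ x ∈ addPt p.1 p.2, x ∉ A} = Aᶜ ×ˢ voidSet A := by
    ext p; simp [voidSet]
  rw [this]
  exact hA.compl.prod (measurableSet_voidSet hA)

theorem measurable_mix {τ : X → I} (hτ : Measurable τ) :
    Measurable fun p : I × Finset X × Finset X => mix τ p.1 p.2.1 p.2.2 := by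
  refine measurable_to_finset_of_hit fun A hA => ?_
  obtain ⟨D, hDc, hDd⟩ := TopologicalSpace.exists_countable_dense I
  -- A threshold q from a countable dense set, inserted between τ x and the varying time, decouples
  -- the condition on the point from the condition on the time. The third set of the union is empty.
  have : {p : I × Finset X × Finset X | ∃ x ∈ mix τ p.1 p.2.1 p.2.2, x ∈ A} =
      (⋃ q ∈ D, {p : I × Finset X × Finset X | q ≤ p.1 ∧ ∃ x ∈ p.2.1, x ∈ A ∩ τ ⁻¹' Set.Iio q}) ∪
      (⋃ q ∈ D, {p : I × Finset X × Finset X |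
        p.1 ≤ q ∧ ∃ x ∈ p.2.2, x ∈ A ∩ τ ⁻¹' Set.Ioi q}) ∪
      ({p | p.1 = p.1 ∧ False}) := by
    ext p
    simp only [mem_mix, Set.mem_ofPred_eq, Set.mem_union, Set.mem_iUnion, Set.mem_inter_iff,
      Set.mem_preimage, Set.mem_Iio, Set.mem_Ioi, and_false, or_false, exists_prop]
    constructor
    · rintro ⟨x, ⟨hx, hxt⟩ | ⟨hx, hxt⟩, hxA⟩
      · obtain ⟨q, hq, h1, h2⟩ := hDd.exists_between hxt
        exact Or.inl ⟨q, hq, h2.le, x, hx, hxA, h1⟩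
      · obtain ⟨q, hq, h1, h2⟩ := hDd.exists_between hxt
        exact Or.inr ⟨q, hq, h1.le, x, hx, hxA, h2⟩
    · rintro (⟨q, hq, h1, x, hx, hxA, h2⟩ | ⟨q, hq, h1, x, hx, hxA, h2⟩)
      · exact ⟨x, Or.inl ⟨hx, h2.trans_le h1⟩, hxA⟩
      · exact ⟨x, Or.inr ⟨hx, h1.trans_lt h2⟩, hxA⟩
  rw [this]
  refine ((MeasurableSet.biUnion hDc fun q _ => ?_).union
    (MeasurableSet.biUnion hDc fun q _ => ?_)).union (by simp)
  · exact (measurableSet_le measurable_const measurable_fst).inter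
      (measurable_snd.fst (measurableSet_hit (hA.inter (hτ measurableSet_Iio))))
  · exact (measurableSet_le measurable_fst measurable_const).inter
      (measurable_snd.snd (measurableSet_hit (hA.inter (hτ measurableSet_Ioi))))

open Classical in
theorem measurable_filter {p : X → Prop} (hp : MeasurableSet {x | p x}) :
    Measurable fun η : Finset X => η.filter p := by
  refine measurable_to_finset_of_hit fun A hA => ?_
  convert measurableSet_hit (hp.inter hA) using 1
  ext η
  simp [and_assoc]

/-- A countable family of measurable sets separating the points of every finite set. -/
theorem exists_countable_separating [MeasurableSpace.CountablySeparated X] :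
    ∃ 𝒬 : Set (Set X), 𝒬.Countable ∧ (∀ Q ∈ 𝒬, MeasurableSet Q) ∧
      ∀ F : Finset X, ∃ q : X → Set X, (∀ x ∈ F, q x ∈ 𝒬 ∧ x ∈ q x) ∧
        (F : Set X).PairwiseDisjoint q := by
  obtain ⟨φ, hφ, hinj⟩ := MeasurableSpace.measurable_injection_nat_bool_of_countablySeparated X
  refine ⟨(fun U => φ ⁻¹' U) '' TopologicalSpace.countableBasis (ℕ → Bool),
    (TopologicalSpace.countable_countableBasis _).image _, ?_, ?_⟩
  · rintro _ ⟨U, hU, rfl⟩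
    exact hφ (TopologicalSpace.isOpen_of_mem_countableBasis hU).measurableSet
  · intro F
    obtain ⟨V, hV, hdisj⟩ := (F.finite_toSet.image φ).t2_separation
    have hb := TopologicalSpace.isBasis_countableBasis (ℕ → Bool)
    have : ∀ x : X, ∃ U ∈ TopologicalSpace.countableBasis (ℕ → Bool), φ x ∈ U ∧ U ⊆ V (φ x) :=
      fun x => hb.exists_subset_of_mem_open (hV _).1 (hV _).2
    choose U hU hxU hUV using this
    refine ⟨fun x => φ ⁻¹' U x, fun x _ => ⟨⟨U x, hU x, rfl⟩, hxU x⟩, ?_⟩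
    intro x hx y hy hxy
    have := hdisj (Set.mem_image_of_mem φ hx) (Set.mem_image_of_mem φ hy) (hinj.ne hxy)
    exact Disjoint.preimage φ (this.mono (hUV x) (hUV y))

/-- Counts are measurable as soon as void events are. -/
theorem measurable_encard_of_void [MeasurableSpace.CountablySeparated X] {S : Y → Set X}
    (h : ∀ A : Set X, MeasurableSet A → MeasurableSet {y | (S y ∩ A).Nonempty})
    {A : Set X} (hA : MeasurableSet A) : Measurable fun y => (S y ∩ A).encard := by
  obtain ⟨𝒬, hc, hm, hsep⟩ := exists_countable_separating (X := X)
  have key : ∀ k : ℕ, MeasurableSet {y | (k : ℕ∞) ≤ (S y ∩ A).encard} := by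
    intro k
    -- At least k points lie in A exactly when k pairwise disjoint members of the countable
    -- separating family are all hit inside A. This is a countable union of finite intersections.
    have : {y | (k : ℕ∞) ≤ (S y ∩ A).encard} =
        ⋃ T ∈ {T : Finset (Set X) | (T : Set (Set X)) ⊆ 𝒬 ∧ T.card = k ∧
          (T : Set (Set X)).PairwiseDisjoint id}, ⋂ Q ∈ T, {y | (S y ∩ (A ∩ Q)).Nonempty} := by
      ext y
      simp only [Set.mem_ofPred_eq, Set.mem_iUnion, Set.mem_iInter, exists_prop]
      constructor
      · intro hk
        obtain ⟨F, hF, hFk⟩ := Set.exists_subset_encard_eq hk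
        have hFf : F.Finite := Set.finite_of_encard_eq_coe hFk
        lift F to Finset X using hFf
        obtain ⟨q, hq, hd⟩ := hsep F
        classical
        have hinj : Set.InjOn q F := by
          intro x hx y hy hxy
          by_contra hne
          have := hd hx hy hne
          exact (Set.disjoint_left.1 this (hq x hx).2) (hxy ▸ (hq x hx).2)
        refine ⟨F.image q, ⟨?_, ?_, ?_⟩, ?_⟩
        · intro Q hQ
          obtain ⟨x, hx, rfl⟩ := Finset.mem_image.1 (Finset.mem_coe.1 hQ)
          exact (hq x hx).1
        · rw [Finset.card_image_of_injOn hinj]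
          rw [Set.encard_coe_eq_coe_finsetCard] at hFk
          exact_mod_cast hFk
        · rw [Finset.coe_image]
          exact hd.image
        · intro Q hQ
          obtain ⟨x, hx, rfl⟩ := Finset.mem_image.1 hQ
          exact ⟨x, (hF hx).1, (hF hx).2, (hq x hx).2⟩
      · rintro ⟨T, ⟨-, hk, hd⟩, hT⟩
        rcases T.eq_empty_or_nonempty with rfl | ⟨Q₀, hQ₀⟩
        · simp [← hk]
        have : Nonempty X := ⟨(hT Q₀ hQ₀).some⟩
        choose! x hx using hT
        have hinj : Set.InjOn x T := by
          intro Q hQ R hR hQR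
          by_contra hne
          exact Set.disjoint_left.1 (hd hQ hR hne) (hx Q hQ).2.2 (hQR ▸ (hx R hR).2.2)
        calc (k : ℕ∞) = (T : Set (Set X)).encard := by
              rw [Set.encard_coe_eq_coe_finsetCard, hk]
          _ = (x '' T).encard := hinj.encard_image.symm
          _ ≤ _ := Set.encard_le_encard (by
              rintro _ ⟨Q, hQ, rfl⟩
              exact ⟨(hx Q hQ).1, (hx Q hQ).2.1⟩)
    rw [this]
    refine MeasurableSet.biUnion ?_ fun T hT => ?_
    · refine Set.Countable.mono (fun T hT => hT.1) (Set.countable_ofPred_finite_subset hc |>.preimage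
        (f := fun T : Finset (Set X) => (T : Set (Set X))) Finset.coe_injective |>.mono ?_)
      intro T hT
      exact ⟨T.finite_toSet, hT⟩
    · exact Finset.measurableSet_biInter _ fun Q hQ => h _ (hA.inter (hm Q (hT.1 hQ)))
  have hnat : ∀ k : ℕ, MeasurableSet {y | (S y ∩ A).encard = k} := by
    intro k
    have : {y | (S y ∩ A).encard = k} =
        {y | (k : ℕ∞) ≤ (S y ∩ A).encard} \ {y | ((k + 1 : ℕ) : ℕ∞) ≤ (S y ∩ A).encard} := by
      ext y
      simp only [Set.mem_ofPred_eq, Set.mem_sdiff, not_le, Nat.cast_add, Nat.cast_one]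
      rw [ENat.lt_add_one_iff (ENat.natCast_ne_top k)]
      exact ⟨fun h => ⟨h.ge, h.le⟩, fun h => le_antisymm h.2 h.1⟩
    rw [this]
    exact (key k).diff (key (k + 1))
  refine measurable_to_countable' fun k => ?_
  induction k using ENat.recTopCoe with
  | coe k => exact hnat k
  | top =>
    have : (fun y => (S y ∩ A).encard) ⁻¹' {⊤} = (⋃ k : ℕ, {y | (S y ∩ A).encard = k})ᶜ := by
      ext y
      simp only [Set.mem_preimage, Set.mem_singleton_iff, Set.mem_compl_iff, Set.mem_iUnion,
        Set.mem_ofPred_eq, not_exists]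
      rw [← not_iff_not, ← ne_eq, ENat.ne_top_iff_exists]
      simp [eq_comm]
    rw [this]
    exact (MeasurableSet.iUnion hnat).compl

/-- A point of F outside G lies in a member of the separating family that misses G, so countably
many void events tell F from G. This property of the target is what lets measurability descend along
a surjection in `measurable_graph`. -/
instance [MeasurableSpace.CountablySeparated X] :
    MeasurableSpace.CountablySeparated (Finset X) := by
  obtain ⟨𝒬, hc, hm, hsep⟩ := exists_countable_separating (X := X)
  refine ⟨⟨voidSet '' 𝒬, hc.image _, ?_, ?_⟩⟩
  · rintro _ ⟨Q, hQ, rfl⟩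
    exact measurableSet_voidSet (hm Q hQ)
  · classical
    have sub : ∀ F G : Finset X, (∀ s ∈ voidSet '' 𝒬, F ∈ s ↔ G ∈ s) → F ⊆ G := by
      intro F G h a ha
      by_contra haG
      obtain ⟨q, hq, hd⟩ := hsep (F ∪ G)
      have haq := hq a (Finset.mem_union_left _ ha)
      refine (h _ ⟨q a, haq.1, rfl⟩).2 (fun x hx hxa => ?_) a ha haq.2
      have hxu : x ∈ F ∪ G := Finset.mem_union_right _ hx
      have hne : x ≠ a := fun e => haG (e ▸ hx)
      exact Set.disjoint_left.1 (hd (Finset.mem_coe.2 hxu)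
        (Finset.mem_coe.2 (Finset.mem_union_left _ ha)) hne) (hq x hxu).2 hxa
    intro F _ G _ h
    exact (sub F G h).antisymm (sub G F fun s hs => (h s hs).symm)

end Voids

/-! ### The covariance identity for Poisson processes -/

theorem continuous_measureReal_Ioi (ρ : Measure I) [IsFiniteMeasure ρ] [NullSingletonClass ρ] :
    Continuous fun t : I => ρ.real (Set.Ioi t) := by
  have h : ∀ t : I, ρ.real (Set.Ioi t) = ∫ x, (Set.Ioi t).indicator (fun _ => (1 : ℝ)) x ∂ρ := by
    intro t
    rw [integral_indicator measurableSet_Ioi]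
    simp
  simp_rw [h]
  refine continuous_iff_continuousAt.2 fun t => ?_
  refine tendsto_integral_filter_of_dominated_convergence (fun _ => 1) ?_ ?_
    (integrable_const _) ?_
  · exact Eventually.of_forall fun s =>
      (measurable_const.indicator measurableSet_Ioi).aestronglyMeasurable
  · refine Eventually.of_forall fun s => Eventually.of_forall fun x => ?_
    by_cases hx : x ∈ Set.Ioi s <;> simp [hx]
  · have : ∀ᵐ x ∂ρ, x ≠ t := by simp [ae_iff]
    filter_upwards [this] with x hx
    rcases lt_or_gt_of_ne hx with hx | hx
    · refine tendsto_const_nhds.congr' ?_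
      filter_upwards [lt_mem_nhds hx] with s hs
      simp [hx.le, hs.le]
    · refine tendsto_const_nhds.congr' ?_
      filter_upwards [gt_mem_nhds hx] with s hs
      simp [hx, hs]

theorem measureReal_Ioi_one (ρ : Measure I) : ρ.real (Set.Ioi (1 : I)) = 0 := by
  have : Set.Ioi (1 : I) = ∅ := Set.eq_empty_of_forall_notMem fun x hx =>
    absurd hx (not_lt.2 (unitInterval.le_one' (t := x)))
  simp [this]

theorem measureReal_Ioi_zero (ρ : Measure I) [IsFiniteMeasure ρ] [NullSingletonClass ρ] :
    ρ.real (Set.Ioi (0 : I)) = ρ.real Set.univ := by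
  have : Set.Ici (0 : I) = Set.univ := Set.eq_univ_of_forall fun x => unitInterval.nonneg' (t := x)
  rw [← this]
  exact measureReal_congr Ioi_ae_eq_Ici

/-- The tail function of an atomless finite measure maps it to the Lebesgue measure. -/
theorem map_measureReal_Ioi (ρ : Measure I) [IsFiniteMeasure ρ] [NullSingletonClass ρ] :
    ρ.map (fun t => ρ.real (Set.Ioi t)) = volume.restrict (Set.Ioc 0 (ρ.real Set.univ)) := by
  have hcont := continuous_measureReal_Ioi ρ
  set U : I → ℝ := fun t => ρ.real (Set.Ioi t) with hU
  set c := ρ.real Set.univ with hc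
  have hanti : ∀ s t : I, s ≤ t → U t ≤ U s := fun s t hst =>
    measureReal_mono (Set.Ioi_subset_Ioi hst)
  have hex : ∀ a, 0 ≤ a → a ≤ c → ∃ t, U t = a := by
    intro a h0 h1
    refine intermediate_value_univ (1 : I) (0 : I) hcont ⟨?_, ?_⟩
    · rw [hU]; simp only; rw [measureReal_Ioi_one]; exact h0
    · rw [hU]; simp only; rw [measureReal_Ioi_zero]; exact h1
  have hUc : ∀ t, U t ≤ c := fun t => measureReal_mono (Set.subset_univ _)
  have hU0 : ∀ t, 0 ≤ U t := fun t => measureReal_nonneg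
  have : IsFiniteMeasure (volume.restrict (Set.Ioc 0 c)) := ⟨by simp⟩
  refine (Measure.ext_of_Iic _ _ fun a => ?_)
  rw [Measure.map_apply hcont.measurable measurableSet_Iic,
    Measure.restrict_apply measurableSet_Iic]
  have hL : ρ (U ⁻¹' Set.Iic a) = ENNReal.ofReal (ρ.real (U ⁻¹' Set.Iic a)) := by
    rw [measureReal_def, ENNReal.ofReal_toReal (measure_ne_top _ _)]
  rcases lt_or_ge a 0 with ha | ha
  · have h1 : U ⁻¹' Set.Iic a = ∅ := Set.eq_empty_of_forall_notMem fun t ht =>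
      absurd (hU0 t) (not_le.2 (lt_of_le_of_lt ht ha))
    have h2 : Set.Iic a ∩ Set.Ioc 0 c = ∅ := Set.eq_empty_of_forall_notMem fun t ht =>
      absurd (ht.2.1.trans_le ht.1) (not_lt.2 ha.le)
    rw [h1, h2]; simp
  rcases le_or_gt c a with hca | hca
  · have h1 : U ⁻¹' Set.Iic a = Set.univ := Set.eq_univ_of_forall fun t => (hUc t).trans hca
    have h2 : Set.Iic a ∩ Set.Ioc 0 c = Set.Ioc 0 c :=
      Set.inter_eq_right.2 fun t ht => ht.2.trans hca
    rw [h2, hL, h1]; simp [hc]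
  · have h2 : Set.Iic a ∩ Set.Ioc 0 c = Set.Ioc 0 a := by
      ext t; simp only [Set.mem_inter_iff, Set.mem_Iic, Set.mem_Ioc]
      constructor
      · rintro ⟨h1, h2, -⟩; exact ⟨h2, h1⟩
      · rintro ⟨h1, h2⟩; exact ⟨h2, h1, h2.trans hca.le⟩
    rw [h2, hL, Real.volume_Ioc, sub_zero]
    congr 1
    -- The tail function U is continuous and antitone, so each level in [0, c] is attained. A point
    -- at level a makes the sublevel set contain a half-line of mass a. A point at a level b > a
    -- makes it lie in a half-line of mass b.
    refine le_antisymm (le_of_forall_gt_imp_ge_of_dense fun b hb => ?_) ?_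
    · rcases le_or_gt c b with hcb | hcb
      · exact (measureReal_mono (Set.subset_univ _)).trans hcb
      · obtain ⟨t, ht⟩ := hex b (ha.trans hb.le) hcb.le
        rw [← ht]
        refine measureReal_mono fun s hs => ?_
        by_contra hst
        have := hanti s t (not_lt.1 hst)
        rw [ht] at this
        exact absurd (this.trans hs) (not_le.2 hb)
    · obtain ⟨t, ht⟩ := hex a ha hca.le
      calc a = ρ.real (Set.Ioi t) := ht.symm
        _ ≤ _ := measureReal_mono fun s hs => (hanti t s (le_of_lt hs)).trans ht.le

/-- The substitution u = ρ((t, 1]) turns ρ into Lebesgue measure on (0, ρ(I)] and the integral into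
that of exp(-u). -/
theorem integral_exp_neg_measureReal_Ioi (ρ : Measure I) [IsFiniteMeasure ρ] [NullSingletonClass ρ] :
    ∫ t, Real.exp (-ρ.real (Set.Ioi t)) ∂ρ = 1 - Real.exp (-ρ.real Set.univ) := by
  have h := integral_map (μ := ρ) (φ := fun t => ρ.real (Set.Ioi t))
    (continuous_measureReal_Ioi ρ).measurable.aemeasurable
    (f := fun u => Real.exp (-u)) (by fun_prop)
  rw [← h, map_measureReal_Ioi, ← intervalIntegral.integral_of_le measureReal_nonneg,
    intervalIntegral.integral_comp_neg (fun u => Real.exp u), integral_exp]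
  simp

/-- Against ρ the integrand is the density of the youngest point of a Poisson process with intensity
ρ. The right-hand side is the probability that this process is not empty. -/
theorem integral_exp_neg_measureReal_lt {X : Type*} [MeasurableSpace X] (ρ : Measure X)
    [IsFiniteMeasure ρ] {τ : X → I} (hτ : Measurable τ) (hρ : NullSingletonClass (ρ.map τ)) :
    ∫ z, Real.exp (-ρ.real {x | τ z < τ x}) ∂ρ = 1 - Real.exp (-ρ.real Set.univ) := by
  have h := integral_exp_neg_measureReal_Ioi (ρ.map τ)
  rw [integral_map hτ.aemeasurable] at h
  · have h1 : ∀ t, (ρ.map τ).real (Set.Ioi t) = ρ.real {x | t < τ x} := fun t => by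
      rw [map_measureReal_apply hτ measurableSet_Ioi]; rfl
    simp_rw [h1] at h
    rw [h, map_measureReal_apply hτ MeasurableSet.univ, Set.preimage_univ]
  · exact (Real.continuous_exp.comp
      (continuous_measureReal_Ioi _).neg).aestronglyMeasurable

section Covariance

variable {X : Type*} [MeasurableSpace X]

/-- `L` is the law of a Poisson process with finite intensity measure `μ`, in terms of its void
probabilities. -/
def IsPoissonLaw (L : Measure (Finset X)) (μ : Measure X) : Prop :=
  ∀ A : Set X, MeasurableSet A → L (voidSet A) = ENNReal.ofReal (Real.exp (-μ.real A))

theorem IsPoissonLaw.isProbabilityMeasure {L : Measure (Finset X)} {μ : Measure X}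
    (h : IsPoissonLaw L μ) : IsProbabilityMeasure L :=
  ⟨by rw [← voidSet_empty, h ∅ MeasurableSet.empty]; simp⟩

/-- Adding a point or not. -/
def addIf (a : Bool) (z : X) (η : Finset X) : Finset X := bif a then addPt z η else η

theorem measurable_addIf (a : Bool) : Measurable fun p : X × Finset X => addIf a p.1 p.2 := by
  cases a
  · exact measurable_snd
  · exact measurable_addPt

theorem addIf_mem_voidSet {a : Bool} {z : X} {η : Finset X} {A : Set X} :
    addIf a z η ∈ voidSet A ↔ (a = true → z ∉ A) ∧ η ∈ voidSet A := by
  cases a <;> simp [addIf, voidSet]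

theorem mix_mem_voidSet {τ : X → I} {t : I} {η η' : Finset X} {A : Set X} :
    mix τ t η η' ∈ voidSet A ↔ η ∈ voidSet (A ∩ {x | τ x < t}) ∧
      η' ∈ voidSet (A ∩ {x | t < τ x}) := by
  simp only [voidSet, mem_mix, Set.mem_ofPred_eq, Set.mem_inter_iff, not_and, not_lt]
  constructor
  · intro h
    exact ⟨fun x hx hA => not_lt.1 fun hlt => h x (Or.inl ⟨hx, hlt⟩) hA,
      fun x hx hA => not_lt.1 fun hlt => h x (Or.inr ⟨hx, hlt⟩) hA⟩
  · rintro ⟨h1, h2⟩ x (⟨hx, hlt⟩ | ⟨hx, hlt⟩) hA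
    · exact absurd hlt (not_lt.2 (h1 x hx hA))
    · exact absurd hlt (not_lt.2 (h2 x hx hA))

/-- The law of a Poisson process and of the process mixed at time `τ z` with an independent copy,
with the point `z` added or not, where `z` has law `μ`. -/
def addMixLaw (L : Measure (Finset X)) (μ : Measure X) (τ : X → I) (a b : Bool) :
    Measure (Finset X × Finset X) :=
  (μ.prod (L.prod L)).map fun q =>
    (addIf a q.1 q.2.1, addIf b q.1 (mix τ (τ q.1) q.2.1 q.2.2))

theorem measurable_addMix {τ : X → I} (hτ : Measurable τ) (a b : Bool) :
    Measurable fun q : X × Finset X × Finset X =>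
      (addIf a q.1 q.2.1, addIf b q.1 (mix τ (τ q.1) q.2.1 q.2.2)) := by
  refine ((measurable_addIf a).comp (measurable_fst.prodMk measurable_snd.fst)).prodMk
    ((measurable_addIf b).comp (measurable_fst.prodMk ?_))
  exact (measurable_mix hτ).comp ((hτ.comp measurable_fst).prodMk measurable_snd)

variable {L : Measure (Finset X)} {μ : Measure X} {τ : X → I}

theorem measure_eq_zero_of_noAtoms_map (hτ : Measurable τ) (hμ : NullSingletonClass (μ.map τ)) (t : I) :
    μ {x | τ x = t} = 0 := by
  have := hμ.measure_singleton t
  rwa [Measure.map_apply hτ (measurableSet_singleton t)] at this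

/-- Inclusion–exclusion for the sets to be avoided by the process and by its copy. The slice of
points born exactly at t is null. -/
theorem measureReal_void_mix [IsFiniteMeasure μ] (hτ : Measurable τ)
    (hμ : NullSingletonClass (μ.map τ)) {A B : Set X} (hB : MeasurableSet B) (t : I) :
    μ.real (A ∪ (B ∩ {x | τ x < t})) + μ.real (B ∩ {x | t < τ x}) =
      μ.real (A ∪ B) + μ.real ((A ∩ B) ∩ {x | t < τ x}) := by
  have hlt : MeasurableSet {x | τ x < t} := hτ measurableSet_Iio
  have hgt : MeasurableSet {x | t < τ x} := hτ measurableSet_Ioi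
  have e1 := measureReal_union_add_inter (μ := μ) (s := A ∪ (B ∩ {x | τ x < t}))
    (t := B ∩ {x | t < τ x}) (hB.inter hgt)
  have e2 : (A ∪ (B ∩ {x | τ x < t})) ∩ (B ∩ {x | t < τ x}) = (A ∩ B) ∩ {x | t < τ x} := by
    ext x
    simp only [Set.mem_inter_iff, Set.mem_union, Set.mem_ofPred_eq]
    constructor
    · rintro ⟨h | ⟨-, h⟩, h1, h2⟩
      · exact ⟨⟨h, h1⟩, h2⟩
      · exact absurd h (not_lt.2 h2.le)
    · rintro ⟨⟨h1, h2⟩, h3⟩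
      exact ⟨Or.inl h1, h2, h3⟩
  have e3 : μ.real ((A ∪ (B ∩ {x | τ x < t})) ∪ (B ∩ {x | t < τ x})) = μ.real (A ∪ B) := by
    refine measureReal_congr ?_
    have h0 : ∀ᵐ x ∂μ, τ x ≠ t := by
      rw [ae_iff]; simpa using measure_eq_zero_of_noAtoms_map hτ hμ t
    filter_upwards [h0] with x hx
    refine propext ?_
    change ((x ∈ A ∨ (x ∈ B ∧ τ x < t)) ∨ (x ∈ B ∧ t < τ x)) ↔ (x ∈ A ∨ x ∈ B)
    rcases lt_or_gt_of_ne hx with h | h <;> (simp [h, h.le]; try tauto)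
  rw [e2, e3] at e1
  exact e1.symm

/-- The two conditions together say that η avoids A and the early part of B, and that η' avoids the
late part of B. These events are independent, and the overlap of the two sets yields the second
exponential factor. -/
theorem void_mix [IsFiniteMeasure μ] (hL : IsPoissonLaw L μ) (hτ : Measurable τ)
    (hμ : NullSingletonClass (μ.map τ)) {A B : Set X} (hA : MeasurableSet A) (hB : MeasurableSet B) (t : I) :
    (L.prod L) {p | p.1 ∈ voidSet A ∧ mix τ t p.1 p.2 ∈ voidSet B} =
      ENNReal.ofReal (Real.exp (-μ.real (A ∪ B)) *
        Real.exp (-μ.real ((A ∩ B) ∩ {x | t < τ x}))) := by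
  have := hL.isProbabilityMeasure
  have hlt : MeasurableSet {x | τ x < t} := hτ measurableSet_Iio
  have hgt : MeasurableSet {x | t < τ x} := hτ measurableSet_Ioi
  have e : {p : Finset X × Finset X | p.1 ∈ voidSet A ∧ mix τ t p.1 p.2 ∈ voidSet B} =
      voidSet (A ∪ (B ∩ {x | τ x < t})) ×ˢ voidSet (B ∩ {x | t < τ x}) := by
    ext p
    rw [← voidSet_inter]
    simp only [Set.mem_ofPred_eq, Set.mem_prod, Set.mem_inter_iff, mix_mem_voidSet]
    tauto
  rw [e, Measure.prod_prod, hL _ (hA.union (hB.inter hlt)), hL _ (hB.inter hgt),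
    ← ENNReal.ofReal_mul (Real.exp_nonneg _), ← Real.exp_add, ← Real.exp_add, ← neg_add,
    ← neg_add, measureReal_void_mix hτ hμ hB]

theorem map_mix_eq [IsFiniteMeasure μ] (hL : IsPoissonLaw L μ) (hτ : Measurable τ)
    (hμ : NullSingletonClass (μ.map τ)) (t : I) :
    (L.prod L).map (fun p => mix τ t p.1 p.2) = L := by
  have := hL.isProbabilityMeasure
  refine finset_measure_ext fun B hB => ?_
  have hm : Measurable fun p : Finset X × Finset X => mix τ t p.1 p.2 :=
    (measurable_mix hτ).comp (measurable_const.prodMk measurable_id)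
  rw [Measure.map_apply hm (measurableSet_voidSet hB)]
  have := void_mix hL hτ hμ MeasurableSet.empty hB t
  simp only [voidSet_empty, Set.mem_univ, true_and, Set.empty_union, Set.empty_inter,
    measureReal_empty, neg_zero, Real.exp_zero, mul_one] at this
  rw [hL B hB, ← this]
  rfl

/-- Given z, a raised flag only excludes z from the corresponding set. What remains is the event of
`void_mix` at time τ z, which is the same for all four pairs of flags. -/
theorem addMixLaw_voidSet [IsFiniteMeasure μ] (hL : IsPoissonLaw L μ) (hτ : Measurable τ)
    (hμ : NullSingletonClass (μ.map τ)) {A B : Set X} (hA : MeasurableSet A) (hB : MeasurableSet B)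
    (a b : Bool) :
    addMixLaw L μ τ a b (voidSet A ×ˢ voidSet B) =
      (μ.withDensity fun z => ENNReal.ofReal (Real.exp (-μ.real (A ∪ B)) *
        Real.exp (-μ.real ((A ∩ B) ∩ {x | τ z < τ x}))))
        ({z | a = true → z ∉ A} ∩ {z | b = true → z ∉ B}) := by
  have := hL.isProbabilityMeasure
  have hE : ∀ (c : Bool) {C : Set X}, MeasurableSet C → MeasurableSet {z | c = true → z ∉ C} := by
    intro c C hC
    cases c
    · simp
    · simp only [forall_const]; exact hC.compl
  have hm := measurable_addMix hτ a b
  rw [addMixLaw, Measure.map_apply hm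
    ((measurableSet_voidSet hA).prod (measurableSet_voidSet hB)), Measure.prod_apply
    (hm ((measurableSet_voidSet hA).prod (measurableSet_voidSet hB))),
    withDensity_apply _ ((hE a hA).inter (hE b hB)),
    ← lintegral_indicator ((hE a hA).inter (hE b hB))]
  refine lintegral_congr fun z => ?_
  by_cases hz : z ∈ {z | a = true → z ∉ A} ∩ {z | b = true → z ∉ B}
  · rw [Set.indicator_of_mem hz, ← void_mix hL hτ hμ hA hB]
    congr 1
    ext p
    simp only [Set.mem_preimage, Set.mem_prod, addIf_mem_voidSet, Set.mem_ofPred_eq]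
    exact ⟨fun h => ⟨h.1.2, h.2.2⟩, fun h => ⟨⟨hz.1, h.1⟩, hz.2, h.2⟩⟩
  · rw [Set.indicator_of_notMem hz]
    convert measure_empty (μ := L.prod L)
    refine Set.eq_empty_of_forall_notMem fun p hp => hz ?_
    simp only [Set.mem_preimage, Set.mem_prod, addIf_mem_voidSet] at hp
    exact ⟨hp.1.1, hp.2.1⟩

/-- The covariance identity, as an equality of measures: tested against `F(η) G(η')` it expresses
`Cov(F, G)` as `∫ E[D_z F(η) D_z G(mix (τ z) η η')] μ(dz)`. -/
theorem covariance_identity [IsFiniteMeasure μ] (hL : IsPoissonLaw L μ) (hτ : Measurable τ)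
    (hμ : NullSingletonClass (μ.map τ)) :
    L.map (fun η => (η, η)) + addMixLaw L μ τ true false + addMixLaw L μ τ false true =
      L.prod L + addMixLaw L μ τ true true + addMixLaw L μ τ false false := by
  have := hL.isProbabilityMeasure
  have hfin : ∀ a b, IsFiniteMeasure (addMixLaw L μ τ a b) := fun a b => by
    unfold addMixLaw; infer_instance
  refine finset_prod_measure_ext fun A B hA hB => ?_
  have hφm : Measurable fun z => ENNReal.ofReal (Real.exp (-μ.real (A ∪ B)) *
      Real.exp (-μ.real ((A ∩ B) ∩ {x | τ z < τ x}))) := by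
    have : Measurable fun t : I => μ.real ((A ∩ B) ∩ {x | t < τ x}) := by
      refine Antitone.measurable fun s t hst => measureReal_mono ?_
      exact Set.inter_subset_inter_right _ fun x hx => lt_of_le_of_lt hst hx
    exact ENNReal.measurable_ofReal.comp (measurable_const.mul
      (Real.measurable_exp.comp (this.comp hτ).neg))
  have hle : ∀ z, Real.exp (-μ.real (A ∪ B)) *
      Real.exp (-μ.real ((A ∩ B) ∩ {x | τ z < τ x})) ≤ 1 := fun z =>
    mul_le_one₀ (Real.exp_le_one_iff.2 (neg_nonpos.2 measureReal_nonneg)) (Real.exp_nonneg _)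
      (Real.exp_le_one_iff.2 (neg_nonpos.2 measureReal_nonneg))
  rw [Measure.add_apply, Measure.add_apply, Measure.add_apply, Measure.add_apply,
    Measure.prod_prod]
  simp_rw [addMixLaw_voidSet hL hτ hμ hA hB]
  set ν := μ.withDensity fun z => ENNReal.ofReal (Real.exp (-μ.real (A ∪ B)) *
        Real.exp (-μ.real ((A ∩ B) ∩ {x | τ z < τ x}))) with hνdef
  have hν : IsFiniteMeasure ν := by
    refine ⟨?_⟩
    rw [hνdef, withDensity_apply _ MeasurableSet.univ, Measure.restrict_univ]
    calc _ ≤ ∫⁻ _, 1 ∂μ := lintegral_mono fun z => by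
          simpa using ENNReal.ofReal_le_ofReal (hle z)
      _ < ∞ := by simp
  have hd : L.map (fun η => (η, η)) (voidSet A ×ˢ voidSet B) = L (voidSet (A ∪ B)) := by
    have hm : Measurable fun η : Finset X => (η, η) := measurable_id.prodMk measurable_id
    rw [Measure.map_apply hm ((measurableSet_voidSet hA).prod (measurableSet_voidSet hB)), ← voidSet_inter]
    rfl
  rw [hd, hL _ (hA.union hB), hL A hA, hL B hB]
  -- This is the one probabilistic computation: the tail integral is applied to μ restricted to `A ∩
  -- B`.
  have hAB : ν.real (A ∩ B) = Real.exp (-μ.real (A ∪ B)) * (1 - Real.exp (-μ.real (A ∩ B))) := by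
    have hρ : NullSingletonClass ((μ.restrict (A ∩ B)).map τ) := ⟨fun t => by
      rw [Measure.map_apply hτ (measurableSet_singleton t)]
      exact le_antisymm ((Measure.restrict_apply_le _ _).trans
        (measure_eq_zero_of_noAtoms_map hτ hμ t).le) bot_le⟩
    have h1 := integral_exp_neg_measureReal_lt (μ.restrict (A ∩ B)) hτ hρ
    rw [measureReal_restrict_apply_univ] at h1
    rw [← h1, ← integral_const_mul, measureReal_def, hνdef,
      withDensity_apply _ (hA.inter hB), integral_eq_lintegral_of_nonneg_ae
        (Eventually.of_forall fun z => mul_nonneg (Real.exp_nonneg _) (Real.exp_nonneg _))]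
    · congr 1
      refine lintegral_congr fun z => ?_
      have hgt : MeasurableSet {x | τ z < τ x} := hτ measurableSet_Ioi
      rw [measureReal_restrict_apply hgt, Set.inter_comm {x | τ z < τ x}]
    · have : Measurable fun t : I => (μ.restrict (A ∩ B)).real {x | t < τ x} := by
        refine Antitone.measurable fun s t hst => measureReal_mono ?_
        exact fun x hx => lt_of_le_of_lt hst hx
      exact (measurable_const.mul (Real.measurable_exp.comp
        (this.comp hτ).neg)).aestronglyMeasurable
  have hof : ∀ E, ν E = ENNReal.ofReal (ν.real E) := fun E => by
    rw [measureReal_def, ENNReal.ofReal_toReal (measure_ne_top _ _)]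
  have eA : {z : X | True → z ∉ A} = Aᶜ := by ext; simp
  have eB : {z : X | True → z ∉ B} = Bᶜ := by ext; simp
  have eA' : {z : X | false = true → z ∉ A} = Set.univ := by ext; simp
  have eB' : {z : X | false = true → z ∉ B} = Set.univ := by ext; simp
  rw [eA, eB, eA', eB', Set.inter_univ, Set.univ_inter, Set.univ_inter, ← Set.compl_union,
    hof, hof, hof, hof, ← ENNReal.ofReal_mul (Real.exp_nonneg _),
    ← ENNReal.ofReal_add (Real.exp_nonneg _) measureReal_nonneg,
    ← ENNReal.ofReal_add (by positivity) measureReal_nonneg,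
    ← ENNReal.ofReal_add (by positivity) measureReal_nonneg,
    ← ENNReal.ofReal_add (by positivity) measureReal_nonneg]
  congr 1
  -- By inclusion–exclusion the four terms with an added point collapse to ν(A ∩ B). The claim
  -- becomes exp(-μ(A ∪ B)) - exp(-μ(A)) exp(-μ(B)) = ν(A ∩ B).
  have c1 := measureReal_add_measureReal_compl (μ := ν) hA
  have c2 := measureReal_add_measureReal_compl (μ := ν) hB
  have c3 := measureReal_add_measureReal_compl (μ := ν) (hA.union hB)
  have c4 := measureReal_union_add_inter (μ := ν) (s := A) hB
  have c5 : Real.exp (-μ.real (A ∪ B)) * Real.exp (-μ.real (A ∩ B)) =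
      Real.exp (-μ.real A) * Real.exp (-μ.real B) := by
    rw [← Real.exp_add, ← Real.exp_add, ← neg_add, ← neg_add,
      measureReal_union_add_inter (μ := μ) (s := A) hB]
  rw [← c5]
  nlinarith [c1, c2, c3, c4, hAB]

end Covariance

/-! ### Poisson processes as mixed samples -/

section Representation

variable {X Z : Type*}

open Classical in
/-- The finite set of the images `g (z i)` of those sample points which carry the flag `c`. -/
def sampleConfig (g : Z → X) (b : Z → Bool) (c : Bool) {n : ℕ} (z : Fin n → Z) : Finset X :=
  (Finset.univ.filter fun i => b (z i) = c).image fun i => g (z i)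

theorem mem_sampleConfig {g : Z → X} {b : Z → Bool} {c : Bool} {n : ℕ} {z : Fin n → Z} {x : X} :
    x ∈ sampleConfig g b c z ↔ ∃ i, b (z i) = c ∧ g (z i) = x := by
  simp [sampleConfig]

variable [MeasurableSpace X] [MeasurableSpace Z]

theorem measurable_sampleConfig {g : Z → X} (hg : Measurable g) {b : Z → Bool} (hb : Measurable b)
    (c : Bool) (n : ℕ) : Measurable fun z : Fin n → Z => sampleConfig g b c z := by
  refine measurable_to_finset_of_hit fun A hA => ?_
  have : {z : Fin n → Z | ∃ x ∈ sampleConfig g b c z, x ∈ A} =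
      ⋃ i, {z | b (z i) = c ∧ g (z i) ∈ A} := by
    ext z
    simp only [mem_sampleConfig, Set.mem_ofPred_eq, Set.mem_iUnion]
    constructor
    · rintro ⟨_, ⟨i, hi, rfl⟩, hA⟩; exact ⟨i, hi, hA⟩
    · rintro ⟨i, hi, hA⟩; exact ⟨_, ⟨i, hi, rfl⟩, hA⟩
  rw [this]
  refine MeasurableSet.iUnion fun i => ?_
  exact ((hb.comp (measurable_pi_apply i)) (measurableSet_singleton c)).inter
    ((hg.comp (measurable_pi_apply i)) hA)

/-- The weight of the samples of size `n`. -/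
def sampleWeight (m : ℝ) (n : ℕ) : ℝ≥0∞ := ENNReal.ofReal (Real.exp (-m) / n.factorial)

/-- The samples below are drawn from powers of an unnormalised measure, so the weights carry no
power of the mass. Here r is the mass of the admissible sample points, and the sum is the
exponential series. -/
theorem tsum_sampleWeight_mul (m : ℝ) (r : ℝ≥0∞) (hr : r ≠ ∞) :
    ∑' n, sampleWeight m n * r ^ n = ENNReal.ofReal (Real.exp (-m + r.toReal)) := by
  lift r to ℝ≥0 using hr
  have h := hasSum_one_poissonMeasure r
  have h2 := (h.mul_left (Real.exp (-m + r)))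
  rw [mul_one] at h2
  have e : ∀ n : ℕ, sampleWeight m n * (r : ℝ≥0∞) ^ n =
      ENNReal.ofReal (Real.exp (-m + r) * (Real.exp (-r) * r ^ n / n.factorial)) := by
    intro n
    rw [sampleWeight, ← ENNReal.ofReal_coe_nnreal, ← ENNReal.ofReal_pow r.coe_nonneg,
      ← ENNReal.ofReal_mul (by positivity), Real.exp_add, Real.exp_neg (r : ℝ)]
    congr 1
    have := (Real.exp_pos (r : ℝ)).ne'
    field_simp
  simp_rw [e]
  rw [← ENNReal.ofReal_tsum_of_nonneg (fun n => by positivity) h2.summable, h2.tsum_eq]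
  rfl

variable {L : Measure (Finset X)} {μ : Measure X}

/-- Two independent Poisson processes with intensity measure `μ` are the two parts of a mixed
sample of flagged points. -/
theorem prod_eq_sum_sample [IsFiniteMeasure μ] (hL : IsPoissonLaw L μ) (ζ : Measure Z)
    [IsFiniteMeasure ζ] {g : Z → X} (hg : Measurable g) {b : Z → Bool} (hb : Measurable b)
    (h : ∀ (c : Bool) (A : Set X), MeasurableSet A → ζ {z | b z = c ∧ g z ∈ A} = μ A) :
    L.prod L = Measure.sum fun n => sampleWeight (2 * μ.real Set.univ) n •
      (Measure.pi fun _ : Fin n => ζ).map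
        fun z => (sampleConfig g b false z, sampleConfig g b true z) := by
  have := hL.isProbabilityMeasure
  refine finset_prod_measure_ext fun A B hA hB => ?_
  have hAB := (measurableSet_voidSet hA).prod (measurableSet_voidSet hB)
  have hm : ∀ n, Measurable fun z : Fin n → Z =>
      (sampleConfig g b false z, sampleConfig g b true z) := fun n =>
    (measurable_sampleConfig hg hb false n).prodMk (measurable_sampleConfig hg hb true n)
  -- G consists of the flagged points that violate neither void condition. A sample satisfies both
  -- conditions exactly when all its points lie in G.
  set G : Set Z := {z | b z = false ∧ g z ∈ Aᶜ} ∪ {z | b z = true ∧ g z ∈ Bᶜ} with hG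
  have hGm : MeasurableSet G :=
    ((hb (measurableSet_singleton _)).inter (hg hA.compl)).union
      ((hb (measurableSet_singleton _)).inter (hg hB.compl))
  have hζG : ζ G = μ Aᶜ + μ Bᶜ := by
    have hm2 : MeasurableSet {z | b z = true ∧ g z ∈ Bᶜ} :=
      (hb (measurableSet_singleton _)).inter (hg hB.compl)
    rw [hG, measure_union _ hm2, h _ _ hA.compl, h _ _ hB.compl]
    refine Set.disjoint_left.2 fun z hz hz' => ?_
    have h1 : b z = false := hz.1
    rw [hz'.1] at h1
    exact Bool.noConfusion h1
  have hpre : ∀ n, (fun z : Fin n → Z => (sampleConfig g b false z, sampleConfig g b true z)) ⁻¹'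
      (voidSet A ×ˢ voidSet B) = Set.univ.pi fun _ => G := by
    intro n
    ext z
    simp only [Set.mem_preimage, Set.mem_prod, mem_voidSet, mem_sampleConfig, Set.mem_univ_pi, hG,
      Set.mem_union, Set.mem_ofPred_eq, Set.mem_compl_iff]
    constructor
    · rintro ⟨h1, h2⟩ i
      cases hbi : b (z i)
      · exact Or.inl ⟨rfl, h1 _ ⟨i, hbi, rfl⟩⟩
      · exact Or.inr ⟨rfl, h2 _ ⟨i, hbi, rfl⟩⟩
    · intro hz
      constructor
      · rintro _ ⟨i, hi, rfl⟩
        rcases hz i with h1 | h1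
        · exact h1.2
        · rw [hi] at h1; exact Bool.noConfusion h1.1
      · rintro _ ⟨i, hi, rfl⟩
        rcases hz i with h1 | h1
        · rw [hi] at h1; exact Bool.noConfusion h1.1
        · exact h1.2
  rw [Measure.prod_prod, hL A hA, hL B hB, Measure.sum_apply _ hAB]
  simp_rw [Measure.smul_apply, Measure.map_apply (hm _) hAB, hpre, Measure.pi_pi,
    Finset.prod_const, Finset.card_univ, Fintype.card_fin, smul_eq_mul]
  rw [tsum_sampleWeight_mul _ _ (measure_ne_top _ _), ← ENNReal.ofReal_mul (Real.exp_nonneg _),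
    ← Real.exp_add, hζG, ENNReal.toReal_add (measure_ne_top _ _) (measure_ne_top _ _)]
  -- The exponents agree because -2μ(X) + μ(Aᶜ) + μ(Bᶜ) = -μ(A) - μ(B).
  congr 2
  have c1 := measureReal_add_measureReal_compl (μ := μ) hA
  have c2 := measureReal_add_measureReal_compl (μ := μ) hB
  simp only [measureReal_def] at *
  linarith

/-- The expectation of a functional of an independent mark and of two independent marked Poisson
processes, where the sample points split into a skeleton and a mark. -/
theorem lintegral_prod_eq_tsum_sample {S M : Type*} [MeasurableSpace S] [MeasurableSpace M]
    [IsFiniteMeasure μ] (hL : IsPoissonLaw L μ) (κ : Measure S) [IsFiniteMeasure κ]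
    (ν : Measure M) [IsProbabilityMeasure ν] {g : S × M → X} (hg : Measurable g) {b : S → Bool}
    (hb : Measurable b) (h : ∀ (c : Bool) (A : Set X), MeasurableSet A →
      (κ.prod ν) {z | b z.1 = c ∧ g z ∈ A} = μ A)
    {Ψ : M × Finset X × Finset X → ℝ≥0∞} (hΨ : Measurable Ψ) :
    ∫⁻ p, Ψ p ∂(ν.prod (L.prod L)) = ∑' n, sampleWeight (2 * μ.real Set.univ) n *
      ∫⁻ k, ∫⁻ v, Ψ (v 0, sampleConfig g (fun z => b z.1) false (fun i => (k i, v i.succ)),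
        sampleConfig g (fun z => b z.1) true (fun i => (k i, v i.succ)))
        ∂(Measure.pi fun _ : Fin (n + 1) => ν) ∂(Measure.pi fun _ : Fin n => κ) := by
  have := hL.isProbabilityMeasure
  have hb' : Measurable fun z : S × M => b z.1 := hb.comp measurable_fst
  have hm : ∀ n, Measurable fun z : Fin n → S × M =>
      (sampleConfig g (fun z => b z.1) false z, sampleConfig g (fun z => b z.1) true z) := fun n =>
    (measurable_sampleConfig hg hb' false n).prodMk (measurable_sampleConfig hg hb' true n)
  rw [lintegral_prod _ hΨ.aemeasurable]
  have e1 : ∀ x, ∫⁻ y, Ψ (x, y) ∂(L.prod L) = ∑' n, sampleWeight (2 * μ.real Set.univ) n *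
      ∫⁻ z, Ψ (x, sampleConfig g (fun z => b z.1) false z, sampleConfig g (fun z => b z.1) true z)
        ∂(Measure.pi fun _ : Fin n => κ.prod ν) := by
    intro x
    have hx : Measurable fun y => Ψ (x, y) := hΨ.comp (measurable_const.prodMk measurable_id)
    rw [prod_eq_sum_sample hL (κ.prod ν) hg hb' h, lintegral_sum_measure]
    refine tsum_congr fun n => ?_
    rw [lintegral_smul_measure, smul_eq_mul, lintegral_map hx (hm n)]
  simp_rw [e1]
  have hm2 : ∀ n, Measurable fun p : M × (Fin n → S × M) => Ψ (p.1,
      sampleConfig g (fun z => b z.1) false p.2, sampleConfig g (fun z => b z.1) true p.2) :=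
    fun n => hΨ.comp (measurable_fst.prodMk ((hm n).comp measurable_snd))
  rw [lintegral_tsum fun n => ((hm2 n).lintegral_prod_right'.const_mul _).aemeasurable]
  refine tsum_congr fun n => ?_
  rw [lintegral_const_mul _ (hm2 n).lintegral_prod_right']
  congr 1
  have e2 := (measurePreserving_arrowProdEquivProdArrow S M (Fin n) (fun _ => κ) (fun _ => ν)).symm
  have e3 := measurePreserving_piFinSuccAbove (fun _ : Fin (n + 1) => ν) 0
  have hm3 : Measurable fun p : (Fin n → S) × M × (Fin n → M) => Ψ (p.2.1,
      sampleConfig g (fun z => b z.1) false (fun i => (p.1 i, p.2.2 i)),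
      sampleConfig g (fun z => b z.1) true (fun i => (p.1 i, p.2.2 i))) := by
    have h1 : Measurable fun p : (Fin n → S) × M × (Fin n → M) =>
        (fun i => (p.1 i, p.2.2 i) : Fin n → S × M) := by fun_prop
    exact (hm2 n).comp (measurable_snd.fst.prodMk h1)
  calc ∫⁻ x, ∫⁻ z, Ψ (x, sampleConfig g (fun z => b z.1) false z,
        sampleConfig g (fun z => b z.1) true z) ∂(Measure.pi fun _ : Fin n => κ.prod ν) ∂ν
      = ∫⁻ x, ∫⁻ q : (Fin n → S) × (Fin n → M), Ψ (x,
          sampleConfig g (fun z => b z.1) false (fun i => (q.1 i, q.2 i)),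
          sampleConfig g (fun z => b z.1) true (fun i => (q.1 i, q.2 i)))
          ∂((Measure.pi fun _ => κ).prod (Measure.pi fun _ => ν)) ∂ν := by
        refine lintegral_congr fun x => ?_
        exact (e2.lintegral_comp ((hm2 n).comp (measurable_const.prodMk measurable_id))).symm
    _ = ∫⁻ x, ∫⁻ k, ∫⁻ w, Ψ (x,
          sampleConfig g (fun z => b z.1) false (fun i => (k i, w i)),
          sampleConfig g (fun z => b z.1) true (fun i => (k i, w i)))
          ∂(Measure.pi fun _ : Fin n => ν) ∂(Measure.pi fun _ => κ) ∂ν := by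
        refine lintegral_congr fun x => ?_
        rw [lintegral_prod]
        exact (hm3.comp (measurable_fst.prodMk
          (measurable_const.prodMk measurable_snd))).aemeasurable
    _ = ∫⁻ k, ∫⁻ x, ∫⁻ w, Ψ (x,
          sampleConfig g (fun z => b z.1) false (fun i => (k i, w i)),
          sampleConfig g (fun z => b z.1) true (fun i => (k i, w i)))
          ∂(Measure.pi fun _ : Fin n => ν) ∂ν ∂(Measure.pi fun _ => κ) := by
        rw [lintegral_lintegral_swap]
        refine (Measurable.lintegral_prod_right' (f := fun p : (M × (Fin n → S)) × (Fin n → M) =>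
          Ψ (p.1.1, sampleConfig g (fun z => b z.1) false (fun i => (p.1.2 i, p.2 i)),
          sampleConfig g (fun z => b z.1) true (fun i => (p.1.2 i, p.2 i)))) ?_).aemeasurable
        exact hm3.comp (measurable_fst.snd.prodMk (measurable_fst.fst.prodMk measurable_snd))
    _ = _ := by
        refine lintegral_congr fun k => ?_
        have hk := hm3.comp (measurable_const (a := k) |>.prodMk measurable_id)
        rw [← lintegral_prod (fun p : M × (Fin n → M) => Ψ (p.1,
          sampleConfig g (fun z => b z.1) false (fun i => (k i, p.2 i)),
          sampleConfig g (fun z => b z.1) true (fun i => (k i, p.2 i)))) hk.aemeasurable]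
        exact (e3.lintegral_comp hk).symm

end Representation

/-! ### Measurability of the edge marking mapping -/

section GraphMeasurability

variable {d : ℕ}

/-- Countably many tests decide whether a vertex is off an edge. This serves both to separate
unordered pairs and to make the removal of a variable vertex measurable. -/
theorem exists_countable_separating_sym2 {α : Type*} [TopologicalSpace α] [T1Space α]
    [SecondCountableTopology α] [MeasurableSpace α] [BorelSpace α] :
    ∃ 𝒰 : Set (Set α), 𝒰.Countable ∧ (∀ U ∈ 𝒰, MeasurableSet U) ∧
      ∀ (x : α) (e : Sym2 α), x ∉ e → ∃ U ∈ 𝒰, x ∈ U ∧ ∀ y ∈ e, y ∉ U := by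
  refine ⟨TopologicalSpace.countableBasis α, TopologicalSpace.countable_countableBasis _,
    fun U hU => (TopologicalSpace.isOpen_of_mem_countableBasis hU).measurableSet, ?_⟩
  intro x e hx
  induction e using Sym2.ind with
  | _ a b =>
    have hb := TopologicalSpace.isBasis_countableBasis α
    have ho : IsOpen ({a, b}ᶜ : Set α) := (Set.toFinite _).isClosed.isOpen_compl
    have hx' : x ∈ ({a, b}ᶜ : Set α) := by simpa using hx
    obtain ⟨U, hU, hxU, hUs⟩ := hb.exists_subset_of_mem_open hx' ho
    refine ⟨U, hU, hxU, fun y hy hyU => ?_⟩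
    have := hUs hyU
    simp only [Set.mem_compl_iff, Set.mem_insert_iff, Set.mem_singleton_iff] at this
    exact this (Sym2.mem_iff.1 hy)

theorem measurableSet_sym2_avoid {α : Type*} [MeasurableSpace α] {U : Set α}
    (hU : MeasurableSet U) : MeasurableSet {e : Sym2 α | ∀ y ∈ e, y ∉ U} := by
  change MeasurableSet ((fun p : α × α => s(p.1, p.2)) ⁻¹' {e : Sym2 α | ∀ y ∈ e, y ∉ U})
  have : (fun p : α × α => s(p.1, p.2)) ⁻¹' {e : Sym2 α | ∀ y ∈ e, y ∉ U} = Uᶜ ×ˢ Uᶜ := by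
    ext p; simp
  rw [this]
  exact hU.compl.prod hU.compl

theorem countablySeparated_sym2 {α : Type*} [TopologicalSpace α] [T1Space α]
    [SecondCountableTopology α] [MeasurableSpace α] [BorelSpace α] :
    MeasurableSpace.CountablySeparated (Sym2 α) := by
  obtain ⟨𝒰, hc, hm, hsep⟩ := exists_countable_separating_sym2 (α := α)
  refine ⟨⟨(fun U => {e : Sym2 α | ∀ y ∈ e, y ∉ U}) '' 𝒰, hc.image _, ?_, ?_⟩⟩
  · rintro _ ⟨U, hU, rfl⟩
    exact measurableSet_sym2_avoid (hm U hU)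
  · intro e _ e' _ h
    refine Sym2.ext fun x => ?_
    by_contra hx
    rcases not_iff.1 hx |>.symm with hx
    by_cases h1 : x ∈ e
    · have h2 : x ∉ e' := fun h2 => hx.1 h2 h1
      obtain ⟨U, hU, hxU, he⟩ := hsep x e' h2
      exact (h _ ⟨U, hU, rfl⟩).2 he x h1 hxU
    · have h2 : x ∈ e' := hx.2 h1
      obtain ⟨U, hU, hxU, he⟩ := hsep x e h1
      exact (h _ ⟨U, hU, rfl⟩).1 he x h2 hxU

theorem countablySeparated_prod {α β : Type*} [MeasurableSpace α] [MeasurableSpace β]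
    [MeasurableSpace.CountablySeparated α] [MeasurableSpace.CountablySeparated β] :
    MeasurableSpace.CountablySeparated (α × β) := by
  obtain ⟨f, hf, hfi⟩ := MeasurableSpace.measurable_injection_nat_bool_of_countablySeparated α
  obtain ⟨g, hg, hgi⟩ := MeasurableSpace.measurable_injection_nat_bool_of_countablySeparated β
  obtain ⟨S, hSc, hSm, hS⟩ := HasCountableSeparatingOn.exists_countable_separating
    (α := (ℕ → Bool) × (ℕ → Bool)) (p := MeasurableSet) (t := Set.univ)
  refine ⟨⟨(fun s => (Prod.map f g) ⁻¹' s) '' S, hSc.image _, ?_, ?_⟩⟩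
  · rintro _ ⟨s, hs, rfl⟩
    exact (hf.prodMap hg) (hSm s hs)
  · intro x _ y _ h
    refine (hfi.prodMap hgi) (hS _ trivial _ trivial fun s hs => ?_)
    exact h _ ⟨s, hs, rfl⟩

theorem countablySeparated_edge : MeasurableSpace.CountablySeparated (Edge d) :=
  have : MeasurableSpace.CountablySeparated (Sym2 (Fin d → ℝ)) := countablySeparated_sym2
  MeasurableSpace.Subtype.countablySeparated (s := {e : Sym2 (Fin d → ℝ) | ¬ e.IsDiag})

instance : MeasurableSpace.CountablySeparated (MarkedEdge d) :=
  have := countablySeparated_edge (d := d)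
  countablySeparated_prod

/-- The functional f is assumed measurable for the sigma-field of counts, while the proof works with
void events throughout. Counts of a countably separated space are measurable for the void
sigma-field, so the assumption on f passes over. -/
theorem markedEdgeSets_le : markedEdgeSets d ≤ finsetMeasurableSpace := by
  refine iSup₂_le fun A hA => ?_
  refine Measurable.comap_le ?_
  refine measurable_encard_of_void (S := fun G : Finset (MarkedEdge d) =>
    (G : Set (MarkedEdge d))) (fun C hC => ?_) hA
  exact measurableSet_hit hC

/-- The event that an edge between two given locations with a given mark lies in `A`. -/
def edgeSet (A : Set (MarkedEdge d)) : Set (((Fin d → ℝ) × (Fin d → ℝ)) × I) :=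
  {p | ∃ h : ¬ (s(p.1.1, p.1.2) : Sym2 (Fin d → ℝ)).IsDiag, ((⟨s(p.1.1, p.1.2), h⟩, p.2) :
    MarkedEdge d) ∈ A}

theorem measurableSet_edgeSet {A : Set (MarkedEdge d)} (hA : MeasurableSet A) :
    MeasurableSet (edgeSet A) := by
  set D : Set (((Fin d → ℝ) × (Fin d → ℝ)) × I) :=
    {p | ¬ (s(p.1.1, p.1.2) : Sym2 (Fin d → ℝ)).IsDiag} with hD
  have hDm : MeasurableSet D := by
    have : D = {p | p.1.1 = p.1.2}ᶜ := by ext p; simp [hD]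
    rw [this]
    exact (measurableSet_eq_fun measurable_fst.fst measurable_fst.snd).compl
  let φ : D → MarkedEdge d := fun p => (⟨s(p.1.1.1, p.1.1.2), p.2⟩, p.1.2)
  have hs : Measurable fun p : (Fin d → ℝ) × (Fin d → ℝ) => s(p.1, p.2) := fun _ h => h
  have hφ : Measurable φ :=
    (Measurable.subtype_mk (hs.comp (measurable_subtype_coe.fst))).prodMk
      measurable_subtype_coe.snd
  have : edgeSet A = Subtype.val '' (φ ⁻¹' A) := by
    ext p
    constructor
    · rintro ⟨h, hA⟩
      exact ⟨⟨p, h⟩, hA, rfl⟩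
    · rintro ⟨q, hq, rfl⟩
      exact ⟨q.2, hq⟩
  rw [this]
  exact hDm.subtype_image (hφ hA)

theorem mem_graph {B : ℕ ≃ (Fin d → ℤ)} {η : Finset (Pt d)} {e : MarkedEdge d} :
    e ∈ graph B η ↔ ∃ p ∈ η, ∃ q ∈ η, p.2.1 < q.2.1 ∧ e.1.1 = s(p.1, q.1) ∧
      e.2 = q.2.2 (rank (η : Set (Pt d)) p, B.symm (cell p.1)) := by
  simp [graph, edgeMarking]

theorem graph_hit_iff {B : ℕ ≃ (Fin d → ℤ)} {η : Finset (Pt d)} {A : Set (MarkedEdge d)} :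
    (∃ e ∈ graph B η, e ∈ A) ↔ ∃ p ∈ η, ∃ q ∈ η, p.2.1 < q.2.1 ∧
      ((p.1, q.1), q.2.2 (rank (η : Set (Pt d)) p, B.symm (cell p.1))) ∈ edgeSet A := by
  constructor
  · rintro ⟨⟨⟨e, he⟩, u⟩, hG, hA⟩
    obtain ⟨p, hp, q, hq, hlt, h1, h2⟩ := mem_graph.1 hG
    simp only at h1 h2
    subst h1 h2
    exact ⟨p, hp, q, hq, hlt, he, hA⟩
  · rintro ⟨p, hp, q, hq, hlt, he, hA⟩
    exact ⟨_, mem_graph.2 ⟨p, hp, q, hq, hlt, rfl, rfl⟩, hA⟩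

theorem measurable_cell : Measurable (cell (d := d)) :=
  measurable_pi_lambda _ fun i => Int.measurable_floor.comp (measurable_pi_apply i)

open Classical in
/-- The set of the first `n` terms of a sequence. -/
def initialFinset {X : Type*} (p : ℕ × (ℕ → X)) : Finset X := (Finset.range p.1).image p.2

theorem mem_initialFinset {X : Type*} {p : ℕ × (ℕ → X)} {x : X} :
    x ∈ initialFinset p ↔ ∃ i < p.1, p.2 i = x := by simp [initialFinset]

theorem measurable_initialFinset {X : Type*} [MeasurableSpace X] :
    Measurable (initialFinset (X := X)) := by
  refine measurable_to_finset_of_hit fun A hA => ?_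
  have : {p : ℕ × (ℕ → X) | ∃ x ∈ initialFinset p, x ∈ A} =
      ⋃ i, {p | i < p.1 ∧ p.2 i ∈ A} := by
    ext p
    simp only [mem_initialFinset, Set.mem_ofPred_eq, Set.mem_iUnion]
    constructor
    · rintro ⟨_, ⟨i, hi, rfl⟩, hA⟩; exact ⟨i, hi, hA⟩
    · rintro ⟨i, hi, hA⟩; exact ⟨_, ⟨i, hi, rfl⟩, hA⟩
  rw [this]
  refine MeasurableSet.iUnion fun i => ?_
  exact (measurableSet_lt measurable_const measurable_fst).inter
    (((measurable_pi_apply i).comp measurable_snd) hA)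

theorem surjective_initialFinset {X : Type*} [Nonempty X] :
    Function.Surjective (initialFinset (X := X)) := by
  classical
  intro F
  obtain ⟨l, hl⟩ := F.exists_list_nodup_eq
  refine ⟨(l.length, fun i => l.getD i (Classical.arbitrary X)), ?_⟩
  ext x
  rw [mem_initialFinset, ← hl.2, List.mem_toFinset, List.mem_iff_getElem]
  constructor
  · rintro ⟨i, hi, hx⟩
    exact ⟨i, hi, (List.getD_eq_getElem _ _ hi).symm.trans hx⟩
  · rintro ⟨i, hi, hx⟩
    exact ⟨i, hi, (List.getD_eq_getElem _ _ hi).trans hx⟩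

theorem measurable_rank_initialFinset (i : ℕ) : Measurable fun z : ℕ × (ℕ → Pt d) =>
    rank (initialFinset z : Set (Pt d)) (z.2 i) := by
  have h : Measurable fun z : ℕ × (ℕ → Pt d) => ({q | q ∈ (initialFinset z : Set (Pt d)) ∧
      cell q.1 = cell (z.2 i).1 ∧ q.2.1 < (z.2 i).2.1} ∩ Set.univ).encard := by
    -- Terms of the sequence may coincide, so the rank is the cardinality of a set of points and not
    -- a number of indices. It is reached through void events.
    refine measurable_encard_of_void (fun A hA => ?_) MeasurableSet.univ
    have : {z : ℕ × (ℕ → Pt d) | ({q | q ∈ (initialFinset z : Set (Pt d)) ∧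
        cell q.1 = cell (z.2 i).1 ∧ q.2.1 < (z.2 i).2.1} ∩ A).Nonempty} =
        ⋃ j, {z | j < z.1 ∧ z.2 j ∈ A ∧ cell (z.2 j).1 = cell (z.2 i).1 ∧
          (z.2 j).2.1 < (z.2 i).2.1} := by
      ext z
      simp only [Set.Nonempty, Set.mem_inter_iff, Set.mem_ofPred_eq, Finset.mem_coe,
        mem_initialFinset, Set.mem_iUnion]
      constructor
      · rintro ⟨_, ⟨⟨j, hj, rfl⟩, h1, h2⟩, hA⟩; exact ⟨j, hj, hA, h1, h2⟩
      · rintro ⟨j, hj, hA, h1, h2⟩; exact ⟨_, ⟨⟨j, hj, rfl⟩, h1, h2⟩, hA⟩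
    rw [this]
    refine MeasurableSet.iUnion fun j => ?_
    have hz : ∀ k, Measurable fun z : ℕ × (ℕ → Pt d) => z.2 k := fun k =>
      (measurable_pi_apply k).comp measurable_snd
    have h1 : MeasurableSet {z : ℕ × (ℕ → Pt d) | cell (z.2 j).1 = cell (z.2 i).1} :=
      measurableSet_eq_fun (measurable_cell.comp (hz j).fst) (measurable_cell.comp (hz i).fst)
    have h2 : MeasurableSet {z : ℕ × (ℕ → Pt d) | (z.2 j).2.1 < (z.2 i).2.1} :=
      measurableSet_lt (hz j).snd.fst (hz i).snd.fst
    exact (measurableSet_lt measurable_const measurable_fst).inter ((hz j hA).inter (h1.inter h2))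
  simp only [Set.inter_univ] at h
  exact (Measurable.of_discrete (f := ENat.toNat)).comp h


/-- Ranks are awkward to express for an unordered finite set, but explicit once its points are
enumerated. Enumerations form a standard Borel space mapping measurably onto the finite sets, and
the target is countably separated, so measurability descends from enumerations to finite sets. -/
theorem measurable_graph (B : ℕ ≃ (Fin d → ℤ)) : Measurable (graph B) := by
  have h0 : StandardBorelSpace (Pt d) := inferInstance
  have : StandardBorelSpace (ℕ → Pt d) :=
    StandardBorelSpace.pi_countable (α := fun _ : ℕ => Pt d)
  refine (measurable_initialFinset.measurable_comp_iff_of_surjective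
    surjective_initialFinset).1 ?_
  refine measurable_to_finset_of_hit fun A hA => ?_
  have hz : ∀ k, Measurable fun z : ℕ × (ℕ → Pt d) => z.2 k := fun k =>
    (measurable_pi_apply k).comp measurable_snd
  -- Splitting according to the value m of the label makes the mark that is read a fixed coordinate.
  have : {z : ℕ × (ℕ → Pt d) | ∃ e ∈ (graph B ∘ initialFinset) z, e ∈ A} =
      ⋃ i, ⋃ j, ⋃ m : ℕ × ℕ, {z | i < z.1 ∧ j < z.1 ∧ (z.2 i).2.1 < (z.2 j).2.1 ∧
        (rank (initialFinset z : Set (Pt d)) (z.2 i), B.symm (cell (z.2 i).1)) = m ∧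
        (((z.2 i).1, (z.2 j).1), (z.2 j).2.2 m) ∈ edgeSet A} := by
    ext z
    simp only [Function.comp_apply, Set.mem_ofPred_eq, graph_hit_iff, Set.mem_iUnion,
      mem_initialFinset]
    constructor
    · rintro ⟨_, ⟨i, hi, rfl⟩, _, ⟨j, hj, rfl⟩, hlt, h⟩
      exact ⟨i, j, _, hi, hj, hlt, rfl, h⟩
    · rintro ⟨i, j, _, hi, hj, hlt, rfl, h⟩
      exact ⟨_, ⟨i, hi, rfl⟩, _, ⟨j, hj, rfl⟩, hlt, h⟩
  rw [this]
  refine MeasurableSet.iUnion fun i => MeasurableSet.iUnion fun j =>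
    MeasurableSet.iUnion fun m => ?_
  have h2 : MeasurableSet {z : ℕ × (ℕ → Pt d) | (z.2 i).2.1 < (z.2 j).2.1} :=
    measurableSet_lt (hz i).snd.fst (hz j).snd.fst
  refine (measurableSet_lt measurable_const measurable_fst).inter
    ((measurableSet_lt measurable_const measurable_fst).inter
    (h2.inter (MeasurableSet.inter ?_ ?_)))
  · exact ((measurable_rank_initialFinset i).prodMk
      ((Measurable.of_discrete (f := B.symm)).comp (measurable_cell.comp (hz i).fst)))
      (measurableSet_singleton m)
  · exact (((hz i).fst.prodMk (hz j).fst).prodMk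
      ((measurable_pi_apply m).comp (hz j).snd.snd)) (measurableSet_edgeSet hA)

theorem mem_removeVertex {G : Finset (MarkedEdge d)} {x : Fin d → ℝ} {e : MarkedEdge d} :
    e ∈ removeVertex G x ↔ e ∈ G ∧ x ∉ e.1.1 := by
  simp [removeVertex]

theorem measurable_removeVertex :
    Measurable fun p : Finset (MarkedEdge d) × (Fin d → ℝ) => removeVertex p.1 p.2 := by
  obtain ⟨𝒰, hc, hm, hsep⟩ := exists_countable_separating_sym2 (α := Fin d → ℝ)
  refine measurable_to_finset_of_hit fun A hA => ?_
  have : {p : Finset (MarkedEdge d) × (Fin d → ℝ) | ∃ e ∈ removeVertex p.1 p.2, e ∈ A} =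
      ⋃ U ∈ 𝒰, {p | (∃ e ∈ p.1, e ∈ A ∩ {e | ∀ y ∈ e.1.1, y ∉ U}) ∧ p.2 ∈ U} := by
    ext p
    simp only [mem_removeVertex, Set.mem_ofPred_eq, Set.mem_iUnion, Set.mem_inter_iff, exists_prop]
    constructor
    · rintro ⟨e, ⟨he, hx⟩, hA⟩
      obtain ⟨U, hU, hxU, hU'⟩ := hsep p.2 e.1.1 hx
      exact ⟨U, hU, ⟨e, he, hA, hU'⟩, hxU⟩
    · rintro ⟨U, hU, ⟨e, he, hA, hU'⟩, hxU⟩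
      exact ⟨e, ⟨he, fun hx => hU' _ hx hxU⟩, hA⟩
  rw [this]
  refine MeasurableSet.biUnion hc fun U hU => ?_
  have h1 : MeasurableSet {e : MarkedEdge d | ∀ y ∈ e.1.1, y ∉ U} :=
    (measurable_subtype_coe.comp measurable_fst) (measurableSet_sym2_avoid (hm U hU))
  exact (measurable_fst (measurableSet_hit (hA.inter h1))).inter (measurable_snd (hm U hU))

end GraphMeasurability

/-! ### The edge marks of a fixed skeleton are independent and uniform -/

section Relabelling

variable {d m : ℕ}

/-- The rank, among the points with index in `S`, of the point with index `i`. -/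
def skelRank (y : Fin m → Fin d → ℝ) (s : Fin m → I) (S : Finset (Fin m)) (i : Fin m) : ℕ :=
  (S.filter fun j => cell (y j) = cell (y i) ∧ s j < s i).card

open Classical in
/-- The points with index in `S`. -/
def skelPts (y : Fin m → Fin d → ℝ) (s : Fin m → I) (v : Fin m → Marks) (S : Finset (Fin m)) :
    Finset (Pt d) :=
  S.image fun j => (y j, s j, v j)

open Classical in
/-- The complete graph on the locations with index in `S`, the edge between the points with
indices `i < j` being marked with `w (i, j)`. -/
def edgeGraph (y : Fin m → Fin d → ℝ) (S : Finset (Fin m)) (w : Fin m × Fin m → I) :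
    Finset (MarkedEdge d) :=
  ((S ×ˢ S).filter fun p => p.1 < p.2).biUnion fun p =>
    if h : ¬ (s(y p.1, y p.2) : Sym2 (Fin d → ℝ)).IsDiag then {(⟨s(y p.1, y p.2), h⟩, w p)} else ∅

theorem mem_skelPts {y : Fin m → Fin d → ℝ} {s : Fin m → I} {v : Fin m → Marks}
    {S : Finset (Fin m)} {p : Pt d} :
    p ∈ skelPts y s v S ↔ ∃ j ∈ S, (y j, s j, v j) = p := by
  simp [skelPts]

theorem mem_edgeGraph {y : Fin m → Fin d → ℝ} {S : Finset (Fin m)} {w : Fin m × Fin m → I}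
    {e : MarkedEdge d} : e ∈ edgeGraph y S w ↔
      ∃ i ∈ S, ∃ j ∈ S, i < j ∧ e.1.1 = s(y i, y j) ∧ e.2 = w (i, j) := by
  simp only [edgeGraph, Finset.mem_biUnion, Finset.mem_filter, Finset.mem_product, Prod.exists]
  constructor
  · rintro ⟨i, j, ⟨⟨hi, hj⟩, hij⟩, he⟩
    split_ifs at he with h
    · simp at he
    · rw [Finset.mem_singleton] at he
      subst he
      exact ⟨i, hi, j, hj, hij, rfl, rfl⟩
  · rintro ⟨i, hi, j, hj, hij, h1, h2⟩
    refine ⟨i, j, ⟨⟨hi, hj⟩, hij⟩, ?_⟩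
    obtain ⟨⟨e, he⟩, u⟩ := e
    simp only at h1 h2
    subst h1 h2
    rw [dif_pos he, Finset.mem_singleton]

theorem measurable_edgeGraph (y : Fin m → Fin d → ℝ) (S : Finset (Fin m)) :
    Measurable (edgeGraph y S) := by
  refine measurable_to_finset_of_hit fun A hA => ?_
  have : {w : Fin m × Fin m → I | ∃ e ∈ edgeGraph y S w, e ∈ A} =
      ⋃ i ∈ S, ⋃ j ∈ S, {w | i < j ∧ ((y i, y j), w (i, j)) ∈ edgeSet A} := by
    ext w
    simp only [Set.mem_ofPred_eq, Set.mem_iUnion, mem_edgeGraph, exists_prop]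
    constructor
    · rintro ⟨⟨⟨e, he⟩, u⟩, ⟨i, hi, j, hj, hij, h1, h2⟩, hA⟩
      simp only at h1 h2
      subst h1 h2
      exact ⟨i, hi, j, hj, hij, he, hA⟩
    · rintro ⟨i, hi, j, hj, hij, he, hA⟩
      exact ⟨_, ⟨i, hi, j, hj, hij, rfl, rfl⟩, hA⟩
  rw [this]
  refine Finset.measurableSet_biUnion _ fun i _ => Finset.measurableSet_biUnion _ fun j _ => ?_
  have h1 : Measurable fun w : Fin m × Fin m → I => ((y i, y j), w (i, j)) :=
    measurable_const.prodMk (measurable_pi_apply _)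
  exact (MeasurableSet.const _).inter (h1 (measurableSet_edgeSet hA))

theorem rank_skelPts {y : Fin m → Fin d → ℝ} {s : Fin m → I} (hs : Function.Injective s)
    (v : Fin m → Marks) (S : Finset (Fin m)) (i : Fin m) :
    rank (skelPts y s v S : Set (Pt d)) (y i, s i, v i) = skelRank y s S i := by
  classical
  have : {q | q ∈ (skelPts y s v S : Set (Pt d)) ∧ cell q.1 = cell (y i) ∧ q.2.1 < s i} =
      (((S.filter fun j => cell (y j) = cell (y i) ∧ s j < s i).image
        fun j => ((y j, s j, v j) : Pt d) : Finset (Pt d)) : Set (Pt d)) := by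
    ext q
    simp only [Finset.mem_coe, mem_skelPts, Set.mem_ofPred_eq, Finset.mem_image, Finset.mem_filter]
    constructor
    · rintro ⟨⟨j, hj, rfl⟩, h1, h2⟩
      exact ⟨j, ⟨hj, h1, h2⟩, rfl⟩
    · rintro ⟨j, ⟨hj, h1, h2⟩, rfl⟩
      exact ⟨⟨j, hj, rfl⟩, h1, h2⟩
  rw [rank]
  simp only
  rw [this, Set.ncard_coe_finset, Finset.card_image_of_injective, skelRank]
  intro j k hjk
  exact hs (congrArg (fun p : Pt d => p.2.1) hjk)

/-- The marks enter only through a reindexing. A pair of skeleton indices is sent to the younger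
point together with the label, that is the rank and the cell, of the older one. The order of indices
in `edgeGraph` has nothing to do with the order of birth, whence the minimum and the maximum. -/
theorem graph_skelPts_eq (B : ℕ ≃ (Fin d → ℤ)) {y : Fin m → Fin d → ℝ} {s : Fin m → I}
    (hs : Function.Injective s) {S : Finset (Fin m)}
    {idx : Fin m × Fin m → Fin m × (ℕ × ℕ)}
    (h : ∀ i ∈ S, ∀ j ∈ S, s i < s j →
      idx (min i j, max i j) = (j, (skelRank y s S i, B.symm (cell (y i))))) (v : Fin m → Marks) :
    graph B (skelPts y s v S) = edgeGraph y S fun p => v (idx p).1 (idx p).2 := by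
  ext e
  rw [mem_graph, mem_edgeGraph]
  constructor
  · rintro ⟨_, hp, _, hq, hlt, h1, h2⟩
    obtain ⟨i, hi, rfl⟩ := mem_skelPts.1 hp
    obtain ⟨j, hj, rfl⟩ := mem_skelPts.1 hq
    rw [rank_skelPts hs] at h2
    simp only at hlt h1 h2
    have hidx := h i hi j hj hlt
    have hne : i ≠ j := fun e => by subst e; exact lt_irrefl _ hlt
    rcases lt_or_gt_of_ne hne with hij | hij
    · rw [min_eq_left hij.le, max_eq_right hij.le] at hidx
      exact ⟨i, hi, j, hj, hij, h1, by rw [hidx]; exact h2⟩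
    · rw [min_eq_right hij.le, max_eq_left hij.le] at hidx
      exact ⟨j, hj, i, hi, hij, by rw [h1, Sym2.eq_swap], by rw [hidx]; exact h2⟩
  · rintro ⟨i, hi, j, hj, hij, h1, h2⟩
    rcases lt_or_gt_of_ne (hs.ne hij.ne) with hlt | hlt
    · have hidx := h i hi j hj hlt
      rw [min_eq_left hij.le, max_eq_right hij.le] at hidx
      refine ⟨_, mem_skelPts.2 ⟨i, hi, rfl⟩, _, mem_skelPts.2 ⟨j, hj, rfl⟩, hlt, h1, ?_⟩
      rw [rank_skelPts hs, h2, hidx]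
    · have hidx := h j hj i hi hlt
      rw [min_eq_right hij.le, max_eq_left hij.le] at hidx
      refine ⟨_, mem_skelPts.2 ⟨j, hj, rfl⟩, _, mem_skelPts.2 ⟨i, hi, rfl⟩, hlt, ?_, ?_⟩
      · rw [h1, Sym2.eq_swap]
      · rw [rank_skelPts hs, h2, hidx]

/-- The label determines the cell, and inside one cell the rank is strictly increasing in the birth
time. -/
theorem skelLabel_injOn (B : ℕ ≃ (Fin d → ℤ)) {y : Fin m → Fin d → ℝ} {s : Fin m → I}
    (hs : Function.Injective s) (S : Finset (Fin m)) {i k : Fin m} (hi : i ∈ S) (hk : k ∈ S)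
    (h1 : skelRank y s S i = skelRank y s S k) (h2 : B.symm (cell (y i)) = B.symm (cell (y k))) :
    i = k := by
  have hc : cell (y i) = cell (y k) := B.symm.injective h2
  have key : ∀ i ∈ S, ∀ k ∈ S, cell (y i) = cell (y k) → s i < s k →
      skelRank y s S i < skelRank y s S k := by
    intro i hi k hk hc hlt
    refine Finset.card_lt_card ⟨?_, ?_⟩
    · intro j hj
      rw [Finset.mem_filter] at hj ⊢
      exact ⟨hj.1, hj.2.1.trans hc, hj.2.2.trans hlt⟩
    · intro hsub
      have : i ∈ S.filter fun j => cell (y j) = cell (y i) ∧ s j < s i :=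
        hsub (Finset.mem_filter.2 ⟨hi, hc, hlt⟩)
      exact lt_irrefl _ (Finset.mem_filter.1 this).2.2
  by_contra hne
  rcases lt_or_gt_of_ne (hs.ne hne) with hlt | hlt
  · exact (key i hi k hk hc hlt).ne h1
  · exact (key k hk i hi hc.symm hlt).ne h1.symm

/-- Two subsets of a skeleton whose edge marking mappings use compatible labels. -/
structure Compatible (y : Fin m → Fin d → ℝ) (s : Fin m → I) (S₁ S₂ : Finset (Fin m)) : Prop where
  rank_eq : ∀ i ∈ S₁, i ∈ S₂ → skelRank y s S₁ i = skelRank y s S₂ i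
  older : ∀ q ∈ S₁, q ∈ S₂ → (∀ i ∈ S₁, s i < s q → i ∈ S₂) ∨ (∀ i ∈ S₂, s i < s q → i ∈ S₁)

/-- One injective reindexing serves both graphs, so that their edge marks are jointly independent
and an edge common to both has a single mark. The field `rank_eq` makes the label of a common point
unambiguous. The field `older` excludes that a common younger point reads the same mark for two
different older points, one from each set. -/
theorem exists_index (B : ℕ ≃ (Fin d → ℤ)) {y : Fin m → Fin d → ℝ} {s : Fin m → I}
    (hs : Function.Injective s) {S₁ S₂ : Finset (Fin m)} (hc : Compatible y s S₁ S₂) :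
    ∃ idx : Fin m × Fin m → Fin m × (ℕ × ℕ), Function.Injective idx ∧
      ∀ v : Fin m → Marks,
        graph B (skelPts y s v S₁) = edgeGraph y S₁ (fun p => v (idx p).1 (idx p).2) ∧
        graph B (skelPts y s v S₂) = edgeGraph y S₂ (fun p => v (idx p).1 (idx p).2) := by
  classical
  let lab : Fin m → ℕ × ℕ := fun i =>
    (if i ∈ S₁ then skelRank y s S₁ i else skelRank y s S₂ i, B.symm (cell (y i)))
  let ok : Fin m × Fin m → Prop := fun p =>
    p.1 < p.2 ∧ ((p.1 ∈ S₁ ∧ p.2 ∈ S₁) ∨ (p.1 ∈ S₂ ∧ p.2 ∈ S₂))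
  -- Pairs that are edges of neither graph get a dummy label. Its first entry exceeds m, hence every
  -- rank, so it never collides with a genuine label and `idx` is injective on all pairs.
  let idx : Fin m × Fin m → Fin m × (ℕ × ℕ) := fun p =>
    if ok p then (if s p.1 < s p.2 then (p.2, lab p.1) else (p.1, lab p.2))
    else (p.1, (m + 1 + p.2, 0))
  have lab1 : ∀ i ∈ S₁, lab i = (skelRank y s S₁ i, B.symm (cell (y i))) := fun i hi => by
    simp [lab, hi]
  have lab2 : ∀ i ∈ S₂, lab i = (skelRank y s S₂ i, B.symm (cell (y i))) := fun i hi => by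
    by_cases h : i ∈ S₁
    · rw [lab1 i h, hc.rank_eq i h hi]
    · simp [lab, h]
  have inj1 : ∀ i ∈ S₁, ∀ k ∈ S₁, lab i = lab k → i = k := fun i hi k hk h => by
    rw [lab1 i hi, lab1 k hk, Prod.mk.injEq] at h
    exact skelLabel_injOn B hs S₁ hi hk h.1 h.2
  have inj2 : ∀ i ∈ S₂, ∀ k ∈ S₂, lab i = lab k → i = k := fun i hi k hk h => by
    rw [lab2 i hi, lab2 k hk, Prod.mk.injEq] at h
    exact skelLabel_injOn B hs S₂ hi hk h.1 h.2
  have hrank : ∀ (S : Finset (Fin m)) i, skelRank y s S i ≤ m := fun S i =>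
    (Finset.card_le_univ _).trans (by simp)
  have hlab : ∀ i, (lab i).1 ≤ m := fun i => by
    simp only [lab]; split_ifs <;> exact hrank _ _
  -- a good index determines the younger point and the label of the older point
  have hok : ∀ p, ok p → ∃ q o, idx p = (q, lab o) ∧ s o < s q ∧
      ((q ∈ S₁ ∧ o ∈ S₁) ∨ (q ∈ S₂ ∧ o ∈ S₂)) ∧ p = (min q o, max q o) := by
    rintro ⟨i, j⟩ h
    have hij : i < j := h.1
    by_cases hlt : s i < s j
    · refine ⟨j, i, ?_, hlt, h.2.imp And.symm And.symm, ?_⟩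
      · simp only [idx]; rw [if_pos h, if_pos hlt]
      · rw [min_eq_right hij.le, max_eq_left hij.le]
    · refine ⟨i, j, ?_, lt_of_le_of_ne (not_lt.1 hlt) (hs.ne hij.ne'), h.2, ?_⟩
      · simp only [idx]; rw [if_pos h, if_neg hlt]
      · rw [min_eq_left hij.le, max_eq_right hij.le]
  have hnok : ∀ p, ¬ ok p → idx p = (p.1, (m + 1 + p.2, 0)) := fun p h => by
    simp only [idx]; rw [if_neg h]
  refine ⟨idx, ?_, fun v => ⟨graph_skelPts_eq B hs ?_ v, graph_skelPts_eq B hs ?_ v⟩⟩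
  · intro p p' hpp
    by_cases h : ok p <;> by_cases h' : ok p'
    · obtain ⟨q, o, h1, h2, h3, h4⟩ := hok p h
      obtain ⟨q', o', h1', h2', h3', h4'⟩ := hok p' h'
      rw [h1, h1', Prod.mk.injEq] at hpp
      obtain ⟨rfl, hl⟩ := hpp
      -- If the two edges come from different sets, the nesting of the points older than q places o
      -- and o' in a common set, where labels are injective.
      have : o = o' := by
        rcases h3 with ⟨hq, ho⟩ | ⟨hq, ho⟩ <;> rcases h3' with ⟨hq', ho'⟩ | ⟨hq', ho'⟩
        · exact inj1 _ ho _ ho' hl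
        · rcases hc.older q hq hq' with hh | hh
          · exact inj2 _ (hh o ho h2) _ ho' hl
          · exact inj1 _ ho _ (hh o' ho' h2') hl
        · rcases hc.older q hq' hq with hh | hh
          · exact inj2 _ ho _ (hh o' ho' h2') hl
          · exact inj1 _ (hh o ho h2) _ ho' hl
        · exact inj2 _ ho _ ho' hl
      rw [h4, h4', this]
    · obtain ⟨q, o, h1, -⟩ := hok p h
      rw [h1, hnok p' h', Prod.mk.injEq] at hpp
      have := hlab o
      rw [hpp.2] at this
      simp only at this
      omega
    · obtain ⟨q, o, h1, -⟩ := hok p' h'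
      rw [h1, hnok p h, Prod.mk.injEq] at hpp
      have := hlab o
      rw [← hpp.2] at this
      simp only at this
      omega
    · rw [hnok p h, hnok p' h', Prod.mk.injEq, Prod.mk.injEq] at hpp
      exact Prod.ext hpp.1 (Fin.ext (by omega))
  · intro i hi j hj hlt
    rw [← lab1 i hi]
    have hne : i ≠ j := fun e => by subst e; exact lt_irrefl _ hlt
    rcases lt_or_gt_of_ne hne with hij | hij
    · rw [min_eq_left hij.le, max_eq_right hij.le]
      simp only [idx]
      rw [if_pos ⟨hij, Or.inl ⟨hi, hj⟩⟩, if_pos hlt]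
    · rw [min_eq_right hij.le, max_eq_left hij.le]
      simp only [idx]
      rw [if_pos ⟨hij, Or.inl ⟨hj, hi⟩⟩, if_neg (not_lt.2 hlt.le)]
  · intro i hi j hj hlt
    rw [← lab2 i hi]
    have hne : i ≠ j := fun e => by subst e; exact lt_irrefl _ hlt
    rcases lt_or_gt_of_ne hne with hij | hij
    · rw [min_eq_left hij.le, max_eq_right hij.le]
      simp only [idx]
      rw [if_pos ⟨hij, Or.inr ⟨hi, hj⟩⟩, if_pos hlt]
    · rw [min_eq_right hij.le, max_eq_left hij.le]
      simp only [idx]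
      rw [if_pos ⟨hij, Or.inr ⟨hj, hi⟩⟩, if_neg (not_lt.2 hlt.le)]

instance : IsProbabilityMeasure marksMeasure := by unfold marksMeasure; infer_instance

/-- Distinct marks of finitely many independent mark sequences are independent and uniform. -/
theorem map_marks_index {K : Type*} [Fintype K] {idx : K → Fin m × (ℕ × ℕ)}
    (hidx : Function.Injective idx) :
    (Measure.pi fun _ : Fin m => marksMeasure).map
      (fun v => fun p => v (idx p).1 (idx p).2) = Measure.pi fun _ : K => (volume : Measure I) := by
  classical
  refine (Measure.pi_eq fun t ht => ?_).symm
  have hm : Measurable fun (v : Fin m → Marks) (p : K) => v (idx p).1 (idx p).2 :=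
    measurable_pi_lambda _ fun p => (measurable_pi_apply (idx p).2).comp (measurable_pi_apply _)
  rw [Measure.map_apply hm (MeasurableSet.univ_pi ht)]
  -- `T j k` collects the constraints on the mark k of point j. By injectivity of `idx` there is at
  -- most one, and `T j k` is everything if that mark is not read.
  let T : Fin m → ℕ × ℕ → Set I := fun j k => {u | ∀ p, idx p = (j, k) → u ∈ t p}
  let F : Finset (ℕ × ℕ) := Finset.univ.image fun p => (idx p).2
  have hT : ∀ j k, MeasurableSet (T j k) := fun j k => by
    have : T j k = ⋂ p, ⋂ _ : idx p = (j, k), t p := by ext u; simp [T]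
    rw [this]
    exact MeasurableSet.iInter fun p => MeasurableSet.iInter fun _ => ht p
  have hpre : (fun (v : Fin m → Marks) (p : K) => v (idx p).1 (idx p).2) ⁻¹' (Set.univ.pi t) =
      Set.univ.pi fun j => (F : Set (ℕ × ℕ)).pi (T j) := by
    ext v
    simp only [Set.mem_preimage, Set.mem_pi, Set.mem_univ, forall_const, Finset.mem_coe]
    constructor
    · intro h j k _ p hp
      have := h p
      rw [hp] at this
      exact this
    · intro h p
      exact h (idx p).1 (idx p).2 (Finset.mem_image_of_mem _ (Finset.mem_univ p)) p rfl
  rw [hpre, Measure.pi_pi]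
  have h1 : ∀ j, marksMeasure ((F : Set (ℕ × ℕ)).pi (T j)) = ∏ k ∈ F, volume (T j k) :=
    fun j => Measure.infinitePi_pi _ fun k _ => hT j k
  simp_rw [h1]
  have h2 : ∀ a : Fin m × (ℕ × ℕ), a ∉ Finset.univ.image idx → volume (T a.1 a.2) = 1 := by
    intro a ha
    have : T a.1 a.2 = Set.univ := Set.eq_univ_of_forall fun u p hp =>
      absurd (Finset.mem_image.2 ⟨p, Finset.mem_univ _, hp⟩) ha
    rw [this, measure_univ]
  have h3 : ∀ p, volume (T (idx p).1 (idx p).2) = volume (t p) := by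
    intro p
    congr 1
    ext u
    exact ⟨fun h => h p rfl, fun h p' hp' => by rw [hidx hp']; exact h⟩
  calc ∏ j, ∏ k ∈ F, volume (T j k)
      = ∏ a ∈ (Finset.univ : Finset (Fin m)) ×ˢ F, volume (T a.1 a.2) :=
        (Finset.prod_product _ _ fun a : Fin m × (ℕ × ℕ) => volume (T a.1 a.2)).symm
    _ = ∏ a ∈ Finset.univ.image idx, volume (T a.1 a.2) := by
        refine (Finset.prod_subset ?_ fun a _ ha => h2 a ha).symm
        intro a ha
        obtain ⟨p, -, rfl⟩ := Finset.mem_image.1 ha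
        exact Finset.mem_product.2 ⟨Finset.mem_univ _,
          Finset.mem_image_of_mem _ (Finset.mem_univ p)⟩
    _ = ∏ p, volume (T (idx p).1 (idx p).2) := Finset.prod_image fun _ _ _ _ h => hidx h
    _ = ∏ p, volume (t p) := Finset.prod_congr rfl fun p _ => h3 p

/-- The law of two graphs on a fixed skeleton does not depend on the birth times. -/
theorem lintegral_graph_skelPts (B : ℕ ≃ (Fin d → ℤ)) {y : Fin m → Fin d → ℝ} {s : Fin m → I}
    (hs : Function.Injective s) {S₁ S₂ : Finset (Fin m)} (hc : Compatible y s S₁ S₂)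
    {Φ : Finset (MarkedEdge d) × Finset (MarkedEdge d) → ℝ≥0∞} (hΦ : Measurable Φ) :
    ∫⁻ v, Φ (graph B (skelPts y s v S₁), graph B (skelPts y s v S₂))
      ∂(Measure.pi fun _ => marksMeasure) =
    ∫⁻ w, Φ (edgeGraph y S₁ w, edgeGraph y S₂ w)
      ∂(Measure.pi fun _ : Fin m × Fin m => (volume : Measure I)) := by
  obtain ⟨idx, hinj, hidx⟩ := exists_index B hs hc
  have hm : Measurable fun (v : Fin m → Marks) (p : Fin m × Fin m) => v (idx p).1 (idx p).2 :=
    measurable_pi_lambda _ fun p => (measurable_pi_apply (idx p).2).comp (measurable_pi_apply _)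
  rw [← map_marks_index hinj, lintegral_map _ hm]
  · refine lintegral_congr fun v => ?_
    rw [(hidx v).1, (hidx v).2]
  · exact hΦ.comp ((measurable_edgeGraph y S₁).prodMk (measurable_edgeGraph y S₂))

end Relabelling

/-! ### Distributional identities for the graph of a Poisson process with an added point -/

section Identities

variable {d : ℕ}

/-- The intensity measure of the marked Poisson process with locations in `W`. -/
def windowIntensity (lam : ℝ) (W : Set (Fin d → ℝ)) : Measure (Pt d) :=
  ((ENNReal.ofReal lam • (volume : Measure (Fin d → ℝ))).restrict W).prod
    ((volume : Measure I).prod marksMeasure)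

theorem windowIntensity_eq_restrict (lam : ℝ) (W : Set (Fin d → ℝ)) :
    windowIntensity lam W = (intensity d lam).restrict {p | p.1 ∈ W} := by
  have : {p : Pt d | p.1 ∈ W} = W ×ˢ Set.univ := by ext; simp
  rw [windowIntensity, intensity, this, ← Measure.prod_restrict, Measure.restrict_univ]

theorem isFiniteMeasure_windowIntensity {lam : ℝ} {W : Set (Fin d → ℝ)} (hW : volume W ≠ ∞) :
    IsFiniteMeasure (windowIntensity lam W) := by
  have : IsFiniteMeasure ((ENNReal.ofReal lam • (volume : Measure (Fin d → ℝ))).restrict W) :=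
    ⟨by simpa using ENNReal.mul_lt_top ENNReal.ofReal_lt_top hW.lt_top⟩
  unfold windowIntensity
  infer_instance

/-- A location with a birth time and a flag. -/
abbrev Skel (d : ℕ) : Type := ((Fin d → ℝ) × I) × Bool

/-- The intensity measure of flagged locations with birth times. -/
def skelMeasure (lam : ℝ) (W : Set (Fin d → ℝ)) : Measure (Skel d) :=
  (((ENNReal.ofReal lam • (volume : Measure (Fin d → ℝ))).restrict W).prod
    (volume : Measure I)).prod Measure.count

theorem isFiniteMeasure_skelMeasure {lam : ℝ} {W : Set (Fin d → ℝ)} (hW : volume W ≠ ∞) :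
    IsFiniteMeasure (skelMeasure lam W) := by
  have : IsFiniteMeasure ((ENNReal.ofReal lam • (volume : Measure (Fin d → ℝ))).restrict W) :=
    ⟨by simpa using ENNReal.mul_lt_top ENNReal.ofReal_lt_top hW.lt_top⟩
  unfold skelMeasure
  infer_instance

/-- The point with a given skeleton and mark. -/
def skelPoint (z : Skel d × Marks) : Pt d := (z.1.1.1, z.1.1.2, z.2)

theorem measurable_skelPoint : Measurable (skelPoint (d := d)) :=
  measurable_fst.fst.fst.prodMk (measurable_fst.fst.snd.prodMk measurable_snd)

/-- Each flag has mass one under the counting measure, so each flag class carries a full copy of the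
intensity. This is the hypothesis under which the two flag classes of a mixed sample are independent
Poisson processes. -/
theorem skelMeasure_prod_apply {lam : ℝ} {W : Set (Fin d → ℝ)} (hW : volume W ≠ ∞) (c : Bool)
    {A : Set (Pt d)} (hA : MeasurableSet A) :
    ((skelMeasure lam W).prod marksMeasure) {z | z.1.2 = c ∧ skelPoint z ∈ A} =
      windowIntensity lam W A := by
  have := isFiniteMeasure_skelMeasure (lam := lam) hW
  have h0 : IsFiniteMeasure ((ENNReal.ofReal lam • (volume : Measure (Fin d → ℝ))).restrict W) :=
    ⟨by simpa using ENNReal.mul_lt_top ENNReal.ofReal_lt_top hW.lt_top⟩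
  have hS : MeasurableSet {z : Skel d × Marks | z.1.2 = c ∧ skelPoint z ∈ A} :=
    (measurable_fst.snd (measurableSet_singleton c)).inter (measurable_skelPoint hA)
  have hA' : MeasurableSet {q : ((Fin d → ℝ) × I) × Marks | ((q.1.1, q.1.2, q.2) : Pt d) ∈ A} := by
    have : Measurable fun q : ((Fin d → ℝ) × I) × Marks => ((q.1.1, q.1.2, q.2) : Pt d) :=
      measurable_fst.fst.prodMk (measurable_fst.snd.prodMk measurable_snd)
    exact this hA
  have e := (measurePreserving_prodAssoc
    ((ENNReal.ofReal lam • (volume : Measure (Fin d → ℝ))).restrict W) (volume : Measure I)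
    marksMeasure).measure_preimage hA.nullMeasurableSet
  rw [windowIntensity, ← e]
  change _ = ((((ENNReal.ofReal lam • (volume : Measure (Fin d → ℝ))).restrict W).prod
    (volume : Measure I)).prod marksMeasure)
      {q : ((Fin d → ℝ) × I) × Marks | ((q.1.1, q.1.2, q.2) : Pt d) ∈ A}
  rw [Measure.prod_apply hA', Measure.prod_apply hS, skelMeasure, lintegral_prod _
    (measurable_measure_prodMk_left hS).aemeasurable]
  refine lintegral_congr fun k => ?_
  rw [lintegral_count, tsum_fintype, Finset.sum_eq_single c]
  · congr 1
    ext M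
    simp [skelPoint]
  · intro c' _ hc'
    convert measure_empty (μ := marksMeasure)
    ext M
    simp [hc']
  · simp

theorem skelMeasure_time (lam : ℝ) {W : Set (Fin d → ℝ)} (hW : volume W ≠ ∞) (t : I) :
    ∀ᵐ k ∂(skelMeasure lam W), k.1.2 ≠ t := by
  have h0 : IsFiniteMeasure ((ENNReal.ofReal lam • (volume : Measure (Fin d → ℝ))).restrict W) :=
    ⟨by simpa using ENNReal.mul_lt_top ENNReal.ofReal_lt_top hW.lt_top⟩
  rw [ae_iff]
  have : {k : Skel d | ¬ k.1.2 ≠ t} = (Set.univ ×ˢ {t}) ×ˢ Set.univ := by ext; simp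
  rw [this, skelMeasure, Measure.prod_prod, Measure.prod_prod]
  simp

theorem skelMeasure_location (lam : ℝ) {W : Set (Fin d → ℝ)} (hWm : MeasurableSet W)
    (hW : volume W ≠ ∞) : ∀ᵐ k ∂(skelMeasure lam W), k.1.1 ∈ W := by
  have h0 : IsFiniteMeasure ((ENNReal.ofReal lam • (volume : Measure (Fin d → ℝ))).restrict W) :=
    ⟨by simpa using ENNReal.mul_lt_top ENNReal.ofReal_lt_top hW.lt_top⟩
  rw [ae_iff]
  have : {k : Skel d | ¬ k.1.1 ∈ W} = (Wᶜ ×ˢ Set.univ) ×ˢ Set.univ := by ext; simp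
  rw [this, skelMeasure, Measure.prod_prod, Measure.prod_prod, Measure.restrict_apply hWm.compl]
  simp

theorem skelMeasure_location_ne [Nonempty (Fin d)] (lam : ℝ) {W : Set (Fin d → ℝ)}
    (hW : volume W ≠ ∞) (x : Fin d → ℝ) :
    ∀ᵐ k ∂(skelMeasure lam W), k.1.1 ≠ x := by
  have h0 : IsFiniteMeasure ((ENNReal.ofReal lam • (volume : Measure (Fin d → ℝ))).restrict W) :=
    ⟨by simpa using ENNReal.mul_lt_top ENNReal.ofReal_lt_top hW.lt_top⟩
  rw [ae_iff]
  have : {k : Skel d | ¬ k.1.1 ≠ x} = ({x} ×ˢ Set.univ) ×ˢ Set.univ := by ext; simp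
  have h1 : ((ENNReal.ofReal lam • (volume : Measure (Fin d → ℝ))).restrict W) {x} = 0 := by
    refine le_antisymm ((Measure.restrict_apply_le _ _).trans ?_) bot_le
    simp
  rw [this, skelMeasure, Measure.prod_prod, Measure.prod_prod, h1]
  simp

theorem ae_pi_forall {S : Type*} [MeasurableSpace S] {κ : Measure S} [IsFiniteMeasure κ]
    {p : S → Prop} (h : ∀ᵐ k ∂κ, p k) (n : ℕ) :
    ∀ᵐ k ∂(Measure.pi fun _ : Fin n => κ), ∀ i, p (k i) :=
  ae_all_iff.2 fun i => (Measure.tendsto_eval_ae_ae (μ := fun _ : Fin n => κ) (i := i)).eventually h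

/-- By Fubini: once the other coordinates are frozen, coordinate i must avoid a single value.
Applied to birth times, this makes the ranks of a skeleton unambiguous. -/
theorem ae_pi_pairwise_ne {S T : Type*} [MeasurableSpace S] [MeasurableSpace T] [MeasurableEq T]
    {κ : Measure S} [IsFiniteMeasure κ] {τ : S → T} (hτ : Measurable τ)
    (h : ∀ t, ∀ᵐ k ∂κ, τ k ≠ t) (n : ℕ) :
    ∀ᵐ k ∂(Measure.pi fun _ : Fin n => κ), ∀ i j, i ≠ j → τ (k i) ≠ τ (k j) := by
  refine ae_all_iff.2 fun i => ae_all_iff.2 fun j => ?_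
  by_cases hij : i = j
  · exact Eventually.of_forall fun _ h => absurd hij h
  cases n with
  | zero => exact i.elim0
  | succ n =>
    obtain ⟨j', rfl⟩ := Fin.exists_succAbove_eq (Ne.symm hij)
    have e := measurePreserving_piFinSuccAbove (fun _ : Fin (n + 1) => κ) i
    have hm : MeasurableSet {q : S × (Fin n → S) | τ q.1 = τ (q.2 j')} :=
      measurableSet_eq_fun (hτ.comp measurable_fst)
        (hτ.comp ((measurable_pi_apply j').comp measurable_snd))
    have h0 : (κ.prod (Measure.pi fun _ : Fin n => κ)) {q | τ q.1 = τ (q.2 j')} = 0 := by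
      rw [Measure.prod_apply_symm hm, lintegral_eq_zero_iff]
      · refine Eventually.of_forall fun r => ?_
        have := h (τ (r j'))
        rw [ae_iff] at this
        simpa using this
      · exact measurable_measure_prodMk_right hm
    have h1 := e.measure_preimage hm.nullMeasurableSet
    rw [h0] at h1
    have h2 : ∀ᵐ k ∂(Measure.pi fun _ : Fin (n + 1) => κ),
        k ∉ (MeasurableEquiv.piFinSuccAbove (fun _ => S) i) ⁻¹' {q | τ q.1 = τ (q.2 j')} :=
      measure_eq_zero_iff_ae_notMem.1 h1
    filter_upwards [h2] with k hk _ heq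
    exact hk heq

/-- The set of indices of a skeleton satisfying `p`, shifted by one. -/
def idxSet {n : ℕ} (p : Skel d → Prop) (k : Fin n → Skel d) : Finset (Fin (n + 1)) :=
  open Classical in (Finset.univ.filter fun i => p (k i)).image Fin.succ

/-- The set of indices, with the index `0` of the added point included or not. -/
def withRoot {n : ℕ} (a : Bool) (S : Finset (Fin (n + 1))) : Finset (Fin (n + 1)) :=
  bif a then insert 0 S else S

theorem mem_idxSet {n : ℕ} {p : Skel d → Prop} {k : Fin n → Skel d} {j : Fin (n + 1)} :
    j ∈ idxSet p k ↔ ∃ i, p (k i) ∧ i.succ = j := by simp [idxSet]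

theorem succ_mem_idxSet {n : ℕ} {p : Skel d → Prop} {k : Fin n → Skel d} {i : Fin n} :
    i.succ ∈ idxSet p k ↔ p (k i) := by simp [mem_idxSet]

theorem zero_notMem_idxSet {n : ℕ} {p : Skel d → Prop} {k : Fin n → Skel d} :
    0 ∉ idxSet p k := by simp [mem_idxSet, Fin.succ_ne_zero]

theorem zero_mem_withRoot {n : ℕ} {a : Bool} {p : Skel d → Prop} {k : Fin n → Skel d} :
    0 ∈ withRoot a (idxSet p k) ↔ a = true := by
  cases a <;> simp [withRoot, zero_notMem_idxSet]

theorem succ_mem_withRoot {n : ℕ} {a : Bool} {p : Skel d → Prop} {k : Fin n → Skel d}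
    {i : Fin n} : i.succ ∈ withRoot a (idxSet p k) ↔ p (k i) := by
  cases a <;> simp [withRoot, succ_mem_idxSet]

/-- The locations of the added point and of a skeleton. -/
def skelLoc {n : ℕ} (x : Fin d → ℝ) (k : Fin n → Skel d) : Fin (n + 1) → Fin d → ℝ :=
  Fin.cons x fun i => (k i).1.1

/-- The birth times of the added point and of a skeleton. -/
def skelTime {n : ℕ} (t : I) (k : Fin n → Skel d) : Fin (n + 1) → I :=
  Fin.cons t fun i => (k i).1.2

theorem skelTime_injective {n : ℕ} {t : I} {k : Fin n → Skel d} (h1 : ∀ i, (k i).1.2 ≠ t)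
    (h2 : ∀ i j, i ≠ j → (k i).1.2 ≠ (k j).1.2) : Function.Injective (skelTime t k) := by
  intro i j hij
  induction i using Fin.cases with
  | zero =>
    induction j using Fin.cases with
    | zero => rfl
    | succ j => exact absurd hij.symm (h1 j)
  | succ i =>
    induction j using Fin.cases with
    | zero => exact absurd hij (h1 i)
    | succ j =>
      by_contra hne
      exact h2 i j (fun e => hne (by rw [e])) hij

theorem mem_skelPts_withRoot {n : ℕ} {x : Fin d → ℝ} {t : I} {k : Fin n → Skel d}
    {v : Fin (n + 1) → Marks} {a : Bool} {p : Skel d → Prop} {q : Pt d} :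
    q ∈ skelPts (skelLoc x k) (skelTime t k) v (withRoot a (idxSet p k)) ↔
      (a = true ∧ q = (x, t, v 0)) ∨ ∃ i, p (k i) ∧ skelPoint (k i, v i.succ) = q := by
  rw [mem_skelPts]
  constructor
  · rintro ⟨j, hj, rfl⟩
    induction j using Fin.cases with
    | zero => exact Or.inl ⟨zero_mem_withRoot.1 hj, rfl⟩
    | succ i => exact Or.inr ⟨i, succ_mem_withRoot.1 hj, rfl⟩
  · rintro (⟨ha, rfl⟩ | ⟨i, hi, rfl⟩)
    · exact ⟨0, zero_mem_withRoot.2 ha, rfl⟩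
    · exact ⟨i.succ, succ_mem_withRoot.2 hi, rfl⟩

/-- The configuration of the points with flag `c` of a marked skeleton. -/
abbrev skelConfig {n : ℕ} (c : Bool) (k : Fin n → Skel d) (v : Fin (n + 1) → Marks) :
    Finset (Pt d) :=
  sampleConfig skelPoint (fun z : Skel d × Marks => z.1.2) c fun i => (k i, v i.succ)

theorem addIf_skelConfig {n : ℕ} (a : Bool) (x : Fin d → ℝ) (t : I) (k : Fin n → Skel d)
    (v : Fin (n + 1) → Marks) :
    addIf a (x, t, v 0) (skelConfig false k v) =
      skelPts (skelLoc x k) (skelTime t k) v (withRoot a (idxSet (fun z => z.2 = false) k)) := by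
  ext q
  rw [mem_skelPts_withRoot]
  cases a <;> simp [addIf, mem_sampleConfig]

/-- The skeleton points of the mixed process. -/
def mixPred (t : I) (z : Skel d) : Prop := (z.2 = false ∧ z.1.2 < t) ∨ (z.2 = true ∧ t < z.1.2)

theorem addIf_mix_skelConfig {n : ℕ} (a : Bool) (x : Fin d → ℝ) (t : I) (k : Fin n → Skel d)
    (v : Fin (n + 1) → Marks) :
    addIf a (x, t, v 0) (mix (fun p : Pt d => p.2.1) t (skelConfig false k v)
      (skelConfig true k v)) =
      skelPts (skelLoc x k) (skelTime t k) v (withRoot a (idxSet (mixPred t) k)) := by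
  have key : ∀ q : Pt d, q ∈ mix (fun p : Pt d => p.2.1) t (skelConfig false k v)
      (skelConfig true k v) ↔ ∃ i, mixPred t (k i) ∧ skelPoint (k i, v i.succ) = q := by
    intro q
    simp only [mem_mix, mem_sampleConfig, mixPred]
    constructor
    · rintro (⟨⟨i, hi, rfl⟩, ht⟩ | ⟨⟨i, hi, rfl⟩, ht⟩)
      · exact ⟨i, Or.inl ⟨hi, ht⟩, rfl⟩
      · exact ⟨i, Or.inr ⟨hi, ht⟩, rfl⟩
    · rintro ⟨i, ⟨hi, ht⟩ | ⟨hi, ht⟩, rfl⟩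
      · exact Or.inl ⟨⟨i, hi, rfl⟩, ht⟩
      · exact Or.inr ⟨⟨i, hi, rfl⟩, ht⟩
  ext q
  rw [mem_skelPts_withRoot]
  cases a <;> simp [addIf, key]

open Classical in
theorem addPt_filter_skelConfig {n : ℕ} (A : Set (Fin d → ℝ)) (x : Fin d → ℝ) (t : I)
    (k : Fin n → Skel d) (v : Fin (n + 1) → Marks) :
    addPt (x, t, v 0) ((skelConfig false k v).filter fun p => p.1 ∈ A) =
      skelPts (skelLoc x k) (skelTime t k) v
        (withRoot true (idxSet (fun z => z.2 = false ∧ z.1.1 ∈ A) k)) := by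
  ext q
  rw [mem_skelPts_withRoot]
  simp only [mem_addPt, Finset.mem_filter, mem_sampleConfig, true_and]
  refine or_congr_right ⟨?_, ?_⟩
  · rintro ⟨⟨i, hi, rfl⟩, hA⟩
    exact ⟨i, ⟨hi, hA⟩, rfl⟩
  · rintro ⟨i, ⟨hi, hA⟩, rfl⟩
    exact ⟨⟨i, hi, rfl⟩, hA⟩

/-- If both sets have the same members older than each common point, then ranks agree at once and
one inclusion of older points holds. -/
theorem compatible_of_older_iff {m : ℕ} {y : Fin m → Fin d → ℝ} {s : Fin m → I}
    {S₁ S₂ : Finset (Fin m)}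
    (h : ∀ q ∈ S₁, q ∈ S₂ → ∀ i, s i < s q → (i ∈ S₁ ↔ i ∈ S₂)) : Compatible y s S₁ S₂ where
  rank_eq q h1 h2 := by
    unfold skelRank
    congr 1
    ext i
    simp only [Finset.mem_filter]
    constructor
    · rintro ⟨a, b, c⟩; exact ⟨(h q h1 h2 i c).1 a, b, c⟩
    · rintro ⟨a, b, c⟩; exact ⟨(h q h1 h2 i c).2 a, b, c⟩
  older q h1 h2 := Or.inl fun i hi hlt => (h q h1 h2 i hlt).1 hi

/-- A point common to the process and to the mixed process is born before t or is the added point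
itself. Everything older than it is born before t, where the two processes coincide, and the added
point, born at t, is not among these older points. -/
theorem compatible_mix {n : ℕ} (a b : Bool) (x : Fin d → ℝ) (t : I) (k : Fin n → Skel d) :
    Compatible (skelLoc x k) (skelTime t k) (withRoot a (idxSet (fun z => z.2 = false) k))
      (withRoot b (idxSet (mixPred t) k)) := by
  refine compatible_of_older_iff fun q h1 h2 i hi => ?_
  have hq : skelTime t k q ≤ t := by
    induction q using Fin.cases with
    | zero => exact le_rfl
    | succ q =>
      rw [succ_mem_withRoot] at h1 h2
      rcases h2 with h2 | h2
      · exact h2.2.le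
      · rw [h1] at h2; exact Bool.noConfusion h2.1
  have hit := hi.trans_le hq
  induction i using Fin.cases with
  | zero => exact absurd hit (lt_irrefl t)
  | succ i =>
    rw [succ_mem_withRoot, succ_mem_withRoot]
    have hit' : (k i).1.2 < t := hit
    constructor
    · intro h; exact Or.inl ⟨h, hit'⟩
    · rintro (h | h)
      · exact h.1
      · exact absurd h.2 (not_lt.2 hit'.le)

/-- The smaller index set is contained in the larger one, so only ranks matter. They agree since A
contains every point of W lying in a unit cell that A meets. -/
theorem compatible_window {n : ℕ} {A W : Set (Fin d → ℝ)} {x : Fin d → ℝ} (hx : x ∈ A)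
    (hsat : ∀ p ∈ W, ∀ q ∈ A, cell p = cell q → p ∈ A) (t : I) {k : Fin n → Skel d}
    (hk : ∀ i, (k i).1.1 ∈ W) :
    Compatible (skelLoc x k) (skelTime t k)
      (withRoot true (idxSet (fun z => z.2 = false ∧ z.1.1 ∈ A) k))
      (withRoot true (idxSet (fun z => z.2 = false) k)) := by
  have hsub : ∀ i, i ∈ withRoot true (idxSet (fun z => z.2 = false ∧ z.1.1 ∈ A) k) →
      i ∈ withRoot true (idxSet (fun z => z.2 = false) k) := by
    intro i hi
    induction i using Fin.cases with
    | zero => exact zero_mem_withRoot.2 rfl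
    | succ i => exact succ_mem_withRoot.2 (succ_mem_withRoot.1 hi).1
  refine ⟨fun q hq _ => ?_, fun q _ _ => Or.inl fun i hi _ => hsub i hi⟩
  have hqA : skelLoc x k q ∈ A := by
    induction q using Fin.cases with
    | zero => exact hx
    | succ q => exact (succ_mem_withRoot.1 hq).2
  unfold skelRank
  congr 1
  ext i
  simp only [Finset.mem_filter]
  constructor
  · rintro ⟨h1, h2⟩; exact ⟨hsub i h1, h2⟩
  · rintro ⟨h1, h2, h3⟩
    refine ⟨?_, h2, h3⟩
    induction i using Fin.cases with
    | zero => exact zero_mem_withRoot.2 rfl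
    | succ i =>
      exact succ_mem_withRoot.2 ⟨succ_mem_withRoot.1 h1, hsat _ (hk i) _ hqA h2⟩

variable {lam : ℝ} {W : Set (Fin d → ℝ)} {L : Measure (Finset (Pt d))}

theorem lintegral_window_eq_tsum (hW : volume W ≠ ∞)
    (hL : IsPoissonLaw L (windowIntensity lam W))
    {Ψ : Marks × Finset (Pt d) × Finset (Pt d) → ℝ≥0∞} (hΨ : Measurable Ψ) :
    ∫⁻ p, Ψ p ∂(marksMeasure.prod (L.prod L)) =
      ∑' n, sampleWeight (2 * (windowIntensity lam W).real Set.univ) n *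
        ∫⁻ k, ∫⁻ v, Ψ (v 0, skelConfig false k v, skelConfig true k v)
          ∂(Measure.pi fun _ : Fin (n + 1) => marksMeasure)
          ∂(Measure.pi fun _ : Fin n => skelMeasure lam W) := by
  have := isFiniteMeasure_windowIntensity (lam := lam) hW
  have := isFiniteMeasure_skelMeasure (lam := lam) hW
  exact lintegral_prod_eq_tsum_sample hL (skelMeasure lam W) marksMeasure measurable_skelPoint
    measurable_snd (fun c A hA => skelMeasure_prod_apply hW c hA) hΨ

theorem measurable_addIf_root (a : Bool) (x : Fin d → ℝ) (t : I) :
    Measurable fun p : Marks × Finset (Pt d) => addIf a (x, t, p.1) p.2 :=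
  (measurable_addIf a).comp
    ((measurable_const.prodMk (measurable_const.prodMk measurable_fst)).prodMk measurable_snd)

theorem measurable_mix_time (t : I) : Measurable fun p : Finset (Pt d) × Finset (Pt d) =>
    mix (fun q : Pt d => q.2.1) t p.1 p.2 :=
  (measurable_mix measurable_snd.fst).comp (measurable_const.prodMk measurable_id)

/-- The joint law of the graphs, with an added point or not, of a Poisson process and of the
process mixed with an independent copy, in terms of independent edge marks. -/
theorem lintegral_graph_mix (B : ℕ ≃ (Fin d → ℤ)) (hW : volume W ≠ ∞)
    (hL : IsPoissonLaw L (windowIntensity lam W)) (a b : Bool) (x : Fin d → ℝ) (t : I)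
    {Φ : Finset (MarkedEdge d) × Finset (MarkedEdge d) → ℝ≥0∞} (hΦ : Measurable Φ) :
    ∫⁻ p, Φ (graph B (addIf a (x, t, p.1) p.2.1),
        graph B (addIf b (x, t, p.1) (mix (fun q : Pt d => q.2.1) t p.2.1 p.2.2)))
        ∂(marksMeasure.prod (L.prod L)) =
      ∑' n, sampleWeight (2 * (windowIntensity lam W).real Set.univ) n *
        ∫⁻ k, ∫⁻ w, Φ (edgeGraph (skelLoc x k) (withRoot a (idxSet (fun z => z.2 = false) k)) w,
          edgeGraph (skelLoc x k) (withRoot b (idxSet (mixPred t) k)) w)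
          ∂(Measure.pi fun _ : Fin (n + 1) × Fin (n + 1) => (volume : Measure I))
          ∂(Measure.pi fun _ : Fin n => skelMeasure lam W) := by
  have := isFiniteMeasure_skelMeasure (lam := lam) hW
  have hm : Measurable fun p : Marks × Finset (Pt d) × Finset (Pt d) =>
      Φ (graph B (addIf a (x, t, p.1) p.2.1),
        graph B (addIf b (x, t, p.1) (mix (fun q : Pt d => q.2.1) t p.2.1 p.2.2))) := by
    refine hΦ.comp (((measurable_graph B).comp ((measurable_addIf_root a x t).comp
      (measurable_fst.prodMk measurable_snd.fst))).prodMk ((measurable_graph B).comp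
      ((measurable_addIf_root b x t).comp (measurable_fst.prodMk ?_))))
    exact (measurable_mix_time t).comp measurable_snd
  rw [lintegral_window_eq_tsum hW hL hm]
  refine tsum_congr fun n => ?_
  congr 1
  refine lintegral_congr_ae ?_
  filter_upwards [ae_pi_forall (skelMeasure_time lam hW t) n,
    ae_pi_pairwise_ne (τ := fun k : Skel d => k.1.2) measurable_fst.snd
      (fun t => skelMeasure_time lam hW t) n] with k h1 h2
  rw [← lintegral_graph_skelPts B (skelTime_injective h1 h2) (compatible_mix a b x t k) hΦ]
  refine lintegral_congr fun v => ?_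
  rw [addIf_skelConfig, addIf_mix_skelConfig]

open Classical in
/-- The joint law of the graphs of a Poisson process and of its restriction to a saturated
subwindow, with an added point, does not depend on the birth time of that point. -/
theorem lintegral_graph_window (B : ℕ ≃ (Fin d → ℤ)) (hWm : MeasurableSet W) (hW : volume W ≠ ∞)
    (hL : IsPoissonLaw L (windowIntensity lam W)) {A : Set (Fin d → ℝ)} (hA : MeasurableSet A)
    {x : Fin d → ℝ} (hx : x ∈ A) (hsat : ∀ p ∈ W, ∀ q ∈ A, cell p = cell q → p ∈ A) (t t' : I)
    {Φ : Finset (MarkedEdge d) × Finset (MarkedEdge d) → ℝ≥0∞} (hΦ : Measurable Φ) :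
    ∫⁻ p, Φ (graph B (addPt (x, t, p.1) (p.2.filter fun q => q.1 ∈ A)),
        graph B (addPt (x, t, p.1) p.2)) ∂(marksMeasure.prod L) =
    ∫⁻ p, Φ (graph B (addPt (x, t', p.1) (p.2.filter fun q => q.1 ∈ A)),
        graph B (addPt (x, t', p.1) p.2)) ∂(marksMeasure.prod L) := by
  have := isFiniteMeasure_skelMeasure (lam := lam) hW
  have := hL.isProbabilityMeasure
  -- The right-hand side is free of `t`, since birth times disappear with the ranks. The sample of
  -- flagged points describes two copies of the process, and the copy with flag `true` is simply
  -- ignored.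
  have key : ∀ t : I, ∫⁻ p, Φ (graph B (addPt (x, t, p.1) (p.2.filter fun q => q.1 ∈ A)),
        graph B (addPt (x, t, p.1) p.2)) ∂(marksMeasure.prod L) =
      ∑' n, sampleWeight (2 * (windowIntensity lam W).real Set.univ) n *
        ∫⁻ k, ∫⁻ w, Φ (edgeGraph (skelLoc x k)
            (withRoot true (idxSet (fun z => z.2 = false ∧ z.1.1 ∈ A) k)) w,
          edgeGraph (skelLoc x k) (withRoot true (idxSet (fun z => z.2 = false) k)) w)
          ∂(Measure.pi fun _ : Fin (n + 1) × Fin (n + 1) => (volume : Measure I))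
          ∂(Measure.pi fun _ : Fin n => skelMeasure lam W) := by
    intro t
    have hadd := measurable_addIf_root true x t
    have hfil : Measurable fun η : Finset (Pt d) => η.filter fun q => q.1 ∈ A :=
      measurable_filter (measurable_fst hA)
    have hm0 : Measurable fun p : Marks × Finset (Pt d) =>
        Φ (graph B (addPt (x, t, p.1) (p.2.filter fun q => q.1 ∈ A)),
          graph B (addPt (x, t, p.1) p.2)) :=
      hΦ.comp (((measurable_graph B).comp (hadd.comp (measurable_fst.prodMk
        (hfil.comp measurable_snd)))).prodMk ((measurable_graph B).comp hadd))
    have hmp : MeasurePreserving (Prod.map id Prod.fst) (marksMeasure.prod (L.prod L))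
        (marksMeasure.prod L) := (MeasurePreserving.id _).prod measurePreserving_fst
    rw [← hmp.lintegral_comp hm0]
    refine (lintegral_window_eq_tsum hW hL (hm0.comp hmp.measurable)).trans ?_
    refine tsum_congr fun n => ?_
    congr 1
    refine lintegral_congr_ae ?_
    filter_upwards [ae_pi_forall (skelMeasure_time lam hW t) n,
      ae_pi_forall (skelMeasure_location lam hWm hW) n,
      ae_pi_pairwise_ne (τ := fun k : Skel d => k.1.2) measurable_fst.snd
        (fun t => skelMeasure_time lam hW t) n] with k h1 h2 h3
    rw [← lintegral_graph_skelPts B (skelTime_injective h1 h3) (compatible_window hx hsat t h2) hΦ]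
    refine lintegral_congr fun v => ?_
    change Φ (graph B (addPt (x, t, v 0) ((skelConfig false k v).filter fun q => q.1 ∈ A)),
      graph B (addIf true (x, t, v 0) (skelConfig false k v))) = _
    rw [addPt_filter_skelConfig, addIf_skelConfig]
  rw [key t, key t']

end Identities

/-! ### Removing the added point, and translations -/

section Removal

variable {d : ℕ}

/-- The graph itself, or the graph with a vertex removed. -/
def removeIf (a : Bool) (x : Fin d → ℝ) (G : Finset (MarkedEdge d)) : Finset (MarkedEdge d) :=
  bif a then G else removeVertex G x

theorem measurable_removeIf (a : Bool) (x : Fin d → ℝ) : Measurable (removeIf a x) := by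
  cases a
  · exact measurable_removeVertex.comp (measurable_id.prodMk measurable_const)
  · exact measurable_id

/-- In terms of independent edge marks, removing the location x amounts to dropping the index 0,
provided that no other point sits at x. No remaining mark is reassigned, in contrast with the
original marking. -/
theorem removeIf_edgeGraph {n : ℕ} (a : Bool) {x : Fin d → ℝ} {k : Fin n → Skel d}
    (hk : ∀ i, (k i).1.1 ≠ x) (p : Skel d → Prop) (w : Fin (n + 1) × Fin (n + 1) → I) :
    removeIf a x (edgeGraph (skelLoc x k) (withRoot true (idxSet p k)) w) =
      edgeGraph (skelLoc x k) (withRoot a (idxSet p k)) w := by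
  cases a
  swap
  · rfl
  have hne : ∀ j, j ≠ 0 → skelLoc x k j ≠ x := fun j hj => by
    obtain ⟨i, rfl⟩ := Fin.exists_succ_eq.2 hj
    exact hk i
  have hmem : ∀ j, j ∈ withRoot false (idxSet p k) ↔
      j ∈ withRoot true (idxSet p k) ∧ j ≠ 0 := fun j => by
    induction j using Fin.cases with
    | zero => simp [zero_mem_withRoot]
    | succ i => simp [succ_mem_withRoot, Fin.succ_ne_zero]
  ext e
  change e ∈ removeVertex _ x ↔ _
  rw [mem_removeVertex, mem_edgeGraph, mem_edgeGraph]
  constructor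
  · rintro ⟨⟨i, hi, j, hj, hij, h1, h2⟩, hx⟩
    rw [h1, Sym2.mem_iff, not_or] at hx
    refine ⟨i, (hmem i).2 ⟨hi, ?_⟩, j, (hmem j).2 ⟨hj, ?_⟩, hij, h1, h2⟩
    · rintro rfl; exact hx.1 rfl
    · rintro rfl; exact hx.2 rfl
  · rintro ⟨i, hi, j, hj, hij, h1, h2⟩
    obtain ⟨hi, hi0⟩ := (hmem i).1 hi
    obtain ⟨hj, hj0⟩ := (hmem j).1 hj
    refine ⟨⟨i, hi, j, hj, hij, h1, h2⟩, ?_⟩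
    rw [h1, Sym2.mem_iff, not_or]
    exact ⟨(hne i hi0).symm, (hne j hj0).symm⟩

variable {lam : ℝ} {W : Set (Fin d → ℝ)} {L : Measure (Finset (Pt d))}

/-- Not adding a point has, for the joint law of the graphs, the same effect as adding and
removing it. -/
theorem lintegral_graph_remove [Nonempty (Fin d)] (B : ℕ ≃ (Fin d → ℤ)) (hW : volume W ≠ ∞)
    (hL : IsPoissonLaw L (windowIntensity lam W)) (a b : Bool) (x : Fin d → ℝ) (t : I)
    {Φ : Finset (MarkedEdge d) × Finset (MarkedEdge d) → ℝ≥0∞} (hΦ : Measurable Φ) :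
    ∫⁻ p, Φ (graph B (addIf a (x, t, p.1) p.2.1),
        graph B (addIf b (x, t, p.1) (mix (fun q : Pt d => q.2.1) t p.2.1 p.2.2)))
        ∂(marksMeasure.prod (L.prod L)) =
    ∫⁻ p, Φ (removeIf a x (graph B (addPt (x, t, p.1) p.2.1)),
        removeIf b x (graph B (addPt (x, t, p.1) (mix (fun q : Pt d => q.2.1) t p.2.1 p.2.2))))
        ∂(marksMeasure.prod (L.prod L)) := by
  have := isFiniteMeasure_skelMeasure (lam := lam) hW
  have h := lintegral_graph_mix B hW hL true true x t
    (Φ := fun G => Φ (removeIf a x G.1, removeIf b x G.2))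
    (hΦ.comp (((measurable_removeIf a x).comp measurable_fst).prodMk
      ((measurable_removeIf b x).comp measurable_snd)))
  refine (lintegral_graph_mix B hW hL a b x t hΦ).trans (Eq.trans ?_ h.symm)
  refine tsum_congr fun n => ?_
  congr 1
  refine lintegral_congr_ae ?_
  filter_upwards [ae_pi_forall (skelMeasure_location_ne lam hW x) n] with k hk
  refine lintegral_congr fun w => ?_
  rw [removeIf_edgeGraph a hk, removeIf_edgeGraph b hk]

/-- The cost `f(G) - f(G \ x)` of the vertex `x`. -/
def vertexCost (f : Finset (MarkedEdge d) → ℝ) (x : Fin d → ℝ) (G : Finset (MarkedEdge d)) : ℝ :=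
  f G - f (removeVertex G x)

theorem addOneCost_eq (B : ℕ ≃ (Fin d → ℤ)) (f : Finset (MarkedEdge d) → ℝ) (p : Pt d)
    (η : Finset (Pt d)) : addOneCost B f p η = vertexCost f p.1 (graph B (addPt p η)) := by
  classical
  have : insert p η = addPt p η := by ext; simp
  unfold addOneCost vertexCost
  convert rfl <;> exact this.symm

theorem measurable_vertexCost {f : Finset (MarkedEdge d) → ℝ} (hf : Measurable f) :
    Measurable fun p : (Fin d → ℝ) × Finset (MarkedEdge d) => vertexCost f p.1 p.2 :=
  (hf.comp measurable_snd).sub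
    (hf.comp (measurable_removeVertex.comp (measurable_snd.prodMk measurable_fst)))

theorem vertexCost_edgeGraph {n : ℕ} {f : Finset (MarkedEdge d) → ℝ}
    (hf : TranslationInvariant f) (x z : Fin d → ℝ) (y : Fin n → Fin d → ℝ) (S : Finset (Fin n))
    (w : Fin n × Fin n → I) :
    vertexCost f (z + x) (edgeGraph (fun j => z + y j) S w) = vertexCost f x (edgeGraph y S w) := by
  classical
  have h1 : edgeGraph (fun j => z + y j) S w = (edgeGraph y S w).image (MarkedEdge.translate z) := by
    ext e
    rw [mem_edgeGraph, Finset.mem_image]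
    constructor
    · rintro ⟨i, hi, j, hj, hij, h1, h2⟩
      have hd : ¬ (s(y i, y j) : Sym2 (Fin d → ℝ)).IsDiag := fun h => e.1.2 (by
        rw [h1]
        simp only [Sym2.mk_isDiag_iff] at h ⊢
        rw [h])
      refine ⟨(⟨s(y i, y j), hd⟩, w (i, j)), mem_edgeGraph.2 ⟨i, hi, j, hj, hij, rfl, rfl⟩, ?_⟩
      refine Prod.ext (Subtype.ext ?_) h2.symm
      rw [h1]
      rfl
    · rintro ⟨e', he', rfl⟩
      obtain ⟨i, hi, j, hj, hij, h1, h2⟩ := mem_edgeGraph.1 he'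
      refine ⟨i, hi, j, hj, hij, ?_, h2⟩
      simp only [MarkedEdge.translate]
      rw [h1]
      rfl
  have h2 : ∀ G : Finset (MarkedEdge d), removeVertex (G.image (MarkedEdge.translate z)) (z + x) =
      (removeVertex G x).image (MarkedEdge.translate z) := by
    intro G
    ext e
    rw [mem_removeVertex, Finset.mem_image, Finset.mem_image]
    have h3 : ∀ e : MarkedEdge d, z + x ∈ (MarkedEdge.translate z e).1.1 ↔ x ∈ e.1.1 := by
      intro e
      simp only [MarkedEdge.translate, Sym2.mem_map]
      constructor
      · rintro ⟨a, ha, h⟩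
        rwa [← add_left_cancel h]
      · intro h; exact ⟨x, h, rfl⟩
    constructor
    · rintro ⟨⟨e', he', rfl⟩, hx⟩
      exact ⟨e', mem_removeVertex.2 ⟨he', fun h => hx ((h3 e').2 h)⟩, rfl⟩
    · rintro ⟨e', he', rfl⟩
      rw [mem_removeVertex] at he'
      exact ⟨⟨e', he'.1, rfl⟩, fun h => he'.2 ((h3 e').1 h)⟩
  have hf' : ∀ G : Finset (MarkedEdge d), f (G.image (MarkedEdge.translate z)) = f G := fun G => by
    rw [← hf z G]
  unfold vertexCost
  rw [h1, h2, hf', hf']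

/-- Shifting the locations of a skeleton. -/
def shiftSkel (x : Fin d → ℝ) (k : Skel d) : Skel d := ((x + k.1.1, k.1.2), k.2)

theorem measurePreserving_shiftSkel (lam : ℝ) {W : Set (Fin d → ℝ)} (hWm : MeasurableSet W)
    (hW : volume W ≠ ∞) (x : Fin d → ℝ) :
    MeasurePreserving (shiftSkel x) (skelMeasure lam ((fun p => x + p) ⁻¹' W))
      (skelMeasure lam W) := by
  have h0 : ∀ W : Set (Fin d → ℝ), volume W ≠ ∞ →
    IsFiniteMeasure ((ENNReal.ofReal lam • (volume : Measure (Fin d → ℝ))).restrict W) := fun W hW =>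
    ⟨by simpa using ENNReal.mul_lt_top ENNReal.ofReal_lt_top hW.lt_top⟩
  have hW' : volume ((fun p => x + p) ⁻¹' W) ≠ ∞ := by rwa [measure_preimage_add]
  have := h0 W hW
  have := h0 _ hW'
  have h1 : MeasurePreserving (fun p : Fin d → ℝ => x + p) (ENNReal.ofReal lam • volume)
      (ENNReal.ofReal lam • volume) :=
    (measurePreserving_add_left volume x).smul_measure _
  have h2 := (h1.restrict_preimage hWm)
  exact (h2.prod (MeasurePreserving.id (volume : Measure I))).prod
    (MeasurePreserving.id (Measure.count : Measure Bool))

/-- The joint law of the costs of an added point only depends on the position of that point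
relative to the window. -/
theorem lintegral_vertexCost_shift (B : ℕ ≃ (Fin d → ℤ)) {f : Finset (MarkedEdge d) → ℝ}
    (hf : Measurable f) (hft : TranslationInvariant f) (hWm : MeasurableSet W)
    (hW : volume W ≠ ∞) (hL : IsPoissonLaw L (windowIntensity lam W)) (x : Fin d → ℝ)
    {L' : Measure (Finset (Pt d))}
    (hL' : IsPoissonLaw L' (windowIntensity lam ((fun p => x + p) ⁻¹' W))) (t : I)
    {ψ : ℝ × ℝ → ℝ≥0∞} (hψ : Measurable ψ) :
    ∫⁻ p, ψ (vertexCost f x (graph B (addPt (x, t, p.1) p.2.1)),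
        vertexCost f x (graph B (addPt (x, t, p.1) (mix (fun q : Pt d => q.2.1) t p.2.1 p.2.2))))
        ∂(marksMeasure.prod (L.prod L)) =
    ∫⁻ p, ψ (vertexCost f 0 (graph B (addPt (0, t, p.1) p.2.1)),
        vertexCost f 0 (graph B (addPt (0, t, p.1) (mix (fun q : Pt d => q.2.1) t p.2.1 p.2.2))))
        ∂(marksMeasure.prod (L'.prod L')) := by
  have := isFiniteMeasure_skelMeasure (lam := lam) hW
  have hW' : volume ((fun p => x + p) ⁻¹' W) ≠ ∞ := by rwa [measure_preimage_add]
  have := isFiniteMeasure_skelMeasure (lam := lam) hW'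
  have hc : ∀ x : Fin d → ℝ, Measurable fun G => vertexCost f x G := fun x =>
    (measurable_vertexCost hf).comp (measurable_const.prodMk measurable_id)
  have hΦ : ∀ x, Measurable fun G : Finset (MarkedEdge d) × Finset (MarkedEdge d) =>
      ψ (vertexCost f x G.1, vertexCost f x G.2) := fun x =>
    hψ.comp (((hc x).comp measurable_fst).prodMk ((hc x).comp measurable_snd))
  -- With independent edge marks the unit cells no longer occur. This is why a shift by an arbitrary
  -- vector x, which need not preserve the lattice, is harmless.
  refine (lintegral_graph_mix B hW hL true true x t (hΦ x)).trans
    (Eq.trans ?_ (lintegral_graph_mix B hW' hL' true true 0 t (hΦ 0)).symm)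
  have hm : (windowIntensity lam ((fun p => x + p) ⁻¹' W)).real Set.univ =
      (windowIntensity lam W).real Set.univ := by
    simp only [measureReal_def, windowIntensity]
    rw [← Set.univ_prod_univ, Measure.prod_prod, Measure.prod_prod]
    simp [measure_preimage_add]
  rw [hm]
  refine tsum_congr fun n => ?_
  congr 1
  have hs := measurePreserving_shiftSkel lam hWm hW x
  have hsn : MeasurePreserving (fun (k : Fin n → Skel d) i => shiftSkel x (k i))
      (Measure.pi fun _ : Fin n => skelMeasure lam ((fun p => x + p) ⁻¹' W))
      (Measure.pi fun _ : Fin n => skelMeasure lam W) := by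
    exact measurePreserving_pi _ _ fun _ => hs
  have hS : ∀ (p : Skel d → Prop) (k : Fin n → Skel d), (∀ k, p (shiftSkel x k) ↔ p k) →
      idxSet p (fun i => shiftSkel x (k i)) = idxSet p k := by
    intro p k hp
    ext j
    simp only [mem_idxSet, hp]
  have hloc : ∀ k : Fin n → Skel d, skelLoc x (fun i => shiftSkel x (k i)) =
      fun j => x + skelLoc 0 k j := by
    intro k
    funext j
    induction j using Fin.cases with
    | zero => simp [skelLoc]
    | succ i => simp [skelLoc, shiftSkel]
  have e : ∀ k : Fin n → Skel d, ∫⁻ w, ψ (vertexCost f 0 (edgeGraph (skelLoc 0 k)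
        (withRoot true (idxSet (fun z => z.2 = false) k)) w),
          vertexCost f 0 (edgeGraph (skelLoc 0 k) (withRoot true (idxSet (mixPred t) k)) w))
          ∂(Measure.pi fun _ : Fin (n + 1) × Fin (n + 1) => (volume : Measure I)) =
      (fun k => ∫⁻ w, ψ (vertexCost f x (edgeGraph (skelLoc x k)
        (withRoot true (idxSet (fun z => z.2 = false) k)) w),
          vertexCost f x (edgeGraph (skelLoc x k) (withRoot true (idxSet (mixPred t) k)) w))
          ∂(Measure.pi fun _ : Fin (n + 1) × Fin (n + 1) => (volume : Measure I)))
        (fun i => shiftSkel x (k i)) := by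
    intro k
    refine lintegral_congr fun w => ?_
    rw [hS _ _ fun _ => Iff.rfl, hS _ _ fun _ => Iff.rfl, hloc]
    have := vertexCost_edgeGraph hft 0 x (skelLoc 0 k)
    rw [add_zero] at this
    rw [this, this]
  simp_rw [e]
  have hme : MeasurableEmbedding fun (k : Fin n → Skel d) i => shiftSkel x (k i) := by
    have hm : ∀ x : Fin d → ℝ, Measurable fun (k : Fin n → Skel d) i => shiftSkel x (k i) := by
      intro x
      refine measurable_pi_lambda _ fun i => ?_
      have h1 : Measurable (shiftSkel x) :=
        ((measurable_const.add measurable_fst.fst).prodMk measurable_fst.snd).prodMk measurable_snd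
      exact h1.comp (measurable_pi_apply i)
    have hinv : ∀ (x : Fin d → ℝ) (k : Skel d), shiftSkel (-x) (shiftSkel x k) = k := fun x k => by
      simp [shiftSkel]
    have hinv' : ∀ (x : Fin d → ℝ) (k : Skel d), shiftSkel x (shiftSkel (-x) k) = k := fun x k => by
      simp [shiftSkel]
    exact (MeasurableEquiv.mk ⟨fun k i => shiftSkel x (k i), fun k i => shiftSkel (-x) (k i),
      fun k => funext fun i => hinv x (k i), fun k => funext fun i => hinv' x (k i)⟩
      (hm x) (hm (-x))).measurableEmbedding
  exact (hsn.lintegral_comp_emb hme _).symm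

end Removal

/-! ### Cubes -/

section Cubes

variable {d : ℕ}

/-- The assumption d ≥ 1 is contained in the enumeration of the unit cubes. Positive dimension makes
single locations null and forces the side lengths of cubes exhausting the space to infinity. -/
theorem nonempty_fin_of_equiv (B : ℕ ≃ (Fin d → ℤ)) : Nonempty (Fin d) := by
  by_contra h
  rw [not_nonempty_iff] at h
  exact not_finite_iff_infinite.2 (inferInstance : Infinite ℕ) (Finite.of_equiv _ B.symm)

theorem Cube.measurableSet_toSet (W : Cube d) : MeasurableSet W.toSet :=
  MeasurableSet.univ_pi fun _ => measurableSet_Ico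

theorem Cube.volume_toSet (W : Cube d) : volume W.toSet = ENNReal.ofReal W.side ^ d := by
  rw [Cube.toSet, volume_pi_pi]
  simp

theorem Cube.volume_ne_top (W : Cube d) : volume W.toSet ≠ ∞ := by
  rw [W.volume_toSet]
  exact ENNReal.pow_ne_top ENNReal.ofReal_ne_top

theorem Cube.volumeReal_toSet (W : Cube d) : volume.real W.toSet = W.side ^ d := by
  rw [measureReal_def, W.volume_toSet, ENNReal.toReal_pow, ENNReal.toReal_ofReal W.side_pos.le]

theorem Cube.volumeReal_pos (W : Cube d) : 0 < volume.real W.toSet := by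
  rw [W.volumeReal_toSet]
  exact pow_pos W.side_pos d

/-- The cube `W - x`. -/
def Cube.shift (W : Cube d) (x : Fin d → ℝ) : Cube d := ⟨W.corner - x, W.side, W.side_pos⟩

theorem Cube.toSet_shift (W : Cube d) (x : Fin d → ℝ) :
    (W.shift x).toSet = (fun p => x + p) ⁻¹' W.toSet := by
  ext p
  simp only [Cube.toSet, Cube.shift, Set.mem_preimage, Set.mem_pi, Set.mem_univ, true_imp_iff,
    Set.mem_Ico, Pi.sub_apply, Pi.add_apply]
  refine forall_congr' fun i => ⟨fun h => ⟨by linarith [h.1], by linarith [h.2]⟩,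
    fun h => ⟨by linarith [h.1], by linarith [h.2]⟩⟩

theorem Cube.zero_mem_shift {W : Cube d} {x : Fin d → ℝ} : 0 ∈ (W.shift x).toSet ↔ x ∈ W.toSet := by
  rw [W.toSet_shift, Set.mem_preimage, add_zero]

end Cubes

/-! ### Configurations -/

section Configurations

variable {X Y : Type*} [TopologicalSpace X] [MeasurableSpace X] [MeasurableSpace Y]

theorem Config.measurable_count {A : Set X} (hA : MeasurableSet A) :
    Measurable fun η : Config X => η.count A :=
  Measurable.of_comap_le (le_iSup₂_of_le A hA le_rfl)

theorem Config.measurableSet_hit {A : Set X} (hA : MeasurableSet A) :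
    MeasurableSet {η : Config X | (η.carrier ∩ A).Nonempty} := by
  have h := Config.measurable_count hA (measurableSet_singleton 0).compl
  convert h using 1
  ext η
  simp [Config.count, Set.nonempty_iff_ne_empty]

theorem Config.measurable_of_hit [MeasurableSpace.CountablySeparated X] {S : Y → Config X}
    (h : ∀ A : Set X, MeasurableSet A → MeasurableSet {y | ((S y).carrier ∩ A).Nonempty}) :
    Measurable S := by
  refine measurable_iff_comap_le.2 ?_
  change MeasurableSpace.comap S (⨆ (A : Set X) (_ : MeasurableSet A),
    MeasurableSpace.comap (fun η : Config X => η.count A) inferInstance) ≤ _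
  rw [MeasurableSpace.comap_iSup]
  refine iSup_le fun A => ?_
  rw [MeasurableSpace.comap_iSup]
  refine iSup_le fun hA => ?_
  rw [MeasurableSpace.comap_comp]
  exact (measurable_encard_of_void h hA).comap_le

/-- The void events of `N(X)`. -/
def Config.voidEvents (X : Type*) [TopologicalSpace X] [MeasurableSpace X] : Set (Set (Config X)) :=
  {S | ∃ A : Set X, MeasurableSet A ∧ {η : Config X | η.carrier ∩ A = ∅} = S}

/-- Because counts are recovered from void events, laws and independence on `Config X` can be tested
on a π-system of void events. -/
theorem Config.generateFrom_voidEvents [MeasurableSpace.CountablySeparated X] :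
    MeasurableSpace.generateFrom (Config.voidEvents X) =
      (inferInstance : MeasurableSpace (Config X)) := by
  refine le_antisymm (MeasurableSpace.generateFrom_le ?_) ?_
  · rintro _ ⟨A, hA, rfl⟩
    convert (Config.measurableSet_hit hA).compl using 1
    ext η
    simp [Set.not_nonempty_iff_eq_empty]
  · have h : @Measurable _ _ (MeasurableSpace.generateFrom (Config.voidEvents X)) _
        (id : Config X → Config X) := by
      let _ : MeasurableSpace (Config X) := MeasurableSpace.generateFrom (Config.voidEvents X)
      refine Config.measurable_of_hit fun A hA => ?_
      have : {y : Config X | ((id y).carrier ∩ A).Nonempty} =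
          {η : Config X | η.carrier ∩ A = ∅}ᶜ := by
        ext η
        simp [Set.nonempty_iff_ne_empty]
      rw [this]
      refine MeasurableSet.compl (MeasurableSpace.measurableSet_generateFrom ?_)
      exact ⟨A, hA, rfl⟩
    exact fun s hs => h hs

theorem Config.isPiSystem_voidEvents : IsPiSystem (Config.voidEvents X) := by
  rintro _ ⟨A, hA, rfl⟩ _ ⟨B, hB, rfl⟩ -
  refine ⟨A ∪ B, hA.union hB, ?_⟩
  ext η
  simp [Set.inter_union_distrib_left]

/-- Finite measures on pairs of a configuration and a finite set are determined by their values on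
products of void events. -/
theorem config_prod_measure_ext [MeasurableSpace.CountablySeparated X]
    {μ ν : Measure (Config X × Finset X)} [IsFiniteMeasure μ]
    (h : ∀ A B : Set X, MeasurableSet A → MeasurableSet B →
      μ ({η : Config X | η.carrier ∩ A = ∅} ×ˢ voidSet B) =
        ν ({η : Config X | η.carrier ∩ A = ∅} ×ˢ voidSet B)) : μ = ν := by
  have h1 : IsCountablySpanning (Config.voidEvents X) :=
    ⟨fun _ => Set.univ, fun _ => ⟨∅, MeasurableSet.empty, by simp⟩, Set.iUnion_const _⟩
  have h2 : IsCountablySpanning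
      {S : Set (Finset X) | ∃ A : Set X, MeasurableSet A ∧ voidSet A = S} :=
    ⟨fun _ => Set.univ, fun _ => ⟨∅, MeasurableSet.empty, voidSet_empty⟩, Set.iUnion_const _⟩
  have e := generateFrom_prod_eq h1 h2
  rw [Config.generateFrom_voidEvents] at e
  refine ext_of_generate_finite _ e (Config.isPiSystem_voidEvents.prod isPiSystem_voidSet) ?_ ?_
  · rintro _ ⟨_, ⟨A, hA, rfl⟩, _, ⟨B, hB, rfl⟩, rfl⟩
    exact h A B hA hB
  · have := h ∅ ∅ MeasurableSet.empty MeasurableSet.empty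
    simpa [voidSet_empty] using this

end Configurations

/-! ### The Poisson process restricted to a cube, and independence of past and future -/

section PoissonWindow

variable {d : ℕ}

theorem mem_inCube {η : Config (Pt d)} {W : Cube d} {p : Pt d} :
    p ∈ η.inCube W ↔ p ∈ η.carrier ∧ p.1 ∈ W.toSet := by
  simp [Config.inCube]

theorem measurableSet_location {W : Set (Fin d → ℝ)} (hW : MeasurableSet W) :
    MeasurableSet {p : Pt d | p.1 ∈ W} := measurable_fst hW

theorem measurable_inCube (W : Cube d) : Measurable fun η : Config (Pt d) => η.inCube W := by
  refine measurable_to_finset_of_hit fun A hA => ?_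
  convert Config.measurableSet_hit (hA.inter (measurableSet_location W.measurableSet_toSet)) using 1
  ext η
  simp only [Set.mem_ofPred_eq, mem_inCube, Set.Nonempty, Set.mem_inter_iff]
  exact exists_congr fun p => ⟨fun h => ⟨h.1.1, h.2, h.1.2⟩, fun h => ⟨⟨h.1, h.2.2⟩, h.2.1⟩⟩

theorem measurable_before (t : I) : Measurable fun η : Config (Pt d) => η.before t := by
  refine Config.measurable_of_hit fun A hA => ?_
  have hm : MeasurableSet {p : Pt d | p.2.1 < t} := measurable_snd.fst measurableSet_Iio
  convert Config.measurableSet_hit (hm.inter hA) using 1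
  ext η
  simp [Config.before, Config.restrict, Set.inter_assoc]

open Classical in
theorem inCube_filter {η : Config (Pt d)} {A W : Cube d} (h : A.toSet ⊆ W.toSet) :
    (η.inCube W).filter (fun q => q.1 ∈ A.toSet) = η.inCube A := by
  ext p
  simp only [Finset.mem_filter, mem_inCube]
  exact ⟨fun h => ⟨h.1.1, h.2⟩, fun hp => ⟨⟨hp.1, h hp.2⟩, hp.2⟩⟩

variable {Ω : Type*} [MeasurableSpace Ω] {P : Measure Ω} {lam : ℝ} {η : Ω → Config (Pt d)}

/-- The law of the restriction of the process to a cube. -/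
def windowLaw (P : Measure Ω) (η : Ω → Config (Pt d)) (W : Cube d) : Measure (Finset (Pt d)) :=
  P.map fun ω => (η ω).inCube W

theorem IsPoissonProcess.measurable_inCube (hη : IsPoissonProcess P η (intensity d lam))
    (W : Cube d) : Measurable fun ω => (η ω).inCube W :=
  (MarkedPoisson.measurable_inCube W).comp hη.measurable

/-- The probability of the count zero is all that is needed of the Poisson law. -/
theorem IsPoissonProcess.isPoissonLaw_windowLaw (hη : IsPoissonProcess P η (intensity d lam))
    (W : Cube d) : IsPoissonLaw (windowLaw P η W) (windowIntensity lam W.toSet) := by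
  intro A hA
  have hAW := hA.inter (measurableSet_location (d := d) W.measurableSet_toSet)
  have := isFiniteMeasure_windowIntensity (lam := lam) W.volume_ne_top
  have e : windowIntensity lam W.toSet A = intensity d lam (A ∩ {p | p.1 ∈ W.toSet}) := by
    rw [windowIntensity_eq_restrict, Measure.restrict_apply hA]
  have h := hη.law_count _ hAW (by rw [← e]; exact measure_lt_top _ _) 0
  rw [poissonMeasure_singleton, ← e] at h
  rw [windowLaw, Measure.map_apply (hη.measurable_inCube W) (measurableSet_voidSet hA)]
  convert h using 2
  · ext ω
    simp only [Set.mem_preimage, voidSet, Set.mem_ofPred_eq, mem_inCube, Config.count,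
      Nat.cast_zero, Set.encard_eq_zero, Set.eq_empty_iff_forall_notMem, Set.mem_inter_iff]
    exact forall_congr' fun p => ⟨fun h hp => h ⟨hp.1, hp.2.2⟩ hp.2.1,
      fun h h1 h2 => h ⟨h1.1, h2, h1.2⟩⟩
  · simp [measureReal_def, ENNReal.coe_toNNReal_eq_toReal]

theorem nullSingletonClass_time (lam : ℝ) (W : Cube d) :
    NullSingletonClass ((windowIntensity lam W.toSet).map fun q : Pt d => q.2.1) := by
  refine ⟨fun t => ?_⟩
  have hm : Measurable fun q : Pt d => q.2.1 := measurable_snd.fst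
  have : (fun q : Pt d => q.2.1) ⁻¹' {t} = Set.univ ×ˢ ({t} ×ˢ Set.univ) := by ext; simp
  rw [Measure.map_apply hm (measurableSet_singleton t), this, windowIntensity, Measure.prod_prod,
    Measure.prod_prod]
  simp

variable [IsProbabilityMeasure P]

open Classical in
/-- The points after time `t` in a cube are independent of the process before time `t`. -/
theorem IsPoissonProcess.map_before_after (hη : IsPoissonProcess P η (intensity d lam))
    (W : Cube d) (t : I) :
    P.map (fun ω => ((η ω).before t, ((η ω).inCube W).filter fun q => t < q.2.1)) =
      (P.map fun ω => (η ω).before t).prod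
        ((windowLaw P η W).map fun ξ => ξ.filter fun q => t < q.2.1) := by
  have hgt : MeasurableSet {q : Pt d | t < q.2.1} := measurable_snd.fst measurableSet_Ioi
  have hlt : MeasurableSet {q : Pt d | q.2.1 < t} := measurable_snd.fst measurableSet_Iio
  have hb : Measurable fun ω => (η ω).before t := (measurable_before t).comp hη.measurable
  have hfil : Measurable fun ξ : Finset (Pt d) => ξ.filter fun q => t < q.2.1 :=
    measurable_filter hgt
  have hf : Measurable fun ω => ((η ω).inCube W).filter fun q => t < q.2.1 :=
    hfil.comp (hη.measurable_inCube W)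
  have hprob : IsProbabilityMeasure (P.map fun ω => ((η ω).before t,
      ((η ω).inCube W).filter fun q => t < q.2.1)) :=
    Measure.isProbabilityMeasure_map (hb.prodMk hf).aemeasurable
  have hpb : IsProbabilityMeasure (P.map fun ω => (η ω).before t) :=
    Measure.isProbabilityMeasure_map hb.aemeasurable
  rw [windowLaw, Measure.map_map hfil (hη.measurable_inCube W)]
  have hpf : IsProbabilityMeasure (P.map ((fun ξ : Finset (Pt d) => ξ.filter fun q => t < q.2.1) ∘
      fun ω => (η ω).inCube W)) := Measure.isProbabilityMeasure_map hf.aemeasurable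
  refine config_prod_measure_ext fun A B hA hB => ?_
  have hvA : MeasurableSet {ξ : Config (Pt d) | ξ.carrier ∩ A = ∅} := by
    convert (Config.measurableSet_hit hA).compl using 1
    ext ξ
    simp [Set.not_nonempty_iff_eq_empty]
  have hvB := measurableSet_voidSet hB
  rw [Measure.prod_prod, Measure.map_apply (hb.prodMk hf) (hvA.prod hvB), Measure.map_apply hb hvA,
    Measure.map_apply (hfil.comp (hη.measurable_inCube W)) hvB]
  -- The past region and the future region inside the cube are disjoint, so their counts are
  -- independent. Both void events say that a count vanishes.
  let S : Fin 2 → Set (Pt d) := ![{q | q.2.1 < t} ∩ A,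
    B ∩ ({q | q.1 ∈ W.toSet} ∩ {q | t < q.2.1})]
  have hS : ∀ i, MeasurableSet (S i) := by
    rw [Fin.forall_fin_two]
    exact ⟨hlt.inter hA, hB.inter ((measurableSet_location W.measurableSet_toSet).inter hgt)⟩
  have hd : Disjoint (S 0) (S 1) := Set.disjoint_left.2 fun q h0 h1 =>
    lt_asymm (show q.2.1 < t from h0.1) (show t < q.2.1 from h1.2.2)
  have hdis : Pairwise fun i j => Disjoint (S i) (S j) := by
    intro i j hij
    fin_cases i <;> fin_cases j
    · exact absurd rfl hij
    · exact hd
    · exact hd.symm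
    · exact absurd rfl hij
  have hind := (hη.indep 2 S hS hdis).indepFun (i := 0) (j := 1) (by decide)
  have h := hind.measure_inter_preimage_eq_mul {0} {0} (measurableSet_singleton 0)
    (measurableSet_singleton 0)
  have e0 : (fun ω => (η ω).before t) ⁻¹' {ξ : Config (Pt d) | ξ.carrier ∩ A = ∅} =
      (fun ω => (η ω).count (S 0)) ⁻¹' {0} := by
    ext ω
    simp [S, Config.count, Config.before, Config.restrict, Set.inter_assoc]
  have e1 : (fun ω => ((η ω).inCube W).filter fun q => t < q.2.1) ⁻¹' voidSet B =
      (fun ω => (η ω).count (S 1)) ⁻¹' {0} := by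
    ext ω
    simp only [Set.mem_preimage, voidSet, Set.mem_ofPred_eq, Finset.mem_filter, mem_inCube,
      Config.count, Set.mem_singleton_iff, Set.encard_eq_zero, Set.eq_empty_iff_forall_notMem]
    exact forall_congr' fun p => ⟨fun h hp => h ⟨⟨hp.1, hp.2.2.1⟩, hp.2.2.2⟩ hp.2.1,
      fun h h1 h2 => h ⟨h1.1.1, h2, h1.1.2, h1.2⟩⟩
  rw [Set.mk_preimage_prod]
  change P (_ ∩ (fun ω => ((η ω).inCube W).filter fun q => t < q.2.1) ⁻¹' voidSet B) = _ *
    P ((fun ω => ((η ω).inCube W).filter fun q => t < q.2.1) ⁻¹' voidSet B)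
  rw [e0, e1]
  exact h

end PoissonWindow

/-! ### Conditional expectations given the past -/

section CondExp

theorem map_prod_rotate {A C Q : Type*} [MeasurableSpace A] [MeasurableSpace C] [MeasurableSpace Q]
    (μ : Measure A) (ν : Measure C) (κ : Measure Q) [SFinite μ] [SFinite ν] [SFinite κ] :
    ((μ.prod ν).prod κ).map (fun p => ((p.1.1, p.2), p.1.2)) = (μ.prod κ).prod ν :=
  (((measurePreserving_prodAssoc μ κ ν).symm MeasurableEquiv.prodAssoc).comp
    (((MeasurePreserving.id μ).prod Measure.measurePreserving_swap).comp
      (measurePreserving_prodAssoc μ ν κ))).map_eq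

variable {Ω A C : Type*} [MeasurableSpace Ω] [MeasurableSpace A] [MeasurableSpace C]

/-- The freezing lemma: Y is independent of X with law ν, so conditioning on X freezes the first
argument and averages over the second. -/
theorem condExp_of_map_prod {ρ : Measure Ω} [IsProbabilityMeasure ρ] {X : Ω → A} {Y : Ω → C}
    (hX : Measurable X) (hY : Measurable Y) {ν : Measure C} [IsProbabilityMeasure ν]
    (hind : ρ.map (fun ω => (X ω, Y ω)) = (ρ.map X).prod ν) {h : A × C → ℝ} (hh : Measurable h)
    (hint : Integrable (fun ω => h (X ω, Y ω)) ρ) :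
    condExp (MeasurableSpace.comap X inferInstance) ρ (fun ω => h (X ω, Y ω)) =ᵐ[ρ]
      fun ω => ∫ y, h (X ω, y) ∂ν := by
  have hXY := hX.prodMk hY
  have : IsProbabilityMeasure (ρ.map X) := Measure.isProbabilityMeasure_map hX.aemeasurable
  have hint' : Integrable h ((ρ.map X).prod ν) := by
    rw [← hind]
    exact (integrable_map_measure hh.aestronglyMeasurable hXY.aemeasurable).2 hint
  have hm : StronglyMeasurable fun a => ∫ y, h (a, y) ∂ν :=
    hh.stronglyMeasurable.integral_prod_right'
  have hint1 : Integrable (fun ω => ∫ y, h (X ω, y) ∂ν) ρ :=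
    (integrable_map_measure hm.aestronglyMeasurable hX.aemeasurable).1 hint'.integral_prod_left
  symm
  refine ae_eq_condExp_of_forall_setIntegral_eq hX.comap_le hint
    (fun s _ _ => hint1.integrableOn) ?_ ?_
  · rintro _ ⟨S, hS, rfl⟩ -
    have e1 : ∫ ω in X ⁻¹' S, ∫ y, h (X ω, y) ∂ν ∂ρ = ∫ a in S, ∫ y, h (a, y) ∂ν ∂(ρ.map X) :=
      (setIntegral_map hS hm.aestronglyMeasurable hX.aemeasurable).symm
    have e2 : ∫ ω in X ⁻¹' S, h (X ω, Y ω) ∂ρ = ∫ p in S ×ˢ Set.univ, h p ∂((ρ.map X).prod ν) := by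
      rw [← hind, setIntegral_map (hS.prod MeasurableSet.univ) hh.aestronglyMeasurable
        hXY.aemeasurable]
      congr 2
      ext ω
      simp
    rw [e1, e2, setIntegral_prod _ hint'.integrableOn]
    simp
  · exact (hm.comp_measurable (comap_measurable X)).aestronglyMeasurable

/-- Conditional expectation is an orthogonal projection. Keeping one factor unconditioned means that
one resampled future suffices to express the second moment. -/
theorem integral_condExp_sq {m m0 : MeasurableSpace Ω} {ρ : Measure Ω} [IsFiniteMeasure ρ]
    (hm : m ≤ m0) {D : Ω → ℝ} (hD : MemLp D 2 ρ) :
    ∫ z, (condExp m ρ D z) ^ 2 ∂ρ = ∫ z, condExp m ρ D z * D z ∂ρ := by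
  have hZ : MemLp (condExp m ρ D) 2 ρ := hD.condExp one_le_two
  have hZD : Integrable (condExp m ρ D * D) ρ := hZ.integrable_mul hD
  have h := condExp_mul_of_stronglyMeasurable_left (m := m) (μ := ρ) (f := condExp m ρ D) (g := D)
    stronglyMeasurable_condExp hZD (hD.integrable one_le_two)
  change _ = ∫ z, (condExp m ρ D * D) z ∂ρ
  rw [← integral_condExp hm (f := condExp m ρ D * D), integral_congr_ae h]
  simp [pow_two]

end CondExp

/-! ### Resampling the future of the Poisson process -/

section Past

variable {d : ℕ} {Ω : Type*} [MeasurableSpace Ω] {P : Measure Ω} [IsProbabilityMeasure P]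
  {lam : ℝ} {η : Ω → Config (Pt d)}

theorem IsPoissonProcess.isProbabilityMeasure_windowLaw
    (hη : IsPoissonProcess P η (intensity d lam)) (W : Cube d) :
    IsProbabilityMeasure (windowLaw P η W) := (hη.isPoissonLaw_windowLaw W).isProbabilityMeasure

theorem IsPoissonProcess.measurePreserving_inCube (hη : IsPoissonProcess P η (intensity d lam))
    (W : Cube d) : MeasurePreserving (fun z : Ω × Marks => (z.2, (η z.1).inCube W))
      (P.prod marksMeasure) (marksMeasure.prod (windowLaw P η W)) := by
  have h1 : MeasurePreserving (fun ω => (η ω).inCube W) P (windowLaw P η W) :=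
    ⟨hη.measurable_inCube W, rfl⟩
  have := hη.isProbabilityMeasure_windowLaw W
  exact ((MeasurePreserving.id marksMeasure).prod h1).comp Measure.measurePreserving_swap

theorem IsPoissonProcess.ae_time_ne (hη : IsPoissonProcess P η (intensity d lam)) (W : Cube d)
    (t : I) : ∀ᵐ ξ ∂(windowLaw P η W), ∀ q ∈ ξ, q.2.1 ≠ t := by
  have := hη.isProbabilityMeasure_windowLaw W
  have hm : Measurable fun q : Pt d => q.2.1 := measurable_snd.fst
  have h := hη.isPoissonLaw_windowLaw W {q | q.2.1 = t} (hm (measurableSet_singleton t))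
  rw [measureReal_def, measure_eq_zero_of_noAtoms_map hm (nullSingletonClass_time lam W) t] at h
  have h1 : windowLaw P η W (voidSet {q | q.2.1 = t}) = 1 := by simpa using h
  exact (mem_ae_iff_prob_eq_one (measurableSet_voidSet (hm (measurableSet_singleton t)))).2 h1

theorem sigmaBefore_eq_comap (t : I) : sigmaBefore η t =
    MeasurableSpace.comap (Prod.map (fun ω => (η ω).before t) (id : Marks → Marks))
      inferInstance := by
  have := MeasurableSpace.comap_prodMap (mα := (inferInstance : MeasurableSpace (Config (Pt d))))
    (mβ := (inferInstance : MeasurableSpace Marks)) (fun ω => (η ω).before t) (id : Marks → Marks)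
  rw [MeasurableSpace.comap_id] at this
  exact this.symm

/-- The conditional expectation given the past, of a function of the process in a cube and the
mark, is obtained by resampling the future. -/
theorem IsPoissonProcess.condExp_before (hη : IsPoissonProcess P η (intensity d lam)) (W : Cube d)
    (t : I) {g : Marks × Finset (Pt d) → ℝ} (hg : Measurable g)
    (hint : Integrable (fun z : Ω × Marks => g (z.2, (η z.1).inCube W)) (P.prod marksMeasure)) :
    condExp (sigmaBefore η t) (P.prod marksMeasure)
        (fun z : Ω × Marks => g (z.2, (η z.1).inCube W)) =ᵐ[P.prod marksMeasure]
      fun z => ∫ ξ, g (z.2, mix (fun q : Pt d => q.2.1) t ((η z.1).inCube W) ξ)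
        ∂(windowLaw P η W) := by
  classical
  have hL := hη.isProbabilityMeasure_windowLaw W
  have hgt : MeasurableSet {q : Pt d | t < q.2.1} := measurable_snd.fst measurableSet_Ioi
  have hb : Measurable fun ω => (η ω).before t := (measurable_before t).comp hη.measurable
  have hfil : Measurable fun ξ : Finset (Pt d) => ξ.filter fun q => t < q.2.1 :=
    measurable_filter hgt
  let X : Ω × Marks → Config (Pt d) × Marks := Prod.map (fun ω => (η ω).before t) id
  let Y : Ω × Marks → Finset (Pt d) := fun z => ((η z.1).inCube W).filter fun q => t < q.2.1
  have hX : Measurable X := hb.prodMap measurable_id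
  have hY : Measurable Y := hfil.comp ((hη.measurable_inCube W).comp measurable_fst)
  let ν := (windowLaw P η W).map fun ξ => ξ.filter fun q => t < q.2.1
  have hν : IsProbabilityMeasure ν := Measure.isProbabilityMeasure_map hfil.aemeasurable
  have hσ : sigmaBefore η t = MeasurableSpace.comap X inferInstance := sigmaBefore_eq_comap t
  have hpb : IsProbabilityMeasure (P.map fun ω => (η ω).before t) :=
    Measure.isProbabilityMeasure_map hb.aemeasurable
  have hmapX : (P.prod marksMeasure).map X =
      (P.map fun ω => (η ω).before t).prod marksMeasure := by
    have := Measure.map_prod_map P marksMeasure hb measurable_id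
    rw [Measure.map_id] at this
    exact this.symm
  have hind : (P.prod marksMeasure).map (fun z => (X z, Y z)) =
      ((P.prod marksMeasure).map X).prod ν := by
    have hbf : Measurable fun ω => ((η ω).before t, ((η ω).inCube W).filter fun q => t < q.2.1) :=
      hb.prodMk (hfil.comp (hη.measurable_inCube W))
    have h1 := Measure.map_prod_map P marksMeasure hbf measurable_id
    rw [Measure.map_id, hη.map_before_after W t] at h1
    have h2 := map_prod_rotate (P.map fun ω => (η ω).before t) ν marksMeasure
    rw [hmapX, ← h2, h1, Measure.map_map (by fun_prop) (hbf.prodMap measurable_id)]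
    rfl
  have hh : Measurable fun p : (Config (Pt d) × Marks) × Finset (Pt d) =>
      g (p.1.2, mix (fun q : Pt d => q.2.1) t (p.1.1.inCube W) p.2) :=
    hg.comp (measurable_fst.snd.prodMk ((measurable_mix_time t).comp
      (((MarkedPoisson.measurable_inCube W).comp measurable_fst.fst).prodMk measurable_snd)))
  have hmix : ∀ ω ξ, mix (fun q : Pt d => q.2.1) t (((η ω).before t).inCube W) ξ =
      mix (fun q : Pt d => q.2.1) t ((η ω).inCube W) ξ := by
    intro ω ξ
    ext q
    simp only [mem_mix, mem_inCube, Config.before, Config.restrict, Set.mem_inter_iff,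
      Set.mem_ofPred_eq]
    tauto
  -- Almost surely no point is born exactly at t, so the process in W is its past mixed with its own
  -- future.
  have hD : (fun z : Ω × Marks => g (z.2, (η z.1).inCube W)) =ᵐ[P.prod marksMeasure]
      fun z => g ((X z).2, mix (fun q : Pt d => q.2.1) t ((X z).1.inCube W) (Y z)) := by
    have hmp : MeasurePreserving (fun z : Ω × Marks => (η z.1).inCube W) (P.prod marksMeasure)
        (windowLaw P η W) := measurePreserving_snd.comp (hη.measurePreserving_inCube W)
    filter_upwards [hmp.quasiMeasurePreserving.ae (hη.ae_time_ne W t)] with z hz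
    change _ = g (z.2, mix (fun q : Pt d => q.2.1) t (((η z.1).before t).inCube W) (Y z))
    rw [hmix]
    congr 2
    ext q
    simp only [mem_mix, Y, Finset.mem_filter]
    constructor
    · intro hq
      rcases lt_or_gt_of_ne (hz q hq) with h | h
      · exact Or.inl ⟨hq, h⟩
      · exact Or.inr ⟨⟨hq, h⟩, h⟩
    · rintro (h | h)
      · exact h.1
      · exact h.1.1
  refine (condExp_congr_ae hD).trans ?_
  rw [hσ]
  refine (condExp_of_map_prod hX hY hind hh (hint.congr hD)).trans (Eventually.of_forall fun z => ?_)
  change ∫ ξ, g (z.2, mix (fun q : Pt d => q.2.1) t (((η z.1).before t).inCube W) ξ) ∂ν = _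
  have hm : Measurable fun ξ => g (z.2, mix (fun q : Pt d => q.2.1) t ((η z.1).inCube W) ξ) :=
    hg.comp (measurable_const.prodMk ((measurable_mix_time t).comp
      (measurable_const.prodMk measurable_id)))
  simp_rw [hmix]
  rw [integral_map hfil.aemeasurable hm.aestronglyMeasurable]
  refine integral_congr_ae (Eventually.of_forall fun ξ => ?_)
  change g (z.2, mix _ t _ _) = g (z.2, mix _ t _ _)
  congr 2
  ext q
  simp only [mem_mix, Finset.mem_filter]
  tauto

theorem sigmaBefore_le (hη : IsPoissonProcess P η (intensity d lam)) (t : I) :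
    sigmaBefore η t ≤ (inferInstance : MeasurableSpace (Ω × Marks)) :=
  sup_le_sup (MeasurableSpace.comap_mono
    ((measurable_before t).comp hη.measurable).comap_le) le_rfl

theorem IsPoissonProcess.measurePreserving_mix (hη : IsPoissonProcess P η (intensity d lam))
    (W : Cube d) (t : I) :
    MeasurePreserving (fun p : Marks × Finset (Pt d) × Finset (Pt d) =>
        (p.1, mix (fun q : Pt d => q.2.1) t p.2.1 p.2.2))
      (marksMeasure.prod ((windowLaw P η W).prod (windowLaw P η W)))
      (marksMeasure.prod (windowLaw P η W)) := by
  have hL := hη.isProbabilityMeasure_windowLaw W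
  have := isFiniteMeasure_windowIntensity (lam := lam) W.volume_ne_top
  have h1 : MeasurePreserving (fun p : Finset (Pt d) × Finset (Pt d) =>
      mix (fun q : Pt d => q.2.1) t p.1 p.2) ((windowLaw P η W).prod (windowLaw P η W))
      (windowLaw P η W) := ⟨measurable_mix_time t, map_mix_eq (hη.isPoissonLaw_windowLaw W)
        measurable_snd.fst (nullSingletonClass_time lam W) t⟩
  exact (MeasurePreserving.id marksMeasure).prod h1

theorem IsPoissonProcess.measurePreserving_old (hη : IsPoissonProcess P η (intensity d lam))
    (W : Cube d) :
    MeasurePreserving (fun p : Marks × Finset (Pt d) × Finset (Pt d) => (p.1, p.2.1))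
      (marksMeasure.prod ((windowLaw P η W).prod (windowLaw P η W)))
      (marksMeasure.prod (windowLaw P η W)) := by
  have hL := hη.isProbabilityMeasure_windowLaw W
  exact (MeasurePreserving.id marksMeasure).prod measurePreserving_fst

/-- The second moment of the conditional expectation given the past. -/
theorem IsPoissonProcess.integral_condExp_before_sq (hη : IsPoissonProcess P η (intensity d lam))
    (W : Cube d) (t : I) {g : Marks × Finset (Pt d) → ℝ} (hg : Measurable g)
    (hg2 : MemLp g 2 (marksMeasure.prod (windowLaw P η W))) :
    ∫ z, (condExp (sigmaBefore η t) (P.prod marksMeasure)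
        (fun z : Ω × Marks => g (z.2, (η z.1).inCube W)) z) ^ 2 ∂(P.prod marksMeasure) =
      ∫ p, g (p.1, p.2.1) * g (p.1, mix (fun q : Pt d => q.2.1) t p.2.1 p.2.2)
        ∂(marksMeasure.prod ((windowLaw P η W).prod (windowLaw P η W))) := by
  have hL := hη.isProbabilityMeasure_windowLaw W
  have hmp := hη.measurePreserving_inCube W
  have hD : MemLp (fun z : Ω × Marks => g (z.2, (η z.1).inCube W)) 2 (P.prod marksMeasure) :=
    hg2.comp_measurePreserving hmp
  rw [integral_condExp_sq (sigmaBefore_le hη t) hD]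
  have h1 := hη.condExp_before W t hg (hD.integrable one_le_two)
  have e1 : ∫ z, condExp (sigmaBefore η t) (P.prod marksMeasure)
        (fun z : Ω × Marks => g (z.2, (η z.1).inCube W)) z * g (z.2, (η z.1).inCube W)
        ∂(P.prod marksMeasure) =
      ∫ z, (fun p : Marks × Finset (Pt d) =>
        (∫ ξ, g (p.1, mix (fun q : Pt d => q.2.1) t p.2 ξ) ∂(windowLaw P η W)) * g p)
        (z.2, (η z.1).inCube W) ∂(P.prod marksMeasure) := by
    refine integral_congr_ae ?_
    filter_upwards [h1] with z hz
    rw [hz]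
  have hm3 : Measurable fun p : (Marks × Finset (Pt d)) × Finset (Pt d) =>
      g (p.1.1, mix (fun q : Pt d => q.2.1) t p.1.2 p.2) :=
    hg.comp (measurable_fst.fst.prodMk ((measurable_mix_time t).comp
      (measurable_fst.snd.prodMk measurable_snd)))
  have hm2 : Measurable fun p : Marks × Finset (Pt d) =>
      (∫ ξ, g (p.1, mix (fun q : Pt d => q.2.1) t p.2 ξ) ∂(windowLaw P η W)) * g p :=
    (hm3.stronglyMeasurable.integral_prod_right' (ν := windowLaw P η W)).measurable.mul hg
  rw [e1, ← integral_map hmp.measurable.aemeasurable hm2.aestronglyMeasurable, hmp.map_eq]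
  have hass := measurePreserving_prodAssoc marksMeasure (windowLaw P η W) (windowLaw P η W)
  have hG : Integrable (fun p : Marks × Finset (Pt d) × Finset (Pt d) =>
      g (p.1, p.2.1) * g (p.1, mix (fun q : Pt d => q.2.1) t p.2.1 p.2.2))
      (marksMeasure.prod ((windowLaw P η W).prod (windowLaw P η W))) :=
    (hg2.comp_measurePreserving (hη.measurePreserving_old W)).integrable_mul
      (hg2.comp_measurePreserving (hη.measurePreserving_mix W t))
  rw [← hass.integral_comp MeasurableEquiv.prodAssoc.measurableEmbedding]
  have hG' := (hass.integrable_comp_emb MeasurableEquiv.prodAssoc.measurableEmbedding).2 hG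
  refine Eq.trans (integral_congr_ae (Eventually.of_forall fun p => ?_)) (integral_prod _ hG').symm
  change (∫ ξ, g (p.1, mix (fun q : Pt d => q.2.1) t p.2 ξ) ∂(windowLaw P η W)) * g p =
    ∫ ξ, g p * g (p.1, mix (fun q : Pt d => q.2.1) t p.2 ξ) ∂(windowLaw P η W)
  rw [integral_const_mul, mul_comm]

end Past

/-! ### Truncation and convergence in mean square -/

section Truncation

/-- The truncation of `x` to `[-K, K]`. -/
def clamp (K x : ℝ) : ℝ := max (-K) (min x K)

theorem abs_clamp_le {K : ℝ} (hK : 0 ≤ K) (x : ℝ) : |clamp K x| ≤ K :=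
  abs_le.2 ⟨le_max_left _ _, max_le (by linarith) (min_le_right _ _)⟩

theorem abs_clamp_sub_clamp_le (K x y : ℝ) : |clamp K x - clamp K y| ≤ |x - y| := by
  unfold clamp
  refine (abs_max_sub_max_le_max _ _ _ _).trans ?_
  rw [sub_self, abs_zero]
  refine max_le (abs_nonneg _) ((abs_min_sub_min_le_max _ _ _ _).trans ?_)
  rw [sub_self, abs_zero]
  exact max_le le_rfl (abs_nonneg _)

theorem clamp_zero {K : ℝ} (hK : 0 ≤ K) : clamp K 0 = 0 := by
  simp [clamp, hK]

theorem abs_clamp_le_abs {K : ℝ} (hK : 0 ≤ K) (x : ℝ) : |clamp K x| ≤ |x| := by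
  have := abs_clamp_sub_clamp_le K x 0
  rwa [clamp_zero hK, sub_zero, sub_zero] at this

theorem clamp_eq_self {K x : ℝ} (h : |x| ≤ K) : clamp K x = x := by
  rw [clamp, min_eq_left (abs_le.1 h).2, max_eq_right (abs_le.1 h).1]

theorem measurable_clamp (K : ℝ) : Measurable (clamp K) :=
  measurable_const.max (measurable_id.min measurable_const)

theorem tendsto_clamp (x : ℝ) : Tendsto (fun n : ℕ => clamp n x) atTop (𝓝 x) := by
  refine tendsto_const_nhds.congr' ?_
  filter_upwards [(tendsto_natCast_atTop_atTop (R := ℝ)).eventually_ge_atTop |x|] with n hn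
  exact (clamp_eq_self hn).symm

theorem mul_clamp_nonneg {K : ℝ} (hK : 0 ≤ K) (x : ℝ) : 0 ≤ x * clamp K x := by
  rcases le_total 0 x with h | h
  · exact mul_nonneg h (le_max_of_le_right (le_min h hK))
  · refine mul_nonneg_of_nonpos_of_nonpos h (max_le (by linarith) ((min_le_left _ _).trans h))

theorem mul_clamp_pos {K x : ℝ} (hK : 0 < K) (hx : x ≠ 0) : 0 < x * clamp K x := by
  rcases lt_or_gt_of_ne hx with h | h
  · exact mul_pos_of_neg_of_neg h (max_lt (by linarith) ((min_le_left _ _).trans_lt h))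
  · exact mul_pos h (lt_max_of_lt_right (lt_min h hK))

/-- The function is x² on [-1, 1] and |x| outside, hence Lipschitz with constant 2. It vanishes only
at 0, which makes it a substitute for the square that is stable under L¹ errors. -/
theorem abs_mul_clamp_sub_le (x y : ℝ) :
    |x * clamp 1 x - y * clamp 1 y| ≤ 2 * |x - y| := by
  have key : ∀ x : ℝ, x ≤ -1 ∧ clamp 1 x = -1 ∨ 1 ≤ x ∧ clamp 1 x = 1 ∨
      (-1 ≤ x ∧ x ≤ 1) ∧ clamp 1 x = x := by
    intro x
    rcases le_total x (-1) with h | h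
    · exact Or.inl ⟨h, by rw [clamp, min_eq_left (by linarith), max_eq_left h]⟩
    rcases le_total 1 x with h' | h'
    · exact Or.inr (Or.inl ⟨h', by rw [clamp, min_eq_right h', max_eq_right (by norm_num)]⟩)
    · exact Or.inr (Or.inr ⟨⟨h, h'⟩, clamp_eq_self (abs_le.2 ⟨h, h'⟩)⟩)
  rcases abs_cases (x - y) with ⟨h, _⟩ | ⟨h, _⟩ <;> rw [h, abs_le] <;>
  rcases key x with ⟨hx, h1⟩ | ⟨hx, h1⟩ | ⟨⟨hx, hx'⟩, h1⟩ <;>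
  rcases key y with ⟨hy, h2⟩ | ⟨hy, h2⟩ | ⟨⟨hy, hy'⟩, h2⟩ <;> rw [h1, h2] <;>
  constructor <;> nlinarith

end Truncation

/-! ### Mean-square convergence and square integrability -/

section MeanSquare

variable {α : Type*} [MeasurableSpace α] {ρ : Measure α}

theorem integral_sq_eq_eLpNorm {f : α → ℝ} (hf : MemLp f 2 ρ) :
    ∫ x, f x ^ 2 ∂ρ = (eLpNorm f 2 ρ).toReal ^ 2 := by
  have h := hf.eLpNorm_eq_integral_rpow_norm two_ne_zero ENNReal.ofNat_ne_top
  have h0 : 0 ≤ ∫ x, f x ^ 2 ∂ρ := integral_nonneg fun x => sq_nonneg _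
  simp only [ENNReal.toReal_ofNat, Real.rpow_two, Real.norm_eq_abs, sq_abs] at h
  rw [h, ENNReal.toReal_ofReal (by positivity), ← Real.rpow_natCast, ← Real.rpow_mul h0]
  norm_num

theorem tendsto_integral_sq_of_tendsto_eLpNorm {ι : Type*} {l : Filter ι} {f : ι → α → ℝ}
    {g : α → ℝ} (hf : ∀ n, MemLp (f n) 2 ρ) (hg : MemLp g 2 ρ)
    (h : Tendsto (fun n => eLpNorm (f n - g) 2 ρ) l (𝓝 0)) :
    Tendsto (fun n => ∫ x, f n x ^ 2 ∂ρ) l (𝓝 (∫ x, g x ^ 2 ∂ρ)) := by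
  have h1 := ((Lp.tendsto_Lp_iff_tendsto_eLpNorm'' f hf g hg).2 h).norm
  simp only [Lp.norm_toLp] at h1
  rw [integral_sq_eq_eLpNorm hg]
  exact (h1.pow 2).congr fun n => (integral_sq_eq_eLpNorm (hf n)).symm

theorem exists_tendsto_eLpNorm_two {f : ℕ → α → ℝ} (hf : ∀ n, MemLp (f n) 2 ρ)
    (h : ∀ ε : ℝ≥0∞, 0 < ε → ∃ N, ∀ m, N ≤ m → ∀ n, N ≤ n → eLpNorm (f m - f n) 2 ρ ≤ ε) :
    ∃ g : α → ℝ, Measurable g ∧ MemLp g 2 ρ ∧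
      Tendsto (fun n => eLpNorm (f n - g) 2 ρ) atTop (𝓝 0) := by
  have hc : CauchySeq fun n => (hf n).toLp (f n) := by
    rw [Lp.cauchySeq_Lp_iff_cauchySeq_eLpNorm]
    refine ENNReal.tendsto_nhds_zero.2 fun ε hε => ?_
    obtain ⟨N, hN⟩ := h ε hε
    filter_upwards [eventually_ge_atTop (N, N)] with p hp
    refine le_trans (le_of_eq (eLpNorm_congr_ae ?_)) (hN p.1 hp.1 p.2 hp.2)
    exact (hf p.1).coeFn_toLp.sub (hf p.2).coeFn_toLp
  obtain ⟨G, hG⟩ := cauchySeq_tendsto_of_complete hc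
  have hG2 := Lp.memLp G
  refine ⟨G, (Lp.stronglyMeasurable G).measurable, hG2, ?_⟩
  rw [← Lp.tendsto_Lp_iff_tendsto_eLpNorm'' f hf G hG2, Lp.toLp_coeFn]
  exact hG

/-- A bound in L^p with p > 2 gives uniform integrability of the squares. The difference is split
according to whether it exceeds δ: the large part is treated by Hölder and the vanishing measure of
the exceptional set, and the small part is at most δ. -/
theorem tendsto_eLpNorm_two_of_tendstoInMeasure [IsProbabilityMeasure ρ] {f : ℕ → α → ℝ}
    {g : α → ℝ} (hf : ∀ n, Measurable (f n)) (hg : Measurable g)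
    (h : TendstoInMeasure ρ f atTop g) {p : ℝ≥0∞} (hp : 2 < p) (hp' : p ≠ ∞) {C : ℝ≥0∞}
    (hC : C ≠ ∞) (hb : ∀ᶠ n in atTop, eLpNorm (f n) p ρ ≤ C) :
    MemLp g 2 ρ ∧ Tendsto (fun n => eLpNorm (f n - g) 2 ρ) atTop (𝓝 0) := by
  have hgp : eLpNorm g p ρ ≤ C := by
    obtain ⟨N, hN⟩ := eventually_atTop.1 hb
    have h' : TendstoInMeasure ρ (fun n => f (n + N)) atTop g := fun ε hε =>
      (h ε hε).comp (tendsto_add_atTop_nat N)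
    exact eLpNorm_le_of_tendstoInMeasure (Eventually.of_forall fun n => hN _ (by omega)) h'
      fun n => (hf _).aestronglyMeasurable
  have hgL : MemLp g p ρ := ⟨hg.aestronglyMeasurable, hgp.trans_lt hC.lt_top⟩
  refine ⟨hgL.mono_exponent hp.le, ENNReal.tendsto_nhds_zero.2 fun ε hε => ?_⟩
  obtain ⟨δ, hδ0, hδ⟩ := ENNReal.lt_iff_exists_nnreal_btwn.1 (ENNReal.half_pos hε.ne')
  have hδ0' : (0 : ℝ) < δ := by exact_mod_cast hδ0
  -- The Hölder exponent 1/2 - 1/p of the measure of the exceptional set, positive since p > 2.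
  set a : ℝ := 1 / (2 : ℝ≥0∞).toReal - 1 / p.toReal with ha
  have ha0 : 0 < a := by
    have h2p : 2 < p.toReal := by
      have := (ENNReal.toReal_lt_toReal ENNReal.ofNat_ne_top hp').2 hp
      simpa using this
    rw [ha, ENNReal.toReal_ofNat, sub_pos]
    exact one_div_lt_one_div_of_lt two_pos h2p
  have hs := (tendstoInMeasure_iff_norm.1 h) δ hδ0'
  have ht : Tendsto (fun n => (C + C) * ρ {x | (δ : ℝ) ≤ ‖f n x - g x‖} ^ a) atTop (𝓝 0) := by
    have h1 := ((ENNReal.continuous_rpow_const (y := a)).tendsto 0).comp hs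
    rw [ENNReal.zero_rpow_of_pos ha0] at h1
    have h2 := ENNReal.Tendsto.const_mul h1 (Or.inr (ENNReal.add_ne_top.2 ⟨hC, hC⟩))
    rwa [mul_zero] at h2
  filter_upwards [ENNReal.tendsto_nhds_zero.1 ht (ε / 2) (ENNReal.half_pos hε.ne'), hb]
    with n hn hbn
  set s := {x | (δ : ℝ) ≤ ‖f n x - g x‖} with hs_def
  have hsm : MeasurableSet s := measurableSet_le measurable_const ((hf n).sub hg).norm
  have hfg : Measurable (f n - g) := (hf n).sub hg
  have e : f n - g = s.indicator (f n - g) + sᶜ.indicator (f n - g) :=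
    (Set.indicator_self_add_compl s _).symm
  rw [e]
  refine (eLpNorm_add_le (hfg.indicator hsm).aestronglyMeasurable
    (hfg.indicator hsm.compl).aestronglyMeasurable one_le_two).trans ?_
  rw [← ENNReal.add_halves ε]
  refine add_le_add ?_ ?_
  · rw [eLpNorm_indicator_eq_eLpNorm_restrict hsm]
    refine (eLpNorm_le_eLpNorm_mul_rpow_measure_univ hp.le hfg.aestronglyMeasurable).trans
      (le_trans ?_ hn)
    rw [Measure.restrict_apply_univ]
    refine mul_le_mul_left ?_ _
    refine (eLpNorm_mono_measure _ Measure.restrict_le_self).trans ?_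
    exact (eLpNorm_sub_le (hf n).aestronglyMeasurable hg.aestronglyMeasurable
      (one_le_two.trans hp.le)).trans (add_le_add hbn hgp)
  · refine (eLpNorm_le_of_ae_bound (C := δ) (Eventually.of_forall fun x => ?_)).trans ?_
    · by_cases hx : x ∈ s
      · simp [hx]
      · rw [Set.indicator_of_mem (by exact hx)]
        exact (not_le.1 hx).le
    · simpa using hδ.le

/-- Random variables whose truncations have bounded variances are square integrable, and the
variances of the truncations converge. -/
theorem memLp_two_of_variance_clamp_le [IsProbabilityMeasure ρ] {F : α → ℝ} (hF : Measurable F)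
    {C : ℝ} (hC : ∀ n : ℕ, variance (fun x => clamp n (F x)) ρ ≤ C) : MemLp F 2 ρ := by
  have hm : ∀ n : ℕ, Measurable fun x => clamp n (F x) := fun n => (measurable_clamp n).comp hF
  have hL : ∀ n : ℕ, MemLp (fun x => clamp n (F x)) 2 ρ := fun n =>
    MemLp.of_bound (hm n).aestronglyMeasurable n
      (Eventually.of_forall fun x => abs_clamp_le (Nat.cast_nonneg n) _)
  -- The difference of two independent copies has second moment twice the variance, so no control of
  -- the means is needed.
  have hsym : ∀ n : ℕ, eLpNorm (fun p : α × α => clamp n (F p.1) - clamp n (F p.2)) 2 (ρ.prod ρ) ≤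
      ENNReal.ofReal (Real.sqrt (2 * C)) := by
    intro n
    have h1 := (hL n).comp_measurePreserving (measurePreserving_fst (μ := ρ) (ν := ρ))
    have h2 := (hL n).comp_measurePreserving (measurePreserving_snd (μ := ρ) (ν := ρ))
    have h3 := h1.sub h2
    have e := integral_sq_eq_eLpNorm h3
    have e1 : ∫ p : α × α, clamp n (F p.1) ^ 2 ∂(ρ.prod ρ) = ∫ x, clamp n (F x) ^ 2 ∂ρ := by
      rw [integral_fun_fst (fun x => clamp n (F x) ^ 2)]; simp
    have e2 : ∫ p : α × α, clamp n (F p.2) ^ 2 ∂(ρ.prod ρ) = ∫ x, clamp n (F x) ^ 2 ∂ρ := by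
      rw [integral_fun_snd (fun x => clamp n (F x) ^ 2)]; simp
    have e3 := integral_prod_mul (μ := ρ) (ν := ρ) (fun x => clamp n (F x)) fun x => clamp n (F x)
    have e4 : ∫ p : α × α, (((fun x => clamp n (F x)) ∘ Prod.fst -
        (fun x => clamp n (F x)) ∘ Prod.snd : α × α → ℝ) p) ^ 2 ∂(ρ.prod ρ) = 2 * variance (fun x => clamp n (F x)) ρ := by
      have hi12 : Integrable (fun p : α × α => clamp n (F p.1) * clamp n (F p.2)) (ρ.prod ρ) :=
        h1.integrable_mul h2
      have hi1 : Integrable (fun p : α × α => clamp n (F p.1) ^ 2) (ρ.prod ρ) := h1.integrable_sq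
      have hi2 : Integrable (fun p : α × α => clamp n (F p.2) ^ 2) (ρ.prod ρ) := h2.integrable_sq
      have hi3 : Integrable (fun p : α × α => clamp n (F p.1) ^ 2 + clamp n (F p.2) ^ 2)
        (ρ.prod ρ) := hi1.add hi2
      have : ∀ p : α × α, (((fun x => clamp n (F x)) ∘ Prod.fst -
          (fun x => clamp n (F x)) ∘ Prod.snd : α × α → ℝ) p) ^ 2 = (clamp n (F p.1) ^ 2 + clamp n (F p.2) ^ 2) -
            2 * (clamp n (F p.1) * clamp n (F p.2)) := fun p => by
        simp only [Pi.sub_apply, Function.comp]; ring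
      simp_rw [this]
      rw [integral_sub hi3 (hi12.const_mul 2), integral_add hi1 hi2, integral_const_mul,
        e1, e2, e3, variance_eq_sub (hL n)]
      simp only [Pi.pow_apply]
      ring
    rw [e4] at e
    refine ENNReal.le_ofReal_iff_toReal_le h3.2.ne (Real.sqrt_nonneg _) |>.2 ?_
    refine Real.le_sqrt_of_sq_le ?_
    rw [← e]
    linarith [hC n]
  have hlim : eLpNorm (fun p : α × α => F p.1 - F p.2) 2 (ρ.prod ρ) ≤
      ENNReal.ofReal (Real.sqrt (2 * C)) := by
    refine Lp.eLpNorm_le_of_ae_tendsto (u := atTop) (Eventually.of_forall hsym) ?_ ?_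
    · exact fun n => (((hm n).comp measurable_fst).sub
        ((hm n).comp measurable_snd)).aestronglyMeasurable
    · exact Eventually.of_forall fun p => (tendsto_clamp _).sub (tendsto_clamp _)
  have hFF : MemLp (fun p : α × α => F p.1 - F p.2) 2 (ρ.prod ρ) :=
    ⟨((hF.comp measurable_fst).sub (hF.comp measurable_snd)).aestronglyMeasurable,
      hlim.trans_lt ENNReal.ofReal_lt_top⟩
  -- After Fatou on the product space, Fubini freezes one copy at some y: F - F y is square
  -- integrable, and F y is a constant.
  have hae := hFF.integrable_sq.prod_left_ae
  obtain ⟨y, hy⟩ := hae.exists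
  have hy2 : MemLp (fun x => F x - F y) 2 ρ :=
    (memLp_two_iff_integrable_sq (hF.sub_const _).aestronglyMeasurable).2 hy
  have := hy2.add (memLp_const (F y))
  convert this using 1
  ext x
  simp

theorem tendsto_variance_clamp [IsProbabilityMeasure ρ] {F : α → ℝ} (hFm : Measurable F)
    (hF : MemLp F 2 ρ) :
    Tendsto (fun n : ℕ => variance (fun x => clamp n (F x)) ρ) atTop (𝓝 (variance F ρ)) := by
  have hm : ∀ n : ℕ, Measurable fun x => clamp n (F x) := fun n => (measurable_clamp n).comp hFm
  have hL : ∀ n : ℕ, MemLp (fun x => clamp n (F x)) 2 ρ := fun n =>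
    hF.mono (hm n).aestronglyMeasurable
      (Eventually.of_forall fun x => abs_clamp_le_abs (Nat.cast_nonneg n) _)
  have h1 : Tendsto (fun n : ℕ => ∫ x, clamp n (F x) ∂ρ) atTop (𝓝 (∫ x, F x ∂ρ)) :=
    tendsto_integral_of_dominated_convergence (fun x => |F x|)
      (fun n => (hm n).aestronglyMeasurable) (hF.integrable one_le_two).abs
      (fun n => Eventually.of_forall fun x => abs_clamp_le_abs (Nat.cast_nonneg n) _)
      (Eventually.of_forall fun x => tendsto_clamp _)
  have h2 : Tendsto (fun n : ℕ => ∫ x, clamp n (F x) ^ 2 ∂ρ) atTop (𝓝 (∫ x, F x ^ 2 ∂ρ)) := by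
    refine tendsto_integral_of_dominated_convergence (fun x => F x ^ 2)
      (fun n => ((hm n).pow_const 2).aestronglyMeasurable) hF.integrable_sq
      (fun n => Eventually.of_forall fun x => ?_)
      (Eventually.of_forall fun x => (tendsto_clamp _).pow 2)
    rw [Real.norm_eq_abs, abs_pow, ← sq_abs (F x)]
    exact pow_le_pow_left₀ (abs_nonneg _) (abs_clamp_le_abs (Nat.cast_nonneg n) _) 2
  rw [variance_eq_sub hF]
  exact (h2.sub (h1.pow 2)).congr fun n => (variance_eq_sub (hL n)).symm

end MeanSquare

/-! ### The add-one cost at the origin -/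

section Cost

variable {d : ℕ}

theorem measurable_addOneCost (B : ℕ ≃ (Fin d → ℤ)) {f : Finset (MarkedEdge d) → ℝ}
    (hf : Measurable f) :
    Measurable fun q : Pt d × Finset (Pt d) => addOneCost B f q.1 q.2 := by
  simp_rw [addOneCost_eq]
  exact (measurable_vertexCost hf).comp (measurable_fst.fst.prodMk
    ((measurable_graph B).comp measurable_addPt))

theorem measurable_addOneCost_mark (B : ℕ ≃ (Fin d → ℤ)) {f : Finset (MarkedEdge d) → ℝ}
    (hf : Measurable f) (x : Fin d → ℝ) (t : I) :
    Measurable fun p : Marks × Finset (Pt d) => addOneCost B f (x, t, p.1) p.2 := by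
  simp_rw [addOneCost_eq]
  exact (measurable_vertexCost hf).comp (measurable_const.prodMk
    ((measurable_graph B).comp (measurable_addIf_root true x t)))

variable {Ω : Type*} [MeasurableSpace Ω] {P : Measure Ω} [IsProbabilityMeasure P]
  {lam : ℝ} {η : Ω → Config (Pt d)} {B : ℕ ≃ (Fin d → ℤ)} {f : Finset (MarkedEdge d) → ℝ}

/-- The add-one cost of a point at the origin born at time `t`, in the cube `W`. -/
def originCost (B : ℕ ≃ (Fin d → ℤ)) (η : Ω → Config (Pt d)) (f : Finset (MarkedEdge d) → ℝ)
    (t : I) (W : Cube d) (z : Ω × Marks) : ℝ :=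
  addOneCost B f (0, t, z.2) ((η z.1).inCube W)

theorem measurable_originCost (hη : IsPoissonProcess P η (intensity d lam)) (hf : Measurable f)
    (t : I) (W : Cube d) : Measurable (originCost B η f t W) := by
  have h := (measurable_addOneCost_mark B hf 0 t).comp (hη.measurePreserving_inCube W).measurable
  exact h

/-- The joint law of the add-one costs in a cube and in a saturated smaller cube does not depend on
the birth time. -/
theorem identDistrib_originCost (hη : IsPoissonProcess P η (intensity d lam)) (hf : Measurable f)
    {A W : Cube d} (hAW : A.toSet ⊆ W.toSet) (h0 : (0 : Fin d → ℝ) ∈ A.toSet)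
    (hsat : ∀ p ∈ W.toSet, ∀ q ∈ A.toSet, cell p = cell q → p ∈ A.toSet) (t t' : I) :
    IdentDistrib (fun z => (originCost B η f t A z, originCost B η f t W z))
      (fun z => (originCost B η f t' A z, originCost B η f t' W z))
      (P.prod marksMeasure) (P.prod marksMeasure) := by
  classical
  have hm : ∀ t, Measurable fun z => (originCost B η f t A z, originCost B η f t W z) := fun t =>
    (measurable_originCost hη hf t A).prodMk (measurable_originCost hη hf t W)
  refine ⟨(hm t).aemeasurable, (hm t').aemeasurable, Measure.ext fun S hS => ?_⟩
  have hc : Measurable fun G : Finset (MarkedEdge d) => vertexCost f 0 G :=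
    (measurable_vertexCost hf).comp (measurable_const.prodMk measurable_id)
  have hψ : Measurable (S.indicator (1 : ℝ × ℝ → ℝ≥0∞)) := measurable_one.indicator hS
  have hΦ : Measurable fun G : Finset (MarkedEdge d) × Finset (MarkedEdge d) =>
      S.indicator (1 : ℝ × ℝ → ℝ≥0∞) (vertexCost f 0 G.1, vertexCost f 0 G.2) :=
    hψ.comp ((hc.comp measurable_fst).prodMk (hc.comp measurable_snd))
  have key : ∀ t, (P.prod marksMeasure).map
      (fun z => (originCost B η f t A z, originCost B η f t W z)) S =
      ∫⁻ p, S.indicator (1 : ℝ × ℝ → ℝ≥0∞)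
        (vertexCost f 0 (graph B (addPt (0, t, p.1) (p.2.filter fun q => q.1 ∈ A.toSet))),
          vertexCost f 0 (graph B (addPt (0, t, p.1) p.2)))
        ∂(marksMeasure.prod (windowLaw P η W)) := by
    intro t
    have hfil : Measurable fun ξ : Finset (Pt d) => ξ.filter fun q => q.1 ∈ A.toSet :=
      measurable_filter (measurable_fst A.measurableSet_toSet)
    have hadd := measurable_addIf_root true (0 : Fin d → ℝ) t
    have hmeas : Measurable fun p : Marks × Finset (Pt d) => S.indicator (1 : ℝ × ℝ → ℝ≥0∞)
        (vertexCost f 0 (graph B (addPt (0, t, p.1) (p.2.filter fun q => q.1 ∈ A.toSet))),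
          vertexCost f 0 (graph B (addPt (0, t, p.1) p.2))) :=
      hΦ.comp (((measurable_graph B).comp (hadd.comp (measurable_fst.prodMk
        (hfil.comp measurable_snd)))).prodMk ((measurable_graph B).comp hadd))
    rw [← (hη.measurePreserving_inCube W).lintegral_comp hmeas, ← lintegral_indicator_one hS,
      lintegral_map hψ (hm t)]
    refine lintegral_congr fun z => ?_
    simp only [originCost, addOneCost_eq, inCube_filter hAW]
  rw [key t, key t']
  exact lintegral_graph_window B W.measurableSet_toSet W.volume_ne_top
    (hη.isPoissonLaw_windowLaw W) A.measurableSet_toSet h0 hsat t t' hΦ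

theorem identDistrib_originCost_self (hη : IsPoissonProcess P η (intensity d lam))
    (hf : Measurable f) {W : Cube d} (h0 : (0 : Fin d → ℝ) ∈ W.toSet) (t t' : I) :
    IdentDistrib (originCost B η f t W) (originCost B η f t' W)
      (P.prod marksMeasure) (P.prod marksMeasure) :=
  (identDistrib_originCost (A := W) hη hf subset_rfl h0 (fun _ hp _ _ _ => hp) t t').comp
    measurable_fst

/-- The moment condition speaks of birth time 1 only. It extends to all birth times because the law
of the cost is the same for each of them. -/
theorem MomentCondition.exists_bound (hmom : MomentCondition P B η f)
    (hη : IsPoissonProcess P η (intensity d lam)) (hf : Measurable f) :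
    ∃ p C : ℝ≥0∞, 2 < p ∧ p ≠ ∞ ∧ C ≠ ∞ ∧ ∀ W : Cube d, (0 : Fin d → ℝ) ∈ W.toSet → ∀ t : I,
      eLpNorm (originCost B η f t W) p (P.prod marksMeasure) ≤ C := by
  obtain ⟨p, hp, hS⟩ := hmom
  have hp0 : 0 < p := by linarith
  refine ⟨ENNReal.ofReal p, _, ?_, ENNReal.ofReal_ne_top,
    (ENNReal.rpow_lt_top_of_nonneg (inv_nonneg.2 hp0.le) hS.ne).ne, fun W h0 t => ?_⟩
  · rw [← ENNReal.ofReal_ofNat 2]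
    exact (ENNReal.ofReal_lt_ofReal_iff hp0).2 hp
  · rw [(identDistrib_originCost_self (B := B) hη hf h0 t 1).eLpNorm_eq,
      eLpNorm_eq_lintegral_rpow_enorm_toReal (by simpa using hp0) ENNReal.ofReal_ne_top,
      ENNReal.toReal_ofReal hp0.le, one_div]
    refine ENNReal.rpow_le_rpow ?_ (inv_nonneg.2 hp0.le)
    exact le_iSup₂ (f := fun (W : Cube d) (_ : (0 : Fin d → ℝ) ∈ W.toSet) =>
      ∫⁻ z, ‖addOneCost B f (0, 1, z.2) ((η z.1).inCube W)‖ₑ ^ p ∂(P.prod marksMeasure)) W h0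

theorem zero_mem_of_closedBall_subset {W : Cube d} {r : ℝ} (hr : 0 ≤ r)
    (h : Metric.closedBall (0 : Fin d → ℝ) r ⊆ W.toSet) : (0 : Fin d → ℝ) ∈ W.toSet :=
  h (Metric.mem_closedBall_self hr)

theorem TendsToSpace.eventually_zero_mem {W : ℕ → Cube d} (hW : TendsToSpace W) :
    ∀ᶠ n in atTop, (0 : Fin d → ℝ) ∈ (W n).toSet :=
  (hW 0).mono fun _ h => zero_mem_of_closedBall_subset le_rfl h

/-- The cube `[-N-1, N+1)^d`. -/
def centeredCube (d N : ℕ) : Cube d :=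
  ⟨fun _ => -((N : ℝ) + 1), 2 * ((N : ℝ) + 1), by positivity⟩

theorem mem_centeredCube {N : ℕ} {x : Fin d → ℝ} :
    x ∈ (centeredCube d N).toSet ↔ ∀ i, -((N : ℝ) + 1) ≤ x i ∧ x i < (N : ℝ) + 1 := by
  simp only [Cube.toSet, centeredCube, Set.mem_pi, Set.mem_univ, true_imp_iff, Set.mem_Ico]
  refine forall_congr' fun i => and_congr_right fun _ => ?_
  rw [show -((N : ℝ) + 1) + 2 * ((N : ℝ) + 1) = (N : ℝ) + 1 by ring]

theorem closedBall_subset_centeredCube {N : ℕ} {r : ℝ} (h : r ≤ N) :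
    Metric.closedBall (0 : Fin d → ℝ) r ⊆ (centeredCube d N).toSet := by
  intro x hx
  rw [mem_closedBall_zero_iff] at hx
  refine mem_centeredCube.2 fun i => ?_
  have := (norm_le_pi_norm x i).trans hx
  rw [Real.norm_eq_abs, abs_le] at this
  constructor <;> linarith [this.1, this.2]

theorem centeredCube_subset_closedBall (N : ℕ) :
    (centeredCube d N).toSet ⊆ Metric.closedBall (0 : Fin d → ℝ) (N + 1) := by
  intro x hx
  rw [mem_closedBall_zero_iff, pi_norm_le_iff_of_nonneg (by positivity)]
  intro i
  have := mem_centeredCube.1 hx i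
  rw [Real.norm_eq_abs, abs_le]
  exact ⟨this.1, this.2.le⟩

theorem zero_mem_centeredCube (N : ℕ) : (0 : Fin d → ℝ) ∈ (centeredCube d N).toSet :=
  closedBall_subset_centeredCube (Nat.cast_nonneg N) (Metric.mem_closedBall_self le_rfl)

theorem tendsToSpace_centeredCube : TendsToSpace (centeredCube d) := fun r => by
  filter_upwards [(tendsto_natCast_atTop_atTop (R := ℝ)).eventually_ge_atTop r] with N hN
  exact closedBall_subset_centeredCube hN

/-- The faces of these cubes lie on the integer lattice, so they are unions of unit cells. This
saturation is what the comparison with larger cubes requires. -/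
theorem centeredCube_saturated (N : ℕ) {p q : Fin d → ℝ} (hq : q ∈ (centeredCube d N).toSet)
    (hpq : cell p = cell q) : p ∈ (centeredCube d N).toSet := by
  rw [mem_centeredCube] at hq ⊢
  intro i
  have h : ⌊p i⌋ = ⌊q i⌋ := congrFun hpq i
  have h1 : -((N : ℤ) + 1) ≤ ⌊q i⌋ := Int.le_floor.2 (by push_cast; exact (hq i).1)
  have h2 : ⌊q i⌋ < (N : ℤ) + 1 := Int.floor_lt.2 (by push_cast; exact (hq i).2)
  rw [← h] at h1 h2
  have h3 := Int.le_floor.1 h1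
  have h4 := Int.floor_lt.1 h2
  push_cast at h3 h4
  exact ⟨h3, h4⟩

/-- The distance depends only on the joint law of the two costs, which is free of the birth time.
This carries the stabilization at time 1 to all times. -/
theorem eLpNorm_originCost_sub (hη : IsPoissonProcess P η (intensity d lam)) (hf : Measurable f)
    {N : ℕ} {W : Cube d} (hW : (centeredCube d N).toSet ⊆ W.toSet) (t t' : I) :
    eLpNorm (originCost B η f t (centeredCube d N) - originCost B η f t W) 2
      (P.prod marksMeasure) =
    eLpNorm (originCost B η f t' (centeredCube d N) - originCost B η f t' W) 2
      (P.prod marksMeasure) :=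
  ((identDistrib_originCost (B := B) hη hf hW (zero_mem_centeredCube N)
    (fun _ _ _ hq h => centeredCube_saturated N hq h) t t').comp
    (measurable_fst.sub measurable_snd)).eLpNorm_eq 2

theorem memLp_originCost (hη : IsPoissonProcess P η (intensity d lam)) (hf : Measurable f)
    (hmom : MomentCondition P B η f) {W : Cube d} (h0 : (0 : Fin d → ℝ) ∈ W.toSet) (t : I) :
    MemLp (originCost B η f t W) 2 (P.prod marksMeasure) := by
  obtain ⟨p, C, hp, -, hC, hb⟩ := hmom.exists_bound hη hf
  have : MemLp (originCost B η f t W) p (P.prod marksMeasure) :=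
    ⟨(measurable_originCost hη hf t W).aestronglyMeasurable, (hb W h0 t).trans_lt hC.lt_top⟩
  exact this.mono_exponent hp.le

theorem exists_secondMoment_bound (hη : IsPoissonProcess P η (intensity d lam)) (hf : Measurable f)
    (hmom : MomentCondition P B η f) :
    ∃ C : ℝ, 0 ≤ C ∧ ∀ W : Cube d, (0 : Fin d → ℝ) ∈ W.toSet → ∀ t : I,
      ∫ z, originCost B η f t W z ^ 2 ∂(P.prod marksMeasure) ≤ C := by
  obtain ⟨p, C, hp, -, hC, hb⟩ := hmom.exists_bound hη hf
  refine ⟨C.toReal ^ 2, by positivity, fun W h0 t => ?_⟩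
  rw [integral_sq_eq_eLpNorm (memLp_originCost hη hf hmom h0 t)]
  refine pow_le_pow_left₀ ENNReal.toReal_nonneg (ENNReal.toReal_mono hC ?_) 2
  exact (eLpNorm_le_eLpNorm_of_exponent_le hp.le
    (measurable_originCost hη hf t W).aestronglyMeasurable).trans (hb W h0 t)

/-- The convergence of the add-one cost holds in mean square. -/
theorem IsLimitAddOneCost.tendsto_eLpNorm (hη : IsPoissonProcess P η (intensity d lam))
    (hf : Measurable f) (hmom : MomentCondition P B η f) {t : I} {Δ : Ω × Marks → ℝ}
    (hΔ : IsLimitAddOneCost P B η f t Δ) {W : ℕ → Cube d} (hW : TendsToSpace W) :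
    MemLp Δ 2 (P.prod marksMeasure) ∧
      Tendsto (fun n => eLpNorm (originCost B η f t (W n) - Δ) 2 (P.prod marksMeasure)) atTop
        (𝓝 0) := by
  obtain ⟨p, C, hp, hp', hC, hb⟩ := hmom.exists_bound hη hf
  exact tendsto_eLpNorm_two_of_tendstoInMeasure (fun n => measurable_originCost hη hf t (W n))
    hΔ.1 (hΔ.2 W hW) hp hp' hC (hW.eventually_zero_mem.mono fun n h0 => hb _ h0 t)

/-- Convergence along every sequence of cubes is uniform over cubes containing a large ball:
otherwise one bad cube for each radius would form a sequence tending to the whole space. -/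
theorem IsLimitAddOneCost.exists_radius (hη : IsPoissonProcess P η (intensity d lam))
    (hf : Measurable f) (hmom : MomentCondition P B η f) {t : I} {Δ : Ω × Marks → ℝ}
    (hΔ : IsLimitAddOneCost P B η f t Δ) {ε : ℝ≥0∞} (hε : 0 < ε) :
    ∃ r : ℕ, ∀ W : Cube d, Metric.closedBall (0 : Fin d → ℝ) r ⊆ W.toSet →
      eLpNorm (originCost B η f t W - Δ) 2 (P.prod marksMeasure) ≤ ε := by
  by_contra! h
  choose W hW hlt using h
  have hT : TendsToSpace W := fun r => by
    filter_upwards [(tendsto_natCast_atTop_atTop (R := ℝ)).eventually_ge_atTop r] with N hN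
    exact (Metric.closedBall_subset_closedBall hN).trans (hW N)
  obtain ⟨n, hn⟩ := (ENNReal.tendsto_nhds_zero.1
    (hΔ.tendsto_eLpNorm hη hf hmom hT).2 ε hε).exists
  exact absurd hn (not_le.2 (hlt n))

/-- The distance in mean square of the costs in large cubes is small, whatever the birth time. -/
theorem exists_radius_originCost_sub (hη : IsPoissonProcess P η (intensity d lam))
    (hf : Measurable f) (hmom : MomentCondition P B η f)
    (hex : ∃ Δ, IsLimitAddOneCost P B η f 1 Δ) {ε : ℝ≥0∞} (hε : 0 < ε) :
    ∃ r : ℕ, ∀ N, r ≤ N → ∀ W : Cube d, (centeredCube d N).toSet ⊆ W.toSet → ∀ t : I,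
      eLpNorm (originCost B η f t (centeredCube d N) - originCost B η f t W) 2
        (P.prod marksMeasure) ≤ ε := by
  obtain ⟨Δ, hΔ⟩ := hex
  obtain ⟨r, hr⟩ := hΔ.exists_radius hη hf hmom (ENNReal.half_pos hε.ne')
  refine ⟨r, fun N hN W hW t => ?_⟩
  rw [eLpNorm_originCost_sub hη hf hW t 1]
  have hb : Metric.closedBall (0 : Fin d → ℝ) r ⊆ (centeredCube d N).toSet :=
    closedBall_subset_centeredCube (by exact_mod_cast hN)
  have hm := fun W => (measurable_originCost (B := B) hη hf 1 W).aestronglyMeasurable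
    (μ := P.prod marksMeasure)
  have e : originCost B η f 1 (centeredCube d N) - originCost B η f 1 W =
      (originCost B η f 1 (centeredCube d N) - Δ) - (originCost B η f 1 W - Δ) := by abel
  rw [e, ← ENNReal.add_halves ε]
  exact (eLpNorm_sub_le ((hm _).sub hΔ.1.aestronglyMeasurable)
    ((hm _).sub hΔ.1.aestronglyMeasurable) one_le_two).trans
      (add_le_add (hr _ hb) (hr _ (hb.trans hW)))

/-- The costs in the centered cubes form a Cauchy sequence in L², by comparison with time 1. A
general sequence of cubes is compared with one centered cube that it eventually contains. -/
theorem exists_isLimitAddOneCost (hη : IsPoissonProcess P η (intensity d lam))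
    (hf : Measurable f) (hmom : MomentCondition P B η f)
    (hex : ∃ Δ, IsLimitAddOneCost P B η f 1 Δ) (t : I) :
    ∃ Δ : Ω × Marks → ℝ, IsLimitAddOneCost P B η f t Δ := by
  have hmono : ∀ M N : ℕ, M ≤ N → (centeredCube d M).toSet ⊆ (centeredCube d N).toSet := by
    intro M N h x hx
    have h' : (M : ℝ) ≤ N := by exact_mod_cast h
    refine mem_centeredCube.2 fun i => ?_
    have := mem_centeredCube.1 hx i
    constructor <;> linarith [this.1, this.2]
  have hm := fun W => (measurable_originCost (B := B) hη hf t W).aestronglyMeasurable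
    (μ := P.prod marksMeasure)
  obtain ⟨Δ, hΔm, hΔ2, hΔ⟩ := exists_tendsto_eLpNorm_two
    (f := fun N => originCost B η f t (centeredCube d N))
    (fun N => memLp_originCost hη hf hmom (zero_mem_centeredCube N) t) (fun ε hε => by
      obtain ⟨r, hr⟩ := exists_radius_originCost_sub hη hf hmom hex hε
      refine ⟨r, fun m hm n hn => ?_⟩
      rcases le_total m n with h | h
      · exact hr m hm _ (hmono m n h) t
      · rw [eLpNorm_sub_comm]
        exact hr n hn _ (hmono n m h) t)
  refine ⟨Δ, hΔm, fun W hW => ?_⟩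
  refine tendstoInMeasure_of_tendsto_eLpNorm (p := 2) two_ne_zero (fun n => hm (W n))
    hΔm.aestronglyMeasurable (ENNReal.tendsto_nhds_zero.2 fun ε hε => ?_)
  obtain ⟨r, hr⟩ := exists_radius_originCost_sub hη hf hmom hex (ENNReal.half_pos hε.ne')
  obtain ⟨N, hN, hrN⟩ := ((ENNReal.tendsto_nhds_zero.1 hΔ _ (ENNReal.half_pos hε.ne')).and
    (eventually_ge_atTop r)).exists
  filter_upwards [hW (N + 1)] with n hn
  have e : originCost B η f t (W n) - Δ = (originCost B η f t (centeredCube d N) - Δ) -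
      (originCost B η f t (centeredCube d N) - originCost B η f t (W n)) := by abel
  change eLpNorm (originCost B η f t (W n) - Δ) 2 _ ≤ ε
  rw [e, ← ENNReal.add_halves ε]
  exact (eLpNorm_sub_le ((hm _).sub hΔm.aestronglyMeasurable) ((hm _).sub (hm _))
    one_le_two).trans (add_le_add hN (hr N hrN _ ((centeredCube_subset_closedBall N).trans hn) t))

end Cost

/-! ### The covariance of the costs before and after resampling the future -/

section CostCov

variable {d : ℕ} {Ω : Type*} [MeasurableSpace Ω] {P : Measure Ω} [IsProbabilityMeasure P]
  {lam : ℝ} {η : Ω → Config (Pt d)} {B : ℕ ≃ (Fin d → ℤ)} {f : Finset (MarkedEdge d) → ℝ}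

/-- The joint law of a mark sequence and of two independent copies of the process in a cube. -/
abbrev doubleLaw (P : Measure Ω) (η : Ω → Config (Pt d)) (W : Cube d) :
    Measure (Marks × Finset (Pt d) × Finset (Pt d)) :=
  marksMeasure.prod ((windowLaw P η W).prod (windowLaw P η W))

/-- The costs of a point for the process in a cube, and for the process with resampled future. -/
def costPair (B : ℕ ≃ (Fin d → ℤ)) (f : Finset (MarkedEdge d) → ℝ) (x : Fin d → ℝ) (t : I)
    (p : Marks × Finset (Pt d) × Finset (Pt d)) : ℝ × ℝ :=
  (addOneCost B f (x, t, p.1) p.2.1,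
    addOneCost B f (x, t, p.1) (mix (fun q : Pt d => q.2.1) t p.2.1 p.2.2))

/-- The mixed moment of the costs of a point for the process in a cube, and for the process with
resampled future. -/
def costCov (P : Measure Ω) (B : ℕ ≃ (Fin d → ℤ)) (η : Ω → Config (Pt d))
    (f : Finset (MarkedEdge d) → ℝ) (W : Cube d) (x : Fin d → ℝ) (t : I) : ℝ :=
  ∫ p, (costPair B f x t p).1 * (costPair B f x t p).2 ∂(doubleLaw P η W)

theorem measurable_costPair_uncurry (hf : Measurable f) :
    Measurable fun q : ((Fin d → ℝ) × I) × Marks × Finset (Pt d) × Finset (Pt d) =>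
      costPair B f q.1.1 q.1.2 q.2 := by
  have h0 : Measurable fun q : ((Fin d → ℝ) × I) × Marks × Finset (Pt d) × Finset (Pt d) =>
      ((q.1.1, q.1.2, q.2.1) : Pt d) :=
    measurable_fst.fst.prodMk (measurable_fst.snd.prodMk measurable_snd.fst)
  have hmix : Measurable fun q : ((Fin d → ℝ) × I) × Marks × Finset (Pt d) × Finset (Pt d) =>
      mix (fun q : Pt d => q.2.1) q.1.2 q.2.2.1 q.2.2.2 :=
    (measurable_mix measurable_snd.fst).comp (measurable_fst.snd.prodMk measurable_snd.snd)
  have h1 := (measurable_addOneCost B hf).comp (h0.prodMk measurable_snd.snd.fst)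
  have h2 := (measurable_addOneCost B hf).comp (h0.prodMk hmix)
  exact h1.prodMk h2

theorem measurable_costPair (hf : Measurable f) (x : Fin d → ℝ) (t : I) :
    Measurable (costPair B f x t) := by
  have h : Measurable fun p : Marks × Finset (Pt d) × Finset (Pt d) => ((x, t), p) :=
    measurable_const.prodMk measurable_id
  have h1 := (measurable_costPair_uncurry (B := B) hf).comp h
  exact h1

theorem measurable_costCov (hη : IsPoissonProcess P η (intensity d lam)) (hf : Measurable f)
    (W : Cube d) : Measurable fun q : (Fin d → ℝ) × I => costCov P B η f W q.1 q.2 := by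
  have := hη.isProbabilityMeasure_windowLaw W
  have h := measurable_costPair_uncurry (B := B) hf
  exact ((h.fst.mul h.snd).stronglyMeasurable.integral_prod_right'
    (ν := doubleLaw P η W)).measurable

theorem memLp_addOneCost_of_originCost (hη : IsPoissonProcess P η (intensity d lam))
    (hf : Measurable f) {W : Cube d} {t : I}
    (h : MemLp (originCost B η f t W) 2 (P.prod marksMeasure)) :
    MemLp (fun p : Marks × Finset (Pt d) => addOneCost B f (0, t, p.1) p.2) 2
      (marksMeasure.prod (windowLaw P η W)) := by
  have hmp := hη.measurePreserving_inCube W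
  rw [← hmp.map_eq, memLp_map_measure_iff
    (measurable_addOneCost_mark B hf 0 t).aestronglyMeasurable hmp.measurable.aemeasurable]
  exact h

/-- The link between the covariance identity, which produces resampled futures, and the conditional
expectations in the limiting variance. -/
theorem integral_condExp_originCost_sq (hη : IsPoissonProcess P η (intensity d lam))
    (hf : Measurable f) (hmom : MomentCondition P B η f) {W : Cube d}
    (h0 : (0 : Fin d → ℝ) ∈ W.toSet) (t : I) :
    ∫ z, (condExp (sigmaBefore η t) (P.prod marksMeasure) (originCost B η f t W) z) ^ 2
      ∂(P.prod marksMeasure) = costCov P B η f W 0 t :=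
  hη.integral_condExp_before_sq W t (measurable_addOneCost_mark B hf 0 t)
    (memLp_addOneCost_of_originCost hη hf (memLp_originCost hη hf hmom h0 t))

theorem costCov_le (hη : IsPoissonProcess P η (intensity d lam))
    (hf : Measurable f) (hmom : MomentCondition P B η f) {C : ℝ}
    (hC : ∀ W : Cube d, (0 : Fin d → ℝ) ∈ W.toSet → ∀ t : I,
      ∫ z, originCost B η f t W z ^ 2 ∂(P.prod marksMeasure) ≤ C) {W : Cube d}
    (h0 : (0 : Fin d → ℝ) ∈ W.toSet) (t : I) : costCov P B η f W 0 t ≤ C := by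
  have hD := memLp_originCost hη hf hmom h0 t
  rw [← integral_condExp_originCost_sq hη hf hmom h0 t]
  refine le_trans ?_ (hC W h0 t)
  rw [integral_sq_eq_eLpNorm (hD.condExp one_le_two), integral_sq_eq_eLpNorm hD]
  exact pow_le_pow_left₀ ENNReal.toReal_nonneg
    (ENNReal.toReal_mono hD.2.ne (eLpNorm_condExp_le_eLpNorm _ one_le_two)) 2

/-- The costs converge in mean square, conditional expectation is a contraction of L², and second
moments are continuous there. -/
theorem tendsto_costCov (hη : IsPoissonProcess P η (intensity d lam)) (hf : Measurable f)
    (hmom : MomentCondition P B η f) {Δ : I → Ω × Marks → ℝ} {t : I}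
    (hΔ : IsLimitAddOneCost P B η f t (Δ t)) {W : ℕ → Cube d} (hW : TendsToSpace W) :
    Tendsto (fun n => costCov P B η f (W n) 0 t) atTop (𝓝 (condSecondMoment P η Δ t)) := by
  obtain ⟨N, hN⟩ := eventually_atTop.1 hW.eventually_zero_mem
  rw [← tendsto_add_atTop_iff_nat N]
  have h0 : ∀ n, (0 : Fin d → ℝ) ∈ (W (n + N)).toSet := fun n => hN _ (by omega)
  obtain ⟨hΔ2, hlim⟩ := hΔ.tendsto_eLpNorm hη hf hmom hW
  have hD := fun n => memLp_originCost hη hf hmom (h0 n) t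
  refine (tendsto_integral_sq_of_tendsto_eLpNorm
    (f := fun n => condExp (sigmaBefore η t) (P.prod marksMeasure) (originCost B η f t (W (n + N))))
    (fun n => (hD n).condExp one_le_two) (hΔ2.condExp one_le_two) ?_).congr
    fun n => integral_condExp_originCost_sq hη hf hmom (h0 n) t
  refine tendsto_of_tendsto_of_tendsto_of_le_of_le tendsto_const_nhds
    ((tendsto_add_atTop_iff_nat N).2 hlim) (fun _ => bot_le) fun n => ?_
  refine le_trans (le_of_eq (eLpNorm_congr_ae ?_))
    (eLpNorm_condExp_le_eLpNorm (m := sigmaBefore η t) (originCost B η f t (W (n + N)) - Δ t)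
      one_le_two)
  exact (condExp_sub ((hD n).integrable one_le_two) (hΔ2.integrable one_le_two) _).symm

theorem condSecondMoment_nonneg (Δ : I → Ω × Marks → ℝ) (t : I) : 0 ≤ condSecondMoment P η Δ t :=
  integral_nonneg fun _ => sq_nonneg _

/-- Measurability in t is not visible from the pointwise choice of Δ_t. It comes from the jointly
measurable `costCov`, of which this is the pointwise limit along the centered cubes. -/
theorem integrable_condSecondMoment (hη : IsPoissonProcess P η (intensity d lam))
    (hf : Measurable f) (hmom : MomentCondition P B η f) {Δ : I → Ω × Marks → ℝ}
    (hΔ : ∀ t, IsLimitAddOneCost P B η f t (Δ t)) :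
    Integrable (condSecondMoment P η Δ) (volume : Measure I) := by
  obtain ⟨C, -, hC⟩ := exists_secondMoment_bound hη hf hmom
  have hlim := fun t => tendsto_costCov hη hf hmom (hΔ t) (tendsToSpace_centeredCube (d := d))
  have hm : Measurable (condSecondMoment P η Δ) :=
    measurable_of_tendsto_metrizable (fun N => (measurable_costCov hη hf (centeredCube d N)).comp
      ((measurable_const (a := (0 : Fin d → ℝ))).prodMk measurable_id)) (tendsto_pi_nhds.2 hlim)
  refine Integrable.of_bound hm.aestronglyMeasurable C (Eventually.of_forall fun t => ?_)
  rw [Real.norm_of_nonneg (condSecondMoment_nonneg Δ t)]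
  exact le_of_tendsto' (hlim t) fun N => costCov_le hη hf hmom hC (zero_mem_centeredCube N) t

/-- The law of the costs only depends on the position of the point relative to the cube. -/
theorem map_costPair_shift (hη : IsPoissonProcess P η (intensity d lam)) (hf : Measurable f)
    (hft : TranslationInvariant f) (W : Cube d) (x : Fin d → ℝ) (t : I) :
    (doubleLaw P η W).map (costPair B f x t) =
      (doubleLaw P η (W.shift x)).map (costPair B f 0 t) := by
  refine Measure.ext fun S hS => ?_
  have hψ : Measurable (S.indicator (1 : ℝ × ℝ → ℝ≥0∞)) := measurable_one.indicator hS
  have hL' := hη.isPoissonLaw_windowLaw (W.shift x)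
  rw [W.toSet_shift] at hL'
  rw [← lintegral_indicator_one hS, ← lintegral_indicator_one hS,
    lintegral_map hψ (measurable_costPair hf x t), lintegral_map hψ (measurable_costPair hf 0 t)]
  simp only [costPair, addOneCost_eq]
  exact lintegral_vertexCost_shift B hf hft W.measurableSet_toSet W.volume_ne_top
    (hη.isPoissonLaw_windowLaw W) x hL' t hψ

theorem costCov_shift (hη : IsPoissonProcess P η (intensity d lam)) (hf : Measurable f)
    (hft : TranslationInvariant f) (W : Cube d) (x : Fin d → ℝ) (t : I) :
    costCov P B η f W x t = costCov P B η f (W.shift x) 0 t := by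
  have hm : Measurable fun y : ℝ × ℝ => y.1 * y.2 := measurable_fst.mul measurable_snd
  rw [costCov, costCov, ← integral_map (f := fun y : ℝ × ℝ => y.1 * y.2)
      (measurable_costPair hf x t).aemeasurable hm.aestronglyMeasurable,
    ← integral_map (f := fun y : ℝ × ℝ => y.1 * y.2)
      (measurable_costPair hf 0 t).aemeasurable hm.aestronglyMeasurable,
    map_costPair_shift hη hf hft]

end CostCov

/-! ### The variance as an integral of covariances of costs -/

section BoundedVariance

theorem map_prod_regroup {A C D E : Type*} [MeasurableSpace A] [MeasurableSpace C]
    [MeasurableSpace D] [MeasurableSpace E] (μ : Measure A) (ν : Measure C) (κ : Measure D)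
    (ξ : Measure E) [SFinite μ] [SFinite ν] [SFinite κ] [SFinite ξ] :
    MeasurePreserving (fun p : (A × C) × D × E => ((p.1.1, (p.1.2, p.2.1)), p.2.2))
      ((μ.prod ν).prod (κ.prod ξ)) ((μ.prod (ν.prod κ)).prod ξ) :=
  ((measurePreserving_prodAssoc μ (ν.prod κ) ξ).symm MeasurableEquiv.prodAssoc).comp
    (((MeasurePreserving.id μ).prod
      ((measurePreserving_prodAssoc ν κ ξ).symm MeasurableEquiv.prodAssoc)).comp
      (measurePreserving_prodAssoc μ ν (κ.prod ξ)))

theorem integrable_of_abs_le {α : Type*} [MeasurableSpace α] {ρ : Measure α} [IsFiniteMeasure ρ]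
    {g : α → ℝ} (hg : Measurable g) {K : ℝ} (hK : ∀ x, |g x| ≤ K) : Integrable g ρ :=
  Integrable.of_bound hg.aestronglyMeasurable K (Eventually.of_forall hK)

/-- The covariance formula for a bounded functional of a finite Poisson process. -/
theorem variance_eq_integral_addIf {X : Type*} [MeasurableSpace X] {L : Measure (Finset X)}
    {μ : Measure X} [IsFiniteMeasure μ] (hL : IsPoissonLaw L μ) {τ : X → I} (hτ : Measurable τ)
    (hμ : NullSingletonClass (μ.map τ)) {F : Finset X → ℝ} (hF : Measurable F) {K : ℝ}
    (hK : ∀ ξ, |F ξ| ≤ K) :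
    variance F L = ∫ q : X × Finset X × Finset X,
      ((F (addIf true q.1 q.2.1) * F (addIf true q.1 (mix τ (τ q.1) q.2.1 q.2.2)) +
        F (addIf false q.1 q.2.1) * F (addIf false q.1 (mix τ (τ q.1) q.2.1 q.2.2))) -
      (F (addIf true q.1 q.2.1) * F (addIf false q.1 (mix τ (τ q.1) q.2.1 q.2.2)) +
        F (addIf false q.1 q.2.1) * F (addIf true q.1 (mix τ (τ q.1) q.2.1 q.2.2))))
      ∂(μ.prod (L.prod L)) := by
  have := hL.isProbabilityMeasure
  have hfin : ∀ a b, IsFiniteMeasure (addMixLaw L μ τ a b) := fun a b => by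
    unfold addMixLaw; infer_instance
  have hG : Measurable fun p : Finset X × Finset X => F p.1 * F p.2 :=
    (hF.comp measurable_fst).mul (hF.comp measurable_snd)
  have hGK : ∀ p : Finset X × Finset X, |F p.1 * F p.2| ≤ K * K := fun p => by
    rw [abs_mul]
    exact mul_le_mul (hK _) (hK _) (abs_nonneg _) ((abs_nonneg _).trans (hK p.1))
  have hi : ∀ (ν : Measure (Finset X × Finset X)) [IsFiniteMeasure ν],
      Integrable (fun p : Finset X × Finset X => F p.1 * F p.2) ν := fun ν _ =>
    integrable_of_abs_le hG hGK
  have h := congrArg (fun ν => ∫ p : Finset X × Finset X, F p.1 * F p.2 ∂ν)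
    (covariance_identity hL hτ hμ)
  have hdiag : Measurable fun ξ : Finset X => (ξ, ξ) := measurable_id.prodMk measurable_id
  have hfd : IsFiniteMeasure (L.map fun ξ => (ξ, ξ)) := inferInstance
  beta_reduce at h
  rw [integral_add_measure (hi _) (hi _), integral_add_measure (hi _) (hi _),
    integral_add_measure (hi _) (hi _), integral_add_measure (hi _) (hi _),
    integral_map hdiag.aemeasurable hG.aestronglyMeasurable, integral_prod_mul] at h
  have hK4 : ∀ a b, ∫ p : Finset X × Finset X, F p.1 * F p.2 ∂(addMixLaw L μ τ a b) =
      ∫ q : X × Finset X × Finset X,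
        F (addIf a q.1 q.2.1) * F (addIf b q.1 (mix τ (τ q.1) q.2.1 q.2.2))
        ∂(μ.prod (L.prod L)) := fun a b =>
    integral_map (measurable_addMix hτ a b).aemeasurable hG.aestronglyMeasurable
  have hi4 : ∀ a b, Integrable (fun q : X × Finset X × Finset X =>
        F (addIf a q.1 q.2.1) * F (addIf b q.1 (mix τ (τ q.1) q.2.1 q.2.2)))
        (μ.prod (L.prod L)) := fun a b =>
    integrable_of_abs_le (hG.comp (measurable_addMix hτ a b)) fun q => hGK (_, _)
  have hL2 : MemLp F 2 L := MemLp.of_bound hF.aestronglyMeasurable K (Eventually.of_forall hK)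
  have hs1 : Integrable (fun q : X × Finset X × Finset X =>
      F (addIf true q.1 q.2.1) * F (addIf true q.1 (mix τ (τ q.1) q.2.1 q.2.2)) +
        F (addIf false q.1 q.2.1) * F (addIf false q.1 (mix τ (τ q.1) q.2.1 q.2.2)))
        (μ.prod (L.prod L)) := (hi4 _ _).add (hi4 _ _)
  have hs2 : Integrable (fun q : X × Finset X × Finset X =>
      F (addIf true q.1 q.2.1) * F (addIf false q.1 (mix τ (τ q.1) q.2.1 q.2.2)) +
        F (addIf false q.1 q.2.1) * F (addIf true q.1 (mix τ (τ q.1) q.2.1 q.2.2)))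
        (μ.prod (L.prod L)) := (hi4 _ _).add (hi4 _ _)
  rw [variance_eq_sub hL2, integral_sub hs1 hs2, integral_add (hi4 _ _) (hi4 _ _),
    integral_add (hi4 _ _) (hi4 _ _), ← hK4, ← hK4, ← hK4, ← hK4]
  have e : ∫ ξ, (F ^ 2) ξ ∂L = ∫ ξ, F ξ * F ξ ∂L := by simp [pow_two]
  rw [e]
  linarith

variable {d : ℕ} {Ω : Type*} [MeasurableSpace Ω] {P : Measure Ω} [IsProbabilityMeasure P]
  {lam : ℝ} {η : Ω → Config (Pt d)} {B : ℕ ≃ (Fin d → ℤ)} {f : Finset (MarkedEdge d) → ℝ}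

/-- The intensity measure of the locations and birth times in a cube. -/
def placeMeasure (lam : ℝ) (W : Cube d) : Measure ((Fin d → ℝ) × I) :=
  ((ENNReal.ofReal lam • (volume : Measure (Fin d → ℝ))).restrict W.toSet).prod volume

theorem isFiniteMeasure_restrict_cube (lam : ℝ) (W : Cube d) :
    IsFiniteMeasure ((ENNReal.ofReal lam • (volume : Measure (Fin d → ℝ))).restrict W.toSet) :=
  ⟨by simpa using ENNReal.mul_lt_top ENNReal.ofReal_lt_top W.volume_ne_top.lt_top⟩

theorem isFiniteMeasure_placeMeasure (lam : ℝ) (W : Cube d) :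
    IsFiniteMeasure (placeMeasure lam W) := by
  have := isFiniteMeasure_restrict_cube lam W
  unfold placeMeasure
  infer_instance

theorem ae_placeMeasure_mem (lam : ℝ) (W : Cube d) : ∀ᵐ q ∂(placeMeasure lam W), q.1 ∈ W.toSet := by
  have := isFiniteMeasure_restrict_cube lam W
  have h : ∀ᵐ x ∂((ENNReal.ofReal lam • (volume : Measure (Fin d → ℝ))).restrict W.toSet),
      x ∈ W.toSet := ae_restrict_mem W.measurableSet_toSet
  exact Measure.quasiMeasurePreserving_fst.ae h

/-- The expected products of the values with and without the point, when the process is resampled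
after the birth time of the point. -/
theorem integral_addIf_eq_costCov (hη : IsPoissonProcess P η (intensity d lam)) (hf : Measurable f)
    {K : ℝ} (hK : ∀ G, |f G| ≤ K) (W : Cube d) (x : Fin d → ℝ) (t : I) :
    (∫ p, ((f (graph B (addIf true (x, t, p.1) p.2.1)) *
          f (graph B (addIf true (x, t, p.1) (mix (fun q : Pt d => q.2.1) t p.2.1 p.2.2))) +
        f (graph B (addIf false (x, t, p.1) p.2.1)) *
          f (graph B (addIf false (x, t, p.1) (mix (fun q : Pt d => q.2.1) t p.2.1 p.2.2)))) -
      (f (graph B (addIf true (x, t, p.1) p.2.1)) *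
          f (graph B (addIf false (x, t, p.1) (mix (fun q : Pt d => q.2.1) t p.2.1 p.2.2))) +
        f (graph B (addIf false (x, t, p.1) p.2.1)) *
          f (graph B (addIf true (x, t, p.1) (mix (fun q : Pt d => q.2.1) t p.2.1 p.2.2)))))
      ∂(doubleLaw P η W)) = costCov P B η f W x t := by
  have := hη.isProbabilityMeasure_windowLaw W
  have := nonempty_fin_of_equiv B
  have hadd : ∀ a : Bool, Measurable fun p : Marks × Finset (Pt d) × Finset (Pt d) =>
      graph B (addIf a (x, t, p.1) p.2.1) := fun a => (measurable_graph B).comp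
    ((measurable_addIf_root a x t).comp (measurable_fst.prodMk measurable_snd.fst))
  have hmix : ∀ a : Bool, Measurable fun p : Marks × Finset (Pt d) × Finset (Pt d) =>
      graph B (addIf a (x, t, p.1) (mix (fun q : Pt d => q.2.1) t p.2.1 p.2.2)) := fun a =>
    (measurable_graph B).comp ((measurable_addIf_root a x t).comp
      (measurable_fst.prodMk ((measurable_mix_time t).comp measurable_snd)))
  let φ : Bool → Bool → Marks × Finset (Pt d) × Finset (Pt d) →
      Finset (MarkedEdge d) × Finset (MarkedEdge d) := fun a b p =>
    (graph B (addIf a (x, t, p.1) p.2.1),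
      graph B (addIf b (x, t, p.1) (mix (fun q : Pt d => q.2.1) t p.2.1 p.2.2)))
  let ψ : Bool → Bool → Marks × Finset (Pt d) × Finset (Pt d) →
      Finset (MarkedEdge d) × Finset (MarkedEdge d) := fun a b p =>
    (removeIf a x (φ true true p).1, removeIf b x (φ true true p).2)
  have hφ : ∀ a b, Measurable (φ a b) := fun a b => (hadd a).prodMk (hmix b)
  have hψ : ∀ a b, Measurable (ψ a b) := fun a b =>
    ((measurable_removeIf a x).comp (hadd true)).prodMk ((measurable_removeIf b x).comp (hmix true))
  -- Without the point, the later ranks and hence the edge marks differ from those after its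
  -- removal. Only the joint laws agree, which suffices since the four products are integrated
  -- separately.
  have hmap : ∀ a b, (doubleLaw P η W).map (φ a b) = (doubleLaw P η W).map (ψ a b) := by
    intro a b
    refine Measure.ext fun S hS => ?_
    have hm : Measurable (S.indicator
      (1 : Finset (MarkedEdge d) × Finset (MarkedEdge d) → ℝ≥0∞)) := measurable_one.indicator hS
    rw [← lintegral_indicator_one hS, ← lintegral_indicator_one hS, lintegral_map hm (hφ a b),
      lintegral_map hm (hψ a b)]
    exact lintegral_graph_remove B W.volume_ne_top (hη.isPoissonLaw_windowLaw W) a b x t hm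
  have hG : Measurable fun p : Finset (MarkedEdge d) × Finset (MarkedEdge d) => f p.1 * f p.2 :=
    (hf.comp measurable_fst).mul (hf.comp measurable_snd)
  have hGK : ∀ p : Finset (MarkedEdge d) × Finset (MarkedEdge d), |f p.1 * f p.2| ≤ K * K :=
    fun p => by
      rw [abs_mul]
      exact mul_le_mul (hK _) (hK _) (abs_nonneg _) ((abs_nonneg _).trans (hK p.1))
  have hint : ∀ a b, ∫ p, f (φ a b p).1 * f (φ a b p).2 ∂(doubleLaw P η W) =
      ∫ p, f (ψ a b p).1 * f (ψ a b p).2 ∂(doubleLaw P η W) := by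
    intro a b
    rw [← integral_map (f := fun G => f G.1 * f G.2) (hφ a b).aemeasurable hG.aestronglyMeasurable,
      hmap, integral_map (hψ a b).aemeasurable hG.aestronglyMeasurable]
  have hi : ∀ a b, Integrable (fun p => f (φ a b p).1 * f (φ a b p).2) (doubleLaw P η W) :=
    fun a b => integrable_of_abs_le (hG.comp (hφ a b)) fun p => hGK _
  have hi' : ∀ a b, Integrable (fun p => f (ψ a b p).1 * f (ψ a b p).2) (doubleLaw P η W) :=
    fun a b => integrable_of_abs_le (hG.comp (hψ a b)) fun p => hGK _
  have split : ∀ {g₁ g₂ g₃ g₄ : Marks × Finset (Pt d) × Finset (Pt d) → ℝ},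
      Integrable g₁ (doubleLaw P η W) → Integrable g₂ (doubleLaw P η W) →
      Integrable g₃ (doubleLaw P η W) → Integrable g₄ (doubleLaw P η W) →
      ∫ p, ((g₁ p + g₂ p) - (g₃ p + g₄ p)) ∂(doubleLaw P η W) =
        (∫ p, g₁ p ∂(doubleLaw P η W) + ∫ p, g₂ p ∂(doubleLaw P η W)) -
          (∫ p, g₃ p ∂(doubleLaw P η W) + ∫ p, g₄ p ∂(doubleLaw P η W)) := by
    intro g₁ g₂ g₃ g₄ h₁ h₂ h₃ h₄
    have h12 : Integrable (fun p => g₁ p + g₂ p) (doubleLaw P η W) := h₁.add h₂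
    have h34 : Integrable (fun p => g₃ p + g₄ p) (doubleLaw P η W) := h₃.add h₄
    rw [integral_sub h12 h34, integral_add h₁ h₂, integral_add h₃ h₄]
  refine (split (hi true true) (hi false false) (hi true false) (hi false true)).trans ?_
  rw [hint, hint, hint, hint,
    ← split (hi' true true) (hi' false false) (hi' true false) (hi' false true)]
  refine integral_congr_ae (Eventually.of_forall fun p => ?_)
  simp only [costPair, addOneCost_eq, vertexCost]
  change f (φ true true p).1 * f (φ true true p).2 +
      f (removeVertex (φ true true p).1 x) * f (removeVertex (φ true true p).2 x) -
    (f (φ true true p).1 * f (removeVertex (φ true true p).2 x) +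
      f (removeVertex (φ true true p).1 x) * f (φ true true p).2) =
    (f (φ true true p).1 - f (removeVertex (φ true true p).1 x)) *
      (f (φ true true p).2 - f (removeVertex (φ true true p).2 x))
  ring

/-- The covariance identity integrates over points z = (x, t, M). Regrouping M with the two copies
of the process leaves, for each (x, t), the expectation evaluated by `integral_addIf_eq_costCov`.
Boundedness makes all four products integrable. -/
theorem variance_eq_integral_costCov_of_bounded (hη : IsPoissonProcess P η (intensity d lam))
    (hf : Measurable f) {K : ℝ} (hK : ∀ G, |f G| ≤ K) (W : Cube d) :
    variance (fun ω => f (graph B ((η ω).inCube W))) P =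
      ∫ q, costCov P B η f W q.1 q.2 ∂(placeMeasure lam W) := by
  have := hη.isProbabilityMeasure_windowLaw W
  have := isFiniteMeasure_windowIntensity (lam := lam) W.volume_ne_top
  have := isFiniteMeasure_restrict_cube lam W
  have := isFiniteMeasure_placeMeasure lam W
  have hτ : Measurable fun q : Pt d => q.2.1 := measurable_snd.fst
  have hF : Measurable fun ξ : Finset (Pt d) => f (graph B ξ) := hf.comp (measurable_graph B)
  have e1 : variance (fun ω => f (graph B ((η ω).inCube W))) P =
      variance (fun ξ => f (graph B ξ)) (windowLaw P η W) := by
    rw [windowLaw, variance_map hF.aemeasurable (hη.measurable_inCube W).aemeasurable]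
    rfl
  rw [e1, variance_eq_integral_addIf (hη.isPoissonLaw_windowLaw W) hτ
    (nullSingletonClass_time lam W) hF (fun ξ => hK _)]
  set T : Pt d × Finset (Pt d) × Finset (Pt d) → ℝ := fun q =>
    ((f (graph B (addIf true q.1 q.2.1)) *
          f (graph B (addIf true q.1 (mix (fun q : Pt d => q.2.1) q.1.2.1 q.2.1 q.2.2))) +
        f (graph B (addIf false q.1 q.2.1)) *
          f (graph B (addIf false q.1 (mix (fun q : Pt d => q.2.1) q.1.2.1 q.2.1 q.2.2)))) -
      (f (graph B (addIf true q.1 q.2.1)) *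
          f (graph B (addIf false q.1 (mix (fun q : Pt d => q.2.1) q.1.2.1 q.2.1 q.2.2))) +
        f (graph B (addIf false q.1 q.2.1)) *
          f (graph B (addIf true q.1 (mix (fun q : Pt d => q.2.1) q.1.2.1 q.2.1 q.2.2))))) with hT
  have hG : Measurable fun p : Finset (Pt d) × Finset (Pt d) =>
      f (graph B p.1) * f (graph B p.2) := (hF.comp measurable_fst).mul (hF.comp measurable_snd)
  have hm4 : ∀ a b, Measurable fun q : Pt d × Finset (Pt d) × Finset (Pt d) =>
      f (graph B (addIf a q.1 q.2.1)) *
        f (graph B (addIf b q.1 (mix (fun q : Pt d => q.2.1) q.1.2.1 q.2.1 q.2.2))) := fun a b => by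
    have h := hG.comp (measurable_addMix hτ a b)
    exact h
  have hTm : Measurable T :=
    ((hm4 true true).add (hm4 false false)).sub ((hm4 true false).add (hm4 false true))
  have hTK : ∀ q, |T q| ≤ (K * K + K * K) + (K * K + K * K) := by
    have h2 : ∀ G G', |f G * f G'| ≤ K * K := fun G G' => by
      rw [abs_mul]
      exact mul_le_mul (hK _) (hK _) (abs_nonneg _) ((abs_nonneg _).trans (hK G))
    intro q
    exact (abs_sub _ _).trans (add_le_add ((abs_add_le _ _).trans (add_le_add (h2 _ _) (h2 _ _)))
      ((abs_add_le _ _).trans (add_le_add (h2 _ _) (h2 _ _))))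
  have hreg := map_prod_regroup
    ((ENNReal.ofReal lam • (volume : Measure (Fin d → ℝ))).restrict W.toSet) (volume : Measure I)
    marksMeasure ((windowLaw P η W).prod (windowLaw P η W))
  change ∫ q, T q ∂((windowIntensity lam W.toSet).prod ((windowLaw P η W).prod (windowLaw P η W))) = _
  unfold windowIntensity
  rw [← hreg.map_eq, integral_map hreg.measurable.aemeasurable hTm.aestronglyMeasurable]
  have hi : Integrable (fun p : ((Fin d → ℝ) × I) × Marks × Finset (Pt d) × Finset (Pt d) =>
      T ((p.1.1, (p.1.2, p.2.1)), p.2.2)) ((placeMeasure lam W).prod (doubleLaw P η W)) :=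
    by
      have h := hTm.comp hreg.measurable
      exact integrable_of_abs_le h fun p => hTK _
  refine (integral_prod _ hi).trans (integral_congr_ae (Eventually.of_forall fun q => ?_))
  exact integral_addIf_eq_costCov hη hf hK W q.1 q.2

end BoundedVariance

/-! ### The variance and its asymptotics -/

section Variance

variable {d : ℕ} {Ω : Type*} [MeasurableSpace Ω] {P : Measure Ω} [IsProbabilityMeasure P]
  {lam : ℝ} {η : Ω → Config (Pt d)} {B : ℕ ≃ (Fin d → ℤ)} {f g : Finset (MarkedEdge d) → ℝ}

theorem abs_addOneCost_clamp_le (K : ℝ) (p : Pt d) (ξ : Finset (Pt d)) :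
    |addOneCost B (fun G => clamp K (f G)) p ξ| ≤ |addOneCost B f p ξ| :=
  abs_clamp_sub_clamp_le K _ _

theorem tendsto_addOneCost_clamp (p : Pt d) (ξ : Finset (Pt d)) :
    Tendsto (fun n : ℕ => addOneCost B (fun G => clamp n (f G)) p ξ) atTop
      (𝓝 (addOneCost B f p ξ)) := (tendsto_clamp _).sub (tendsto_clamp _)

theorem memLp_costPair_fst (hη : IsPoissonProcess P η (intensity d lam)) (hf : Measurable f)
    (hmom : MomentCondition P B η f) {W : Cube d} (h0 : (0 : Fin d → ℝ) ∈ W.toSet) (t : I) :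
    MemLp (fun p => (costPair B f 0 t p).1) 2 (doubleLaw P η W) := by
  have h := (memLp_addOneCost_of_originCost hη hf
    (memLp_originCost hη hf hmom h0 t)).comp_measurePreserving (hη.measurePreserving_old W)
  exact h

theorem memLp_costPair_snd (hη : IsPoissonProcess P η (intensity d lam)) (hf : Measurable f)
    (hmom : MomentCondition P B η f) {W : Cube d} (h0 : (0 : Fin d → ℝ) ∈ W.toSet) (t : I) :
    MemLp (fun p => (costPair B f 0 t p).2) 2 (doubleLaw P η W) := by
  have h := (memLp_addOneCost_of_originCost hη hf
    (memLp_originCost hη hf hmom h0 t)).comp_measurePreserving (hη.measurePreserving_mix W t)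
  exact h

theorem integral_costPair_fst_sq (hη : IsPoissonProcess P η (intensity d lam)) (hf : Measurable f)
    (W : Cube d) (t : I) : ∫ p, (costPair B f 0 t p).1 ^ 2 ∂(doubleLaw P η W) =
      ∫ z, originCost B η f t W z ^ 2 ∂(P.prod marksMeasure) := by
  have hm := ((measurable_addOneCost_mark B hf 0 t).pow_const 2).aestronglyMeasurable
    (μ := marksMeasure.prod (windowLaw P η W))
  have h1 := hη.measurePreserving_old W
  have h2 := hη.measurePreserving_inCube W
  have e1 := integral_map h1.measurable.aemeasurable (h1.map_eq.symm ▸ hm)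
  have e2 := integral_map h2.measurable.aemeasurable (h2.map_eq.symm ▸ hm)
  rw [h1.map_eq] at e1
  rw [h2.map_eq] at e2
  exact e1.symm.trans e2

theorem integral_costPair_snd_sq (hη : IsPoissonProcess P η (intensity d lam)) (hf : Measurable f)
    (W : Cube d) (t : I) : ∫ p, (costPair B f 0 t p).2 ^ 2 ∂(doubleLaw P η W) =
      ∫ z, originCost B η f t W z ^ 2 ∂(P.prod marksMeasure) := by
  have hm := ((measurable_addOneCost_mark B hf 0 t).pow_const 2).aestronglyMeasurable
    (μ := marksMeasure.prod (windowLaw P η W))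
  have h1 := hη.measurePreserving_mix W t
  have h2 := hη.measurePreserving_inCube W
  have e1 := integral_map h1.measurable.aemeasurable (h1.map_eq.symm ▸ hm)
  have e2 := integral_map h2.measurable.aemeasurable (h2.map_eq.symm ▸ hm)
  rw [h1.map_eq] at e1
  rw [h2.map_eq] at e2
  exact e1.symm.trans e2

/-- Bound on the mixed moments of the costs of a functional with dominated costs. -/
theorem abs_costCov_le (hη : IsPoissonProcess P η (intensity d lam)) (hf : Measurable f)
    (hmom : MomentCondition P B η f) (hgf : ∀ p ξ, |addOneCost B g p ξ| ≤ |addOneCost B f p ξ|)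
    {C : ℝ} (hC : ∀ W : Cube d, (0 : Fin d → ℝ) ∈ W.toSet → ∀ t : I,
      ∫ z, originCost B η f t W z ^ 2 ∂(P.prod marksMeasure) ≤ C) {W : Cube d}
    (h0 : (0 : Fin d → ℝ) ∈ W.toSet) (t : I) : |costCov P B η g W 0 t| ≤ C := by
  have h1 := (memLp_costPair_fst hη hf hmom h0 t).integrable_sq
  have h2 := (memLp_costPair_snd hη hf hmom h0 t).integrable_sq
  have h12 : Integrable (fun p => ((costPair B f 0 t p).1 ^ 2 + (costPair B f 0 t p).2 ^ 2) / 2)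
    (doubleLaw P η W) := (h1.add h2).div_const 2
  have h := norm_integral_le_of_norm_le (μ := doubleLaw P η W)
    (f := fun p => (costPair B g 0 t p).1 * (costPair B g 0 t p).2) h12
    (Eventually.of_forall fun p => by
      rw [Real.norm_eq_abs, abs_mul]
      have a1 := hgf (0, t, p.1) p.2.1
      have a2 := hgf (0, t, p.1) (mix (fun q : Pt d => q.2.1) t p.2.1 p.2.2)
      refine (mul_le_mul a1 a2 (abs_nonneg _) (abs_nonneg _)).trans ?_
      change |(costPair B f 0 t p).1| * |(costPair B f 0 t p).2| ≤ _
      rw [← sq_abs (costPair B f 0 t p).1, ← sq_abs (costPair B f 0 t p).2]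
      nlinarith [sq_nonneg (|(costPair B f 0 t p).1| - |(costPair B f 0 t p).2|)])
  refine h.trans ?_
  rw [integral_div, integral_add h1 h2, integral_costPair_fst_sq hη hf,
    integral_costPair_snd_sq hη hf]
  linarith [hC W h0 t]

theorem tendsto_costCov_clamp (hη : IsPoissonProcess P η (intensity d lam)) (hf : Measurable f)
    (hmom : MomentCondition P B η f) {W : Cube d} (h0 : (0 : Fin d → ℝ) ∈ W.toSet) (t : I) :
    Tendsto (fun n : ℕ => costCov P B η (fun G => clamp n (f G)) W 0 t) atTop
      (𝓝 (costCov P B η f W 0 t)) := by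
  have h12 := ((memLp_costPair_fst hη hf hmom h0 t).integrable_mul
    (memLp_costPair_snd hη hf hmom h0 t)).abs
  refine tendsto_integral_of_dominated_convergence _ (fun n => ?_) h12
    (fun n => Eventually.of_forall fun p => ?_) (Eventually.of_forall fun p => ?_)
  · have hm := measurable_costPair (B := B) ((measurable_clamp n).comp hf) 0 t
    exact (hm.fst.mul hm.snd).aestronglyMeasurable
  · rw [Real.norm_eq_abs, abs_mul, Pi.mul_apply, abs_mul]
    exact mul_le_mul (abs_addOneCost_clamp_le _ _ _) (abs_addOneCost_clamp_le _ _ _)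
      (abs_nonneg _) (abs_nonneg _)
  · exact (tendsto_addOneCost_clamp _ _).mul (tendsto_addOneCost_clamp _ _)

theorem TranslationInvariant.clamp (hft : TranslationInvariant f) (K : ℝ) :
    TranslationInvariant fun G => clamp K (f G) := fun z G => by
  simp only
  rw [hft z G]


theorem abs_costCov_le_of_mem (hη : IsPoissonProcess P η (intensity d lam)) (hf : Measurable f)
    (hg : Measurable g) (hgt : TranslationInvariant g) (hmom : MomentCondition P B η f)
    (hgf : ∀ p ξ, |addOneCost B g p ξ| ≤ |addOneCost B f p ξ|)
    {C : ℝ} (hC : ∀ W : Cube d, (0 : Fin d → ℝ) ∈ W.toSet → ∀ t : I,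
      ∫ z, originCost B η f t W z ^ 2 ∂(P.prod marksMeasure) ≤ C) {W : Cube d}
    {x : Fin d → ℝ} (hx : x ∈ W.toSet) (t : I) : |costCov P B η g W x t| ≤ C := by
  rw [costCov_shift hη hg hgt]
  exact abs_costCov_le hη hf hmom hgf hC (Cube.zero_mem_shift.2 hx) t

/-- Truncating f does not increase its add-one costs. The variance formula for the truncations
therefore bounds their variances uniformly by the second moment bound times the intensity mass of
the cube. -/
theorem memLp_two_window (hη : IsPoissonProcess P η (intensity d lam)) (hf : Measurable f)
    (hft : TranslationInvariant f) (hmom : MomentCondition P B η f) (W : Cube d) :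
    MemLp (fun ω => f (graph B ((η ω).inCube W))) 2 P := by
  obtain ⟨C, -, hC⟩ := exists_secondMoment_bound hη hf hmom
  have := isFiniteMeasure_placeMeasure lam W
  refine memLp_two_of_variance_clamp_le
    (hf.comp ((measurable_graph B).comp (hη.measurable_inCube W)))
    (C := C * (placeMeasure lam W).real Set.univ) fun n => ?_
  have e := variance_eq_integral_costCov_of_bounded (B := B) (f := fun G => clamp n (f G)) hη
    ((measurable_clamp n).comp hf) (fun G => abs_clamp_le (Nat.cast_nonneg n) _) W
  refine e.le.trans ((le_abs_self _).trans ?_)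
  refine norm_integral_le_of_norm_le_const (μ := placeMeasure lam W)
    (f := fun q => costCov P B η (fun G => clamp n (f G)) W q.1 q.2) ?_
  filter_upwards [ae_placeMeasure_mem lam W] with q hq
  exact abs_costCov_le_of_mem hη hf ((measurable_clamp n).comp hf) (hft.clamp n) hmom
    (abs_addOneCost_clamp_le _) hC hq q.2

/-- The formula for the truncations of f passes to the limit on both sides, with the second moment
bound as dominating constant. -/
theorem variance_eq_integral_costCov (hη : IsPoissonProcess P η (intensity d lam))
    (hf : Measurable f) (hft : TranslationInvariant f) (hmom : MomentCondition P B η f)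
    (W : Cube d) :
    variance (fun ω => f (graph B ((η ω).inCube W))) P =
      ∫ q, costCov P B η f W q.1 q.2 ∂(placeMeasure lam W) := by
  obtain ⟨C, -, hC⟩ := exists_secondMoment_bound hη hf hmom
  have := isFiniteMeasure_placeMeasure lam W
  have h1 := tendsto_variance_clamp (hf.comp ((measurable_graph B).comp (hη.measurable_inCube W)))
    (memLp_two_window hη hf hft hmom W)
  have h2 : ∀ n : ℕ, variance (fun ω => clamp n (f (graph B ((η ω).inCube W)))) P =
      ∫ q, costCov P B η (fun G => clamp n (f G)) W q.1 q.2 ∂(placeMeasure lam W) := fun n =>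
    variance_eq_integral_costCov_of_bounded (f := fun G => clamp n (f G)) hη
      ((measurable_clamp n).comp hf) (fun G => abs_clamp_le (Nat.cast_nonneg n) _) W
  refine tendsto_nhds_unique (h1.congr h2) ?_
  refine tendsto_integral_of_dominated_convergence (fun _ => C)
    (fun n => (measurable_costCov hη ((measurable_clamp n).comp hf) W).aestronglyMeasurable)
    (integrable_const C) (fun n => ?_) ?_
  · filter_upwards [ae_placeMeasure_mem lam W] with q hq
    exact abs_costCov_le_of_mem hη hf ((measurable_clamp n).comp hf) (hft.clamp n) hmom
      (abs_addOneCost_clamp_le _) hC hq q.2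
  · filter_upwards [ae_placeMeasure_mem lam W] with q hq
    rw [costCov_shift hη hf hft]
    exact (tendsto_costCov_clamp hη hf hmom (Cube.zero_mem_shift.2 hq) q.2).congr fun n =>
      (costCov_shift hη ((measurable_clamp n).comp hf) (hft.clamp n) W q.1 q.2).symm

/-- The open unit cube. -/
def openUnitCube (d : ℕ) : Set (Fin d → ℝ) := Set.univ.pi fun _ => Set.Ioo 0 1

theorem measurableSet_openUnitCube : MeasurableSet (openUnitCube d) :=
  MeasurableSet.univ_pi fun _ => measurableSet_Ioo

theorem volume_openUnitCube : volume (openUnitCube d) = 1 := by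
  rw [openUnitCube, volume_pi_pi]
  simp

theorem setIntegral_cube (W : Cube d) (h : (Fin d → ℝ) → ℝ) :
    ∫ x in W.toSet, h x =
      W.side ^ d * ∫ u in openUnitCube d, h (W.corner + W.side • u) := by
  have hs := W.side_pos
  have hsub : W.toSet =ᵐ[volume] Set.univ.pi fun i =>
      Set.Ioo (W.corner i) (W.corner i + W.side) := by
    have h1 := Measure.univ_pi_Ico_ae_eq_Icc (μ := fun _ : Fin d => (volume : Measure ℝ))
      (f := W.corner) (g := fun i => W.corner i + W.side)
    have h2 := Measure.univ_pi_Ioo_ae_eq_Icc (μ := fun _ : Fin d => (volume : Measure ℝ))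
      (f := W.corner) (g := fun i => W.corner i + W.side)
    exact h1.trans h2.symm
  set S := Set.univ.pi fun i => Set.Ioo (W.corner i) (W.corner i + W.side) with hS
  have hSm : MeasurableSet S := MeasurableSet.univ_pi fun _ => measurableSet_Ioo
  have key : ∀ u, (openUnitCube d).indicator (fun u => h (W.corner + W.side • u)) u =
      (fun v => S.indicator h (W.corner + v)) (W.side • u) := by
    intro u
    have hiff : u ∈ openUnitCube d ↔ W.corner + W.side • u ∈ S := by
      simp only [openUnitCube, hS, Set.mem_pi, Set.mem_univ, true_imp_iff, Set.mem_Ioo,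
        Pi.add_apply, Pi.smul_apply, smul_eq_mul]
      refine forall_congr' fun i => and_congr ?_ ?_
      · exact ⟨fun h => by nlinarith [mul_pos hs h], fun h => pos_of_mul_pos_right
          (by linarith : 0 < W.side * u i) hs.le⟩
      · constructor
        · intro h; nlinarith
        · intro h
          exact lt_of_mul_lt_mul_left (by linarith : W.side * u i < W.side * 1) hs.le
    beta_reduce
    by_cases hu : u ∈ openUnitCube d
    · rw [Set.indicator_of_mem hu, Set.indicator_of_mem (hiff.1 hu)]
    · rw [Set.indicator_of_notMem hu, Set.indicator_of_notMem fun h' => hu (hiff.2 h')]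
  rw [setIntegral_congr_set hsub, ← integral_indicator hSm,
    ← integral_indicator measurableSet_openUnitCube]
  rw [integral_congr_ae (Eventually.of_forall key), Measure.integral_comp_smul _ (fun v =>
    S.indicator h (W.corner + v)), integral_add_left_eq_self (fun v => S.indicator h v),
    Module.finrank_fin_fun, abs_of_pos (by positivity), smul_eq_mul, ← mul_assoc,
    mul_inv_cancel₀ (by positivity), one_mul]

theorem TendsToSpace.tendsto_side [Nonempty (Fin d)] {W : ℕ → Cube d} (hW : TendsToSpace W) :
    Tendsto (fun n => (W n).side) atTop atTop := by
  refine tendsto_atTop.2 fun r => ?_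
  have i : Fin d := Classical.arbitrary _
  filter_upwards [hW |r|] with n hn
  have hmem : ∀ c : ℝ, |c| ≤ |r| → (fun _ => c) ∈ (W n).toSet := fun c hc => hn (by
    rw [mem_closedBall_zero_iff, pi_norm_le_iff_of_nonneg (abs_nonneg r)]
    exact fun _ => hc)
  have h1 := (hmem |r| (by rw [abs_abs])) i trivial
  have h2 := (hmem 0 (by rw [abs_zero]; exact abs_nonneg r)) i trivial
  simp only [Set.mem_Ico] at h1 h2
  linarith [h1.2, h2.1, le_abs_self r]

/-- A point with fixed relative position u in the interior of the cube moves away from every face,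
at distances proportional to the side length. The boundary would fail, hence the open unit cube. -/
theorem TendsToSpace.shift [Nonempty (Fin d)] {W : ℕ → Cube d} (hW : TendsToSpace W)
    {u : Fin d → ℝ} (hu : u ∈ openUnitCube d) :
    TendsToSpace fun n => (W n).shift ((W n).corner + (W n).side • u) := by
  intro r
  have hside := hW.tendsto_side
  -- The extra 1 gives the strict inequality at the excluded upper faces.
  have h : ∀ᶠ n in atTop, ∀ i, r ≤ (W n).side * u i ∧ r + 1 ≤ (W n).side * (1 - u i) := by
    refine eventually_all.2 fun i => ?_
    have hi : 0 < u i ∧ u i < 1 := hu i trivial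
    exact ((hside.atTop_mul_const hi.1).eventually_ge_atTop r).and
      ((hside.atTop_mul_const (sub_pos.2 hi.2)).eventually_ge_atTop (r + 1))
  filter_upwards [h] with n hn x hx i _
  rw [mem_closedBall_zero_iff] at hx
  have hxi := (norm_le_pi_norm x i).trans hx
  rw [Real.norm_eq_abs, abs_le] at hxi
  obtain ⟨h1, h2⟩ := hn i
  simp only [Cube.shift, Pi.sub_apply, Pi.add_apply, Pi.smul_apply, smul_eq_mul, Set.mem_Ico]
  constructor <;> nlinarith [hxi.1, hxi.2]

/-- Parametrising the cube by relative positions u cancels the volume and leaves an average over the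
open unit cube. For each u the cube seen from the point tends to the whole space, so `costCov`
converges pointwise and boundedly. -/
theorem tendsto_variance_div_volume (hlam : 0 ≤ lam) (hη : IsPoissonProcess P η (intensity d lam))
    (hf : Measurable f) (hft : TranslationInvariant f) (hmom : MomentCondition P B η f)
    {Δ : I → Ω × Marks → ℝ} (hΔ : ∀ t, IsLimitAddOneCost P B η f t (Δ t))
    {W : ℕ → Cube d} (hW : TendsToSpace W) :
    Tendsto (fun n => variance (fun ω => f (graph B ((η ω).inCube (W n)))) P /
      volume.real (W n).toSet) atTop (𝓝 (limitVariance P lam η Δ)) := by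
  have := nonempty_fin_of_equiv B
  obtain ⟨C, -, hC⟩ := exists_secondMoment_bound hη hf hmom
  have hbound : ∀ (W : Cube d) {x : Fin d → ℝ}, x ∈ W.toSet → ∀ t, |costCov P B η f W x t| ≤ C :=
    fun W x hx t => abs_costCov_le_of_mem hη hf hf hft hmom (fun _ _ => le_rfl) hC hx t
  have hmc := fun W => measurable_costCov (B := B) hη hf W
  have hmem : ∀ (W : Cube d) {u : Fin d → ℝ}, u ∈ openUnitCube d →
      W.corner + W.side • u ∈ W.toSet := by
    intro W u hu i _
    have hi : 0 < u i ∧ u i < 1 := hu i trivial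
    simp only [Pi.add_apply, Pi.smul_apply, smul_eq_mul, Set.mem_Ico]
    constructor <;> nlinarith [W.side_pos]
  have e : ∀ W : Cube d, variance (fun ω => f (graph B ((η ω).inCube W))) P /
      volume.real W.toSet =
      lam * ∫ u in openUnitCube d, ∫ t : I, costCov P B η f W (W.corner + W.side • u) t := by
    intro W
    have := isFiniteMeasure_placeMeasure lam W
    have := isFiniteMeasure_restrict_cube lam W
    have hi : Integrable (fun q : (Fin d → ℝ) × I => costCov P B η f W q.1 q.2)
        (placeMeasure lam W) := by
      refine Integrable.of_bound (hmc W).aestronglyMeasurable C ?_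
      filter_upwards [ae_placeMeasure_mem lam W] with q hq
      exact hbound W hq q.2
    rw [variance_eq_integral_costCov hη hf hft hmom W]
    have e1 : ∫ q, costCov P B η f W q.1 q.2 ∂(placeMeasure lam W) =
        ∫ x, (∫ t : I, costCov P B η f W x t)
          ∂((ENNReal.ofReal lam • (volume : Measure (Fin d → ℝ))).restrict W.toSet) :=
      integral_prod _ hi
    rw [e1, Measure.restrict_smul, integral_smul_measure, ENNReal.toReal_ofReal hlam, smul_eq_mul,
      setIntegral_cube W fun x => ∫ t : I, costCov P B η f W x t, W.volumeReal_toSet]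
    have := pow_pos W.side_pos d
    field_simp
  simp_rw [e]
  refine Tendsto.const_mul lam ?_
  have hvol : IsProbabilityMeasure ((volume : Measure (Fin d → ℝ)).restrict (openUnitCube d)) :=
    ⟨by rw [Measure.restrict_apply_univ, volume_openUnitCube]⟩
  have e2 : ∫ t : I, condSecondMoment P η Δ t =
      ∫ _ in openUnitCube d, ∫ t : I, condSecondMoment P η Δ t := by
    rw [integral_const]; simp
  rw [e2]
  have hae : ∀ᵐ u ∂((volume : Measure (Fin d → ℝ)).restrict (openUnitCube d)),
      u ∈ openUnitCube d := ae_restrict_mem measurableSet_openUnitCube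
  refine tendsto_integral_of_dominated_convergence (fun _ => C) (fun n => ?_)
    (integrable_const C) (fun n => ?_) ?_
  · have hm : Measurable fun q : (Fin d → ℝ) × I =>
        costCov P B η f (W n) ((W n).corner + (W n).side • q.1) q.2 := by
      have h := (hmc (W n)).comp (((measurable_fst.const_smul (W n).side).const_add
        (W n).corner).prodMk measurable_snd)
      exact h
    exact (hm.stronglyMeasurable.integral_prod_right' (ν := (volume : Measure I))).aestronglyMeasurable
  · filter_upwards [hae] with u hu
    have := norm_integral_le_of_norm_le_const (μ := (volume : Measure I))
      (f := fun t => costCov P B η f (W n) ((W n).corner + (W n).side • u) t)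
      (Eventually.of_forall (hbound (W n) (hmem (W n) hu)))
    simpa using this
  · filter_upwards [hae] with u hu
    refine tendsto_integral_of_dominated_convergence (fun _ => C) (fun n => ?_)
      (integrable_const C) (fun n => Eventually.of_forall (hbound (W n) (hmem (W n) hu)))
      (Eventually.of_forall fun t => ?_)
    · have h := (hmc (W n)).comp ((measurable_const
        (a := (W n).corner + (W n).side • u)).prodMk measurable_id)
      exact h.aestronglyMeasurable
    · exact (tendsto_costCov hη hf hmom (hΔ t) (hW.shift hu)).congr fun n =>
        (costCov_shift hη hf hft (W n) _ t).symm

end Variance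

/-! ### Positivity of the limiting variance -/

section Positivity

theorem integral_abs_le_eLpNorm_two {α : Type*} [MeasurableSpace α] {ρ : Measure α}
    [IsProbabilityMeasure ρ] {g : α → ℝ} (hg : MemLp g 2 ρ) :
    ∫ x, |g x| ∂ρ ≤ (eLpNorm g 2 ρ).toReal := by
  have h := variance_nonneg (fun x => |g x|) ρ
  have habs : MemLp (fun x => |g x|) 2 ρ := hg.abs
  rw [variance_eq_sub habs] at h
  have e : ∫ x, ((fun x => |g x|) ^ 2) x ∂ρ = (eLpNorm g 2 ρ).toReal ^ 2 := by
    rw [← integral_sq_eq_eLpNorm hg]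
    simp
  rw [e] at h
  exact le_of_sq_le_sq (by linarith) ENNReal.toReal_nonneg

variable {d : ℕ} {Ω : Type*} [MeasurableSpace Ω] {P : Measure Ω} [IsProbabilityMeasure P]
  {lam : ℝ} {η : Ω → Config (Pt d)} {B : ℕ ≃ (Fin d → ℤ)} {f : Finset (MarkedEdge d) → ℝ}

/-- The event that a cube has a point born at time `t` or later. -/
def lateEvent (η : Ω → Config (Pt d)) (W : Cube d) (t : I) : Set (Ω × Marks) :=
  {z | ∃ q ∈ (η z.1).inCube W, q ∈ {q : Pt d | t ≤ q.2.1}}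

theorem measurableSet_lateEvent (hη : IsPoissonProcess P η (intensity d lam)) (W : Cube d) (t : I) :
    MeasurableSet (lateEvent η W t) :=
  ((hη.measurable_inCube W).comp measurable_fst) (measurableSet_hit (measurable_snd.fst measurableSet_Ici))

/-- The void probability is exp(-m) with m = λ|W|(1 - t), and 1 - exp(-m) ≤ m. -/
theorem measureReal_lateEvent_le (hlam : 0 ≤ lam) (hη : IsPoissonProcess P η (intensity d lam))
    (W : Cube d) (t : I) :
    (P.prod marksMeasure).real (lateEvent η W t) ≤ lam * volume.real W.toSet * (1 - t) := by
  have hL := hη.isProbabilityMeasure_windowLaw W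
  have := isFiniteMeasure_windowIntensity (lam := lam) W.volume_ne_top
  have := isFiniteMeasure_restrict_cube lam W
  have hm : MeasurableSet {q : Pt d | t ≤ q.2.1} := measurable_snd.fst measurableSet_Ici
  have hmp : MeasurePreserving (fun z : Ω × Marks => (η z.1).inCube W) (P.prod marksMeasure)
      (windowLaw P η W) := measurePreserving_snd.comp (hη.measurePreserving_inCube W)
  have e1 : (P.prod marksMeasure).real (lateEvent η W t) =
      (windowLaw P η W).real (voidSet {q : Pt d | t ≤ q.2.1})ᶜ := by
    rw [measureReal_def, measureReal_def,
      ← hmp.measure_preimage (measurableSet_voidSet hm).compl.nullMeasurableSet]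
    congr 2
    ext z
    simp only [lateEvent, voidSet, Set.mem_preimage, Set.mem_compl_iff, Set.mem_ofPred_eq,
      not_forall, not_not, exists_prop]
  have e2 : (windowIntensity lam W.toSet).real {q : Pt d | t ≤ q.2.1} =
      lam * volume.real W.toSet * (1 - t) := by
    have : {q : Pt d | t ≤ q.2.1} = Set.univ ×ˢ (Set.Ici t ×ˢ Set.univ) := by ext; simp
    rw [this, windowIntensity, measureReal_def, Measure.prod_prod, Measure.prod_prod,
      unitInterval.volume_Ici]
    simp [measureReal_def, hlam, t.2.2]
  rw [e1, measureReal_compl (measurableSet_voidSet hm), probReal_univ, measureReal_def,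
    hη.isPoissonLaw_windowLaw W _ hm, ENNReal.toReal_ofReal (Real.exp_pos _).le, e2]
  linarith [Real.add_one_le_exp (-(lam * volume.real W.toSet * (1 - (t : ℝ))))]

/-- The truncated add-one cost computed from the points born before time `t`. -/
def pastCost (B : ℕ ≃ (Fin d → ℤ)) (η : Ω → Config (Pt d)) (f : Finset (MarkedEdge d) → ℝ)
    (t : I) (W : Cube d) (z : Ω × Marks) : ℝ :=
  clamp 1 (addOneCost B f (0, t, z.2) (((η z.1).before t).inCube W))

theorem stronglyMeasurable_pastCost (hf : Measurable f) (t : I) (W : Cube d) :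
    StronglyMeasurable[sigmaBefore η t] (pastCost B η f t W) := by
  rw [sigmaBefore_eq_comap]
  have h1 := comap_measurable (m := inferInstance) (Prod.map (fun ω => (η ω).before t) (id : Marks → Marks))
  have h2 : Measurable fun p : Config (Pt d) × Marks =>
      clamp 1 (addOneCost B f (0, t, p.2) (p.1.inCube W)) := by
    have h := (measurable_addOneCost_mark B hf 0 t).comp
      (measurable_snd.prodMk ((measurable_inCube W).comp measurable_fst))
    exact (measurable_clamp 1).comp h
  have h3 := h2.comp h1
  exact h3.stronglyMeasurable

theorem pastCost_eq_of_notMem (t : I) (W : Cube d) {z : Ω × Marks} (hz : z ∉ lateEvent η W t) :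
    pastCost B η f t W z = clamp 1 (originCost B η f t W z) := by
  have h : ((η z.1).before t).inCube W = (η z.1).inCube W := by
    ext q
    simp only [mem_inCube, Config.before, Config.restrict, Set.mem_inter_iff, Set.mem_ofPred_eq]
    refine ⟨fun h => ⟨h.1.1, h.2⟩, fun h => ⟨⟨h.1, ?_⟩, h.2⟩⟩
    by_contra hlt
    exact hz ⟨q, mem_inCube.2 h, not_lt.1 hlt⟩
  rw [pastCost, originCost, h]

/-- `pastCost` is a bounded function of the past and of the marks, hence orthogonal to Δ_t once
E[Δ_t | η_t] vanishes. -/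
theorem integral_pastCost_mul_eq_zero (hη : IsPoissonProcess P η (intensity d lam))
    (hf : Measurable f) {Δ : I → Ω × Marks → ℝ} {t : I} (hΔ : MemLp (Δ t) 2 (P.prod marksMeasure))
    (h0 : condSecondMoment P η Δ t = 0) (W : Cube d) :
    ∫ z, pastCost B η f t W z * Δ t z ∂(P.prod marksMeasure) = 0 := by
  have hY := stronglyMeasurable_pastCost (B := B) (η := η) hf t W
  have hle := sigmaBefore_le hη t
  have hYm := (hY.mono hle).aestronglyMeasurable (μ := P.prod marksMeasure)
  have hY2 : MemLp (pastCost B η f t W) 2 (P.prod marksMeasure) :=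
    MemLp.of_bound hYm 1 (Eventually.of_forall fun z => abs_clamp_le zero_le_one _)
  have hZ : (fun z => condExp (sigmaBefore η t) (P.prod marksMeasure) (Δ t) z ^ 2)
      =ᵐ[P.prod marksMeasure] 0 :=
    (integral_eq_zero_iff_of_nonneg (fun _ => sq_nonneg _)
      (hΔ.condExp one_le_two).integrable_sq).1 h0
  have hYΔ : Integrable (pastCost B η f t W * Δ t) (P.prod marksMeasure) := hY2.integrable_mul hΔ
  have hpull := condExp_mul_of_stronglyMeasurable_left hY hYΔ (hΔ.integrable one_le_two)
  change ∫ z, (pastCost B η f t W * Δ t) z ∂(P.prod marksMeasure) = 0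
  rw [← integral_condExp hle (f := pastCost B η f t W * Δ t), integral_congr_ae hpull]
  refine integral_eq_zero_of_ae ?_
  filter_upwards [hZ] with z hz
  have hz' : condExp (sigmaBefore η t) (P.prod marksMeasure) (Δ t) z = 0 := by
    simpa using hz
  simp [hz']

theorem eLpNorm_originCost_sub_limit_le (hη : IsPoissonProcess P η (intensity d lam))
    (hf : Measurable f) (hmom : MomentCondition P B η f) {N : ℕ} {ε : ℝ≥0∞} {t : I}
    (hN : ∀ W : Cube d, (centeredCube d N).toSet ⊆ W.toSet →
      eLpNorm (originCost B η f t (centeredCube d N) - originCost B η f t W) 2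
        (P.prod marksMeasure) ≤ ε) {Δ : Ω × Marks → ℝ} (hΔ : IsLimitAddOneCost P B η f t Δ) :
    eLpNorm (originCost B η f t (centeredCube d N) - Δ) 2 (P.prod marksMeasure) ≤ ε := by
  have hm := fun W => (measurable_originCost (B := B) hη hf t W).aestronglyMeasurable
    (μ := P.prod marksMeasure)
  have hlim := (hΔ.tendsto_eLpNorm hη hf hmom (tendsToSpace_centeredCube (d := d))).2
  have h2 : Tendsto (fun n => ε + eLpNorm (originCost B η f t (centeredCube d n) - Δ) 2
      (P.prod marksMeasure)) atTop (𝓝 (ε + 0)) := hlim.const_add ε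
  rw [add_zero] at h2
  refine ge_of_tendsto h2 ?_
  filter_upwards [tendsToSpace_centeredCube (d := d) (N + 1)] with n hn
  have e : originCost B η f t (centeredCube d N) - Δ =
      (originCost B η f t (centeredCube d N) - originCost B η f t (centeredCube d n)) +
        (originCost B η f t (centeredCube d n) - Δ) := by abel
  rw [e]
  exact (eLpNorm_add_le ((hm _).sub (hm _)) ((hm _).sub hΔ.1.aestronglyMeasurable)
    one_le_two).trans (add_le_add (hN _ ((centeredCube_subset_closedBall N).trans hn)) le_rfl)

/-- If the conditional second moment vanishes at time `t`, then the truncated second moment of the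
limit add-one cost at time `1` is small. -/
theorem integral_mul_clamp_le (hlam : 0 ≤ lam) (hη : IsPoissonProcess P η (intensity d lam))
    (hf : Measurable f) (hmom : MomentCondition P B η f) {Δ : I → Ω × Marks → ℝ}
    (hΔ : ∀ t, IsLimitAddOneCost P B η f t (Δ t)) {C : ℝ}
    (hC : ∀ W : Cube d, (0 : Fin d → ℝ) ∈ W.toSet → ∀ t : I,
      ∫ z, originCost B η f t W z ^ 2 ∂(P.prod marksMeasure) ≤ C) {N : ℕ} {ε : ℝ} (hε : 0 ≤ ε)
    (hN : ∀ W : Cube d, (centeredCube d N).toSet ⊆ W.toSet → ∀ t : I,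
      eLpNorm (originCost B η f t (centeredCube d N) - originCost B η f t W) 2
        (P.prod marksMeasure) ≤ ENNReal.ofReal ε) {t : I} (h0 : condSecondMoment P η Δ t = 0)
    {δ : ℝ} (hδ : 0 < δ) :
    ∫ z, Δ 1 z * clamp 1 (Δ 1 z) ∂(P.prod marksMeasure) ≤
      3 * ε + δ * C + δ⁻¹ * (lam * volume.real (centeredCube d N).toSet * (1 - t)) := by
  set ρ := P.prod marksMeasure with hρ
  set A := centeredCube d N with hA
  have h0A : (0 : Fin d → ℝ) ∈ A.toSet := zero_mem_centeredCube N
  have hD := fun t => memLp_originCost hη hf hmom h0A t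
  have hΔ2 := fun t => ((hΔ t).tendsto_eLpNorm hη hf hmom (tendsToSpace_centeredCube (d := d))).1
  have hdist : ∀ t, ∫ z, |originCost B η f t A z - Δ t z| ∂ρ ≤ ε := fun t => by
    refine (integral_abs_le_eLpNorm_two ((hD t).sub (hΔ2 t))).trans ?_
    exact ENNReal.toReal_le_of_le_ofReal hε
      (eLpNorm_originCost_sub_limit_le hη hf hmom (fun W hW => hN W hW t) (hΔ t))
  have hdi : ∀ t, Integrable (fun z => |originCost B η f t A z - Δ t z|) ρ := fun t =>
    (((hD t).sub (hΔ2 t)).integrable one_le_two).abs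
  have hφ : Measurable fun x : ℝ => x * clamp 1 x := measurable_id.mul (measurable_clamp 1)
  have hφi : ∀ {g : Ω × Marks → ℝ}, MemLp g 2 ρ → Integrable (fun z => g z * clamp 1 (g z)) ρ :=
    fun {g} hg => by
      have hgm := hg.aestronglyMeasurable.aemeasurable
      refine (hg.integrable one_le_two).mono (hφ.comp_aemeasurable hgm).aestronglyMeasurable
        (Eventually.of_forall fun z => ?_)
      rw [norm_mul]
      exact mul_le_of_le_one_right (norm_nonneg _) (abs_clamp_le zero_le_one _)
  -- The limit is replaced by the cost in the cube A. The Lipschitz constant 2 accounts for 2ε, and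
  -- the third ε comes from the same replacement at time t, in the opposite direction.
  have s1 : ∫ z, Δ 1 z * clamp 1 (Δ 1 z) ∂ρ ≤
      ∫ z, originCost B η f 1 A z * clamp 1 (originCost B η f 1 A z) ∂ρ + 2 * ε := by
    have h : ∫ z, Δ 1 z * clamp 1 (Δ 1 z) ∂ρ ≤
        ∫ z, (originCost B η f 1 A z * clamp 1 (originCost B η f 1 A z) +
          2 * |originCost B η f 1 A z - Δ 1 z|) ∂ρ := by
      refine integral_mono (hφi (hΔ2 1)) ((hφi (hD 1)).add ((hdi 1).const_mul 2)) fun z => ?_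
      have := (abs_le.1 (abs_mul_clamp_sub_le (originCost B η f 1 A z) (Δ 1 z))).1
      simp only
      linarith
    rw [integral_add (hφi (hD 1)) ((hdi 1).const_mul 2), integral_const_mul] at h
    linarith [hdist 1]
  have s2 : ∫ z, originCost B η f 1 A z * clamp 1 (originCost B η f 1 A z) ∂ρ =
      ∫ z, originCost B η f t A z * clamp 1 (originCost B η f t A z) ∂ρ :=
    ((identDistrib_originCost_self (B := B) hη hf h0A 1 t).comp hφ).integral_eq
  have hY := stronglyMeasurable_pastCost (B := B) (η := η) hf t A
  have hY2 : MemLp (pastCost B η f t A) 2 ρ :=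
    MemLp.of_bound (hY.mono (sigmaBefore_le hη t)).aestronglyMeasurable 1
      (Eventually.of_forall fun z => abs_clamp_le zero_le_one _)
  have hYΔ : Integrable (fun z => pastCost B η f t A z * Δ t z) ρ := hY2.integrable_mul (hΔ2 t)
  have hE := measurableSet_lateEvent hη A t
  have hEi : Integrable ((lateEvent η A t).indicator fun _ => δ⁻¹) ρ :=
    (integrable_const δ⁻¹).indicator hE
  have hDsq : Integrable (fun z => δ * originCost B η f t A z ^ 2) ρ :=
    (hD t).integrable_sq.const_mul δ
  -- Off the late event the truncated cost is the past cost. On it the discrepancy is at most 2|D|,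
  -- and 2|D| ≤ δD² + δ⁻¹ splits this into a second moment and the probability of the event.
  have s3 : ∫ z, originCost B η f t A z * clamp 1 (originCost B η f t A z) ∂ρ ≤
      ∫ z, ((pastCost B η f t A z * Δ t z + |originCost B η f t A z - Δ t z|) +
        (δ * originCost B η f t A z ^ 2 + (lateEvent η A t).indicator (fun _ => δ⁻¹) z)) ∂ρ := by
    refine integral_mono (hφi (hD t)) ((hYΔ.add (hdi t)).add (hDsq.add hEi)) fun z => ?_
    simp only
    set D := originCost B η f t A z with hDz
    set Y := pastCost B η f t A z with hYz
    have hY1 : |Y| ≤ 1 := abs_clamp_le zero_le_one _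
    have a1 : D * Y ≤ Y * Δ t z + |D - Δ t z| := by
      have : D * Y - Y * Δ t z = (D - Δ t z) * Y := by ring
      have h2 : (D - Δ t z) * Y ≤ |D - Δ t z| := by
        refine (le_abs_self _).trans ?_
        rw [abs_mul]
        exact mul_le_of_le_one_right (abs_nonneg _) hY1
      linarith
    by_cases hz : z ∈ lateEvent η A t
    · rw [Set.indicator_of_mem hz]
      have hc : |clamp 1 D| ≤ 1 := abs_clamp_le zero_le_one _
      have a2 : D * clamp 1 D - D * Y ≤ 2 * |D| := by
        have h1 : D * clamp 1 D ≤ |D| := by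
          refine (le_abs_self _).trans ?_
          rw [abs_mul]
          exact mul_le_of_le_one_right (abs_nonneg _) hc
        have h2 : -(D * Y) ≤ |D| := by
          refine (neg_le_abs _).trans ?_
          rw [abs_mul]
          exact mul_le_of_le_one_right (abs_nonneg _) hY1
        linarith
      have a3 : 2 * |D| ≤ δ * D ^ 2 + δ⁻¹ := by
        have h1 := sq_nonneg (δ * |D| - 1)
        have h2 : δ⁻¹ * (δ * |D| - 1) ^ 2 = δ * D ^ 2 + δ⁻¹ - 2 * |D| := by
          rw [← sq_abs D]
          field_simp
          ring
        have h3 : 0 ≤ δ⁻¹ * (δ * |D| - 1) ^ 2 := by positivity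
        linarith
      linarith
    · rw [Set.indicator_of_notMem hz]
      have hYD : Y = clamp 1 D := pastCost_eq_of_notMem t A hz
      rw [← hYD]
      have : 0 ≤ δ * D ^ 2 := by positivity
      linarith
  have i1 : Integrable (fun z => pastCost B η f t A z * Δ t z +
      |originCost B η f t A z - Δ t z|) ρ := hYΔ.add (hdi t)
  have i2 : Integrable (fun z => δ * originCost B η f t A z ^ 2 +
      (lateEvent η A t).indicator (fun _ => δ⁻¹) z) ρ := hDsq.add hEi
  rw [integral_add i1 i2, integral_add hYΔ (hdi t), integral_add hDsq hEi,
    integral_pastCost_mul_eq_zero hη hf (hΔ2 t) h0 A, integral_const_mul,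
    integral_indicator_const _ hE, smul_eq_mul] at s3
  have s4 := measureReal_lateEvent_le hlam hη A t
  have s5 := mul_le_mul_of_nonneg_left (hC A h0A t) hδ.le
  have s6 := mul_le_mul_of_nonneg_left s4 (inv_pos.2 hδ).le
  rw [mul_comm] at s6
  rw [s2] at s1
  linarith [hdist t]

/-- If the limit variance vanished, `condSecondMoment` would vanish at times arbitrarily close to 1.
The estimate `integral_mul_clamp_le` at such a time bounds α by 3α/4, although α > 0. -/
theorem limitVariance_pos (hlam : 0 < lam) (hη : IsPoissonProcess P η (intensity d lam))
    (hf : Measurable f) (hmom : MomentCondition P B η f) {Δ : I → Ω × Marks → ℝ}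
    (hΔ : ∀ t, IsLimitAddOneCost P B η f t (Δ t))
    (hpos : 0 < (P.prod marksMeasure) {z | Δ 1 z ≠ 0}) : 0 < limitVariance P lam η Δ := by
  refine mul_pos hlam ?_
  have hint := integrable_condSecondMoment hη hf hmom hΔ
  refine lt_of_le_of_ne (integral_nonneg fun t => condSecondMoment_nonneg Δ t) fun h => ?_
  have hae := (integral_eq_zero_iff_of_nonneg (fun t => condSecondMoment_nonneg Δ t) hint).1 h.symm
  have hΔ2 := ((hΔ 1).tendsto_eLpNorm hη hf hmom (tendsToSpace_centeredCube (d := d))).1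
  set α := ∫ z, Δ 1 z * clamp 1 (Δ 1 z) ∂(P.prod marksMeasure) with hα
  have hα0 : 0 < α := by
    have hi : Integrable (fun z => Δ 1 z * clamp 1 (Δ 1 z)) (P.prod marksMeasure) := by
      refine (hΔ2.integrable one_le_two).mono
        ((hΔ 1).1.mul ((measurable_clamp 1).comp (hΔ 1).1)).aestronglyMeasurable
        (Eventually.of_forall fun z => ?_)
      rw [norm_mul]
      exact mul_le_of_le_one_right (norm_nonneg _) (abs_clamp_le zero_le_one _)
    refine (integral_pos_iff_support_of_nonneg (fun z => mul_clamp_nonneg zero_le_one _) hi).2 ?_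
    convert hpos using 2
    ext z
    simp only [Function.mem_support, Set.mem_ofPred_eq]
    exact ⟨fun h hz => h (by rw [hz, zero_mul]), fun h => (mul_clamp_pos one_pos h).ne'⟩
  obtain ⟨C, hC0, hC⟩ := exists_secondMoment_bound hη hf hmom
  -- The three error terms are each made at most α/4: ε = α/12 fixes the cube, then δ is chosen from
  -- the moment bound C, and finally κ from the mass m of the cube.
  obtain ⟨r, hr⟩ := exists_radius_originCost_sub hη hf hmom ⟨Δ 1, hΔ 1⟩
    (ε := ENNReal.ofReal (α / 12)) (by simpa using hα0)
  set δ := α / (4 * (C + 1)) with hδ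
  have hδ0 : 0 < δ := by positivity
  set m := lam * volume.real (centeredCube d r).toSet with hm
  have hm0 : 0 < m := mul_pos hlam (centeredCube d r).volumeReal_pos
  set κ := min 1 (α * δ / (4 * m)) with hκ
  have hκ0 : 0 < κ := lt_min one_pos (by positivity)
  have hs : 1 - κ ∈ I := ⟨by linarith [min_le_left 1 (α * δ / (4 * m))], by linarith⟩
  obtain ⟨t, ht, ht0⟩ : ∃ t : I, 1 - κ ≤ t ∧ condSecondMoment P η Δ t = 0 := by
    -- Almost every t is a zero, and the times in [1 - κ, 1] have measure κ > 0, so one of them is a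
    -- zero.
    by_contra! hcon
    have h1 : volume (Set.Ici (⟨1 - κ, hs⟩ : I)) = 0 := by
      refine measure_mono_null (fun t ht => ?_) (ae_iff.1 hae)
      exact hcon t ht
    rw [unitInterval.volume_Ici] at h1
    simp only [sub_sub_cancel, ENNReal.ofReal_eq_zero] at h1
    linarith
  have h1 := integral_mul_clamp_le hlam.le hη hf hmom hΔ hC (ε := α / 12) (by positivity)
    (hr r le_rfl) ht0 hδ0
  have h2 : δ * C ≤ α / 4 := by
    rw [hδ, div_mul_eq_mul_div, div_le_div_iff₀ (by positivity) (by norm_num)]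
    nlinarith
  have h3 : δ⁻¹ * (m * (1 - t)) ≤ α / 4 := by
    have h4 : m * (1 - t) ≤ m * (α * δ / (4 * m)) :=
      mul_le_mul_of_nonneg_left (by linarith [min_le_right 1 (α * δ / (4 * m))]) hm0.le
    have h5 : m * (α * δ / (4 * m)) = δ * (α / 4) := by field_simp
    rw [h5] at h4
    calc δ⁻¹ * (m * (1 - t)) ≤ δ⁻¹ * (δ * (α / 4)) :=
          mul_le_mul_of_nonneg_left h4 (inv_pos.2 hδ0).le
      _ = α / 4 := by rw [← mul_assoc, inv_mul_cancel₀ hδ0.ne', one_mul]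
  linarith

end Positivity

end

end MarkedPoisson

theorem mainTheorem2 {d : ℕ} {Ω : Type*} [MeasurableSpace Ω] (P : Measure Ω)
    [IsProbabilityMeasure P] (lam : ℝ) (hlam : 0 < lam) (B : ℕ ≃ (Fin d → ℤ))
    (η : Ω → Config (Pt d)) (hη : IsPoissonProcess P η (intensity d lam))
    (f : Finset (MarkedEdge d) → ℝ) (hf : Measurable[markedEdgeSets d] f)
    (hstab : WeaklyStabilizing P B η f) (hmom : MomentCondition P B η f) :
    -- the variances are those of square integrable random variables
    (∀ W : Cube d, MemLp (fun ω => f (graph B ((η ω).inCube W))) 2 P) ∧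
    -- the limit add-one cost exists for every birth time
    (∀ t : I, ∃ Δ : Ω × Marks → ℝ, IsLimitAddOneCost P B η f t Δ) ∧
    ∀ Δ : I → Ω × Marks → ℝ, (∀ t, IsLimitAddOneCost P B η f t (Δ t)) →
      -- the limiting variance is well defined
      (∀ t, MemLp (Δ t) 2 (P.prod marksMeasure)) ∧
      Integrable (condSecondMoment P η Δ) (volume : Measure I) ∧
      -- convergence of the normalized variances
      (∀ W : ℕ → Cube d, TendsToSpace W →
        Tendsto (fun n => variance (fun ω => f (graph B ((η ω).inCube (W n)))) P /
            volume.real (W n).toSet) atTop (𝓝 (limitVariance P lam η Δ))) ∧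
      -- positivity
      (0 < (P.prod marksMeasure) {z | Δ 1 z ≠ 0} → 0 < limitVariance P lam η Δ) := by
  have hfm : Measurable f := hf.mono markedEdgeSets_le le_rfl
  obtain ⟨hft, hex⟩ := hstab
  refine ⟨memLp_two_window hη hfm hft hmom, exists_isLimitAddOneCost hη hfm hmom hex,
    fun Δ hΔ => ⟨fun t => ?_, integrable_condSecondMoment hη hfm hmom hΔ,
      fun W hW => tendsto_variance_div_volume hlam.le hη hfm hft hmom hΔ hW,
      limitVariance_pos hlam hη hfm hmom hΔ⟩⟩
  exact ((hΔ t).tendsto_eLpNorm hη hfm hmom (tendsToSpace_centeredCube (d := d))).1
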